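/- Let $(R,\mathfrak m)$ be a Cohen--Macaulay (in particular Noetherian) local ring of dimension $d\ge 2$ with infinite residue field, and let $I$ be an $\mathfrak m$-primary ideal of $R$. For all large $r$ and $s$ the length of $R/\mathfrak m^rI^s$ can be written uniquely as $$\ell(R/\mathfrak m^rI^s)=\sum_{i+j\le d}e_{ij}\binom{r+i}{i}\binom{s+j}{j},\qquad e_{ij}\in\mathbb Z,$$ and the mixed multiplicities of $\mathfrak m$ and $I$ are $e_j(\mathfrak m|I):=e_{d-j,\,j}$ for $0\le j\le d$. Suppose that $I$ has minimal mixed multiplicity, that is, $$\mu(I)=e_{d-1}(\mathfrak m|I)+d-1,$$ where $\mu(I)$ is the minimal number of generators of $I$. Let $R(I)=\bigoplus_{n\ge0}I^nt^n$ be the Rees ring, $G(I)=R(I)/I\,R(I)=\bigoplus_{n\ge0}I^n/I^{n+1}$ the associated graded ring and $F(I)=R(I)/\mathfrak m\,R(I)=\bigoplus_{n\ge0}I^n/\mathfrak mI^n$ the fiber cone of $I$. If $F(I)$ is Cohen--Macaulay, then $G(I)$ and $R(I)$ are Cohen--Macaulay. -/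

import Mathlib

open IsLocalRing

namespace BlowupAlgebras

universe u

section CohenMacaulay

/-- The depth of a local ring `A`: the supremum of the lengths of the `A`-regular sequences
contained in the maximal ideal. -/
noncomputable def localDepth (A : Type u) [CommRing A] [IsLocalRing A] : ℕ∞ :=
  ⨆ (rs : List A) (_ : (∀ r ∈ rs, r ∈ maximalIdeal A) ∧ RingTheory.Sequence.IsRegular A rs),
    (rs.length : ℕ∞)

/-- A Cohen–Macaulay local ring: a Noetherian local ring whose depth equals its Krull
dimension. -/
def IsCohenMacaulayLocalRing (A : Type u) [CommRing A] [IsLocalRing A] : Prop :=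
  IsNoetherianRing A ∧ (localDepth A : WithBot ℕ∞) = ringKrullDim A

/-- A Cohen–Macaulay ring: a Noetherian ring all of whose localizations at maximal ideals are
Cohen–Macaulay local rings. -/
def IsCohenMacaulayRing (A : Type u) [CommRing A] : Prop :=
  IsNoetherianRing A ∧
    ∀ (P : Ideal A) [P.IsMaximal], IsCohenMacaulayLocalRing (Localization.AtPrime P)

end CohenMacaulay

section Blowup

variable {R : Type u} [CommRing R]

/-- `R(I) / J R(I) = ⨁ₙ Iⁿ / J Iⁿ`, where `R(I) = R[It] = ⨁ₙ Iⁿ tⁿ` is the Rees algebra of `I`.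
See `mem_map_reesAlgebra_iff` for the description of the graded pieces. -/
abbrev ReesQuotient (I J : Ideal R) : Type u :=
  reesAlgebra I ⧸ J.map (algebraMap R (reesAlgebra I))

/-- The associated graded ring `G(I) = R(I) / I R(I) = ⨁ₙ Iⁿ / Iⁿ⁺¹`. -/
abbrev AssociatedGradedRing (I : Ideal R) : Type u := ReesQuotient I I

/-- The fiber cone `F(I) = R(I) / 𝔪 R(I) = ⨁ₙ Iⁿ / 𝔪 Iⁿ` of an ideal of a local ring. -/
abbrev FiberCone [IsLocalRing R] (I : Ideal R) : Type u := ReesQuotient I (maximalIdeal R)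

/-- The ideal `J R(I)` of the Rees algebra is `⨁ₙ J Iⁿ tⁿ`. -/
theorem mem_map_reesAlgebra_iff (I J : Ideal R) (f : reesAlgebra I) :
    f ∈ J.map (algebraMap R (reesAlgebra I)) ↔ ∀ n, (f : Polynomial R).coeff n ∈ J * I ^ n := by
  constructor
  · intro hf
    refine Submodule.span_induction
      (p := fun (g : reesAlgebra I) _ => ∀ n, (g : Polynomial R).coeff n ∈ J * I ^ n)
      ?_ ?_ ?_ ?_ hf
    · rintro _ ⟨a, ha, rfl⟩ n
      change (Polynomial.C a).coeff n ∈ _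
      rw [Polynomial.coeff_C]
      split_ifs with h
      · subst h; simpa using ha
      · exact zero_mem _
    · intro n
      simp
    · intro x y _ _ hx hy n
      simpa using add_mem (hx n) (hy n)
    · intro a x _ hx n
      rw [smul_eq_mul, MulMemClass.coe_mul, Polynomial.coeff_mul]
      refine Ideal.sum_mem _ fun p hp => ?_
      rw [← Finset.HasAntidiagonal.mem_antidiagonal.mp hp, pow_add, mul_left_comm]
      exact Ideal.mul_mem_mul (a.2 p.1) (hx p.2)
  · intro hf
    have key : ∀ n, ∀ c ∈ J * I ^ n, ∃ g ∈ J.map (algebraMap R (reesAlgebra I)),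
        (g : Polynomial R) = Polynomial.monomial n c := by
      intro n c hc
      refine Submodule.mul_induction_on hc ?_ ?_
      · intro a ha b hb
        refine ⟨algebraMap R _ a * ⟨Polynomial.monomial n b, reesAlgebra.monomial_mem.mpr hb⟩,
          Ideal.mul_mem_right _ _ (Ideal.mem_map_of_mem _ ha), ?_⟩
        change Polynomial.C a * Polynomial.monomial n b = _
        rw [Polynomial.C_mul_monomial]
      · rintro x y ⟨g, hg, hgx⟩ ⟨h, hh, hhy⟩
        exact ⟨g + h, add_mem hg hh, by simp [hgx, hhy]⟩
    choose g hg hgc using fun n => key n _ (hf n)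
    have : f = ∑ n ∈ (f : Polynomial R).support, g n := by
      apply Subtype.ext
      rw [AddSubmonoidClass.coe_finsetSum]
      simp only [hgc]
      exact Polynomial.as_sum_support _
    rw [this]
    exact sum_mem fun n _ => hg n

end Blowup

section MixedMultiplicity

variable {R : Type u} [CommRing R] [IsLocalRing R]

/-- The integers `e i j` (`i + j ≤ d`) are the coefficients of the Bhattacharya polynomial of
`𝔪` and `I`: for all large `r` and `s`,
`ℓ(R / 𝔪 ^ r I ^ s) = ∑_{i + j ≤ d} e i j * (r + i choose i) * (s + j choose j)`.
For `I` an `𝔪`-primary ideal of a Noetherian local ring all these lengths are finite. -/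
def IsBhattacharyaCoeff (d : ℕ) (I : Ideal R) (e : ℕ → ℕ → ℤ) : Prop :=
  ∃ N : ℕ, ∀ r s : ℕ, N ≤ r → N ≤ s →
    ((Module.length R (R ⧸ (maximalIdeal R ^ r * I ^ s))).toNat : ℤ) =
      ∑ i ∈ Finset.range (d + 1), ∑ j ∈ Finset.range (d + 1 - i),
        e i j * ((r + i).choose i : ℤ) * ((s + j).choose j : ℤ)

open Classical in
/-- The mixed multiplicity `e_j(𝔪 | I)` of an `𝔪`-primary ideal `I` in a local ring of
dimension `d`, for `j ≤ d`: the coefficient `e (d - j) j` of the Bhattacharya polynomial. -/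
noncomputable def mixedMultiplicity (d : ℕ) (I : Ideal R) (j : ℕ) : ℤ :=
  if h : ∃ e, IsBhattacharyaCoeff d I e then h.choose (d - j) j else 0

/-- `I` has minimal mixed multiplicity (in a local ring of dimension `d`):
`μ(I) = e_{d-1}(𝔪 | I) + d - 1`, with `μ(I)` the minimal number of generators of `I`. -/
def HasMinimalMixedMultiplicity (d : ℕ) (I : Ideal R) : Prop :=
  (Submodule.spanFinrank I : ℤ) = mixedMultiplicity d I (d - 1) + (d : ℤ) - 1

/-- Linear independence of the functions `r ↦ (r + i choose i)`, for large `r`. -/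
theorem binomial_coeff_unique (n : ℕ) : ∀ (N : ℕ) (c : ℕ → ℤ),
    (∀ r, N ≤ r → ∑ i ∈ Finset.range n, c i * ((r + i).choose i : ℤ) = 0) →
    ∀ i < n, c i = 0 := by
  induction n with
  | zero => intro _ _ _ i hi; omega
  | succ n ih =>
    intro N c h
    have h1 : ∀ i < n, c (i + 1) = 0 := by
      refine ih (N + 1) (fun i => c (i + 1)) ?_
      intro r hr
      obtain ⟨r, rfl⟩ : ∃ q, r = q + 1 := ⟨r - 1, by omega⟩
      have e1 := h (r + 1) (by omega)
      have e2 := h r (by omega)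
      rw [Finset.sum_range_succ'] at e1 e2
      have : ∀ i, ((r + 1 + (i + 1)).choose (i + 1) : ℤ)
          = ((r + 1 + i).choose i : ℤ) + ((r + (i + 1)).choose (i + 1) : ℤ) := by
        intro i
        have := Nat.choose_succ_succ (r + 1 + i) i
        rw [show r + (i + 1) = r + 1 + i by ring]
        exact_mod_cast this
      simp only [this, mul_add, Finset.sum_add_distrib] at e1
      simp only [add_zero, Nat.choose_zero_right] at e1 e2
      linarith
    have h0 : c 0 = 0 := by
      have := h N le_rfl
      rw [Finset.sum_range_succ', Finset.sum_eq_zero] at this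
      · simpa using this
      · intro i hi
        rw [h1 i (Finset.mem_range.mp hi), zero_mul]
    intro i hi
    cases i with
    | zero => exact h0
    | succ i => exact h1 i (by omega)

/-- The coefficients of the Bhattacharya polynomial are unique. -/
theorem IsBhattacharyaCoeff.unique {d : ℕ} {I : Ideal R} {e e' : ℕ → ℕ → ℤ}
    (h : IsBhattacharyaCoeff d I e) (h' : IsBhattacharyaCoeff d I e') {i j : ℕ}
    (hij : i + j ≤ d) : e i j = e' i j := by
  obtain ⟨N, hN⟩ := h
  obtain ⟨N', hN'⟩ := h'
  have key : ∀ s, max N N' ≤ s → ∑ j ∈ Finset.range (d + 1 - i),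
      (e i j - e' i j) * ((s + j).choose j : ℤ) = 0 := by
    intro s hs
    refine binomial_coeff_unique (d + 1) (max N N')
      (fun i => ∑ j ∈ Finset.range (d + 1 - i), (e i j - e' i j) * ((s + j).choose j : ℤ))
      ?_ i (by omega)
    intro r hr
    have := (hN r s (le_trans (le_max_left _ _) hr) (le_trans (le_max_left _ _) hs)).symm.trans
      (hN' r s (le_trans (le_max_right _ _) hr) (le_trans (le_max_right _ _) hs))
    rw [← sub_eq_zero, ← Finset.sum_sub_distrib] at this
    rw [← this]
    refine Finset.sum_congr rfl fun i _ => ?_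
    rw [← Finset.sum_sub_distrib, Finset.sum_mul]
    exact Finset.sum_congr rfl fun j _ => by ring
  exact sub_eq_zero.mp (binomial_coeff_unique _ _ (fun j => e i j - e' i j) key j (by omega))

/-- The mixed multiplicities are computed by any Bhattacharya polynomial. -/
theorem IsBhattacharyaCoeff.mixedMultiplicity_eq {d : ℕ} {I : Ideal R} {e : ℕ → ℕ → ℤ}
    (h : IsBhattacharyaCoeff d I e) {j : ℕ} (hj : j ≤ d) :
    mixedMultiplicity d I j = e (d - j) j := by
  have hex : ∃ e, IsBhattacharyaCoeff d I e := ⟨e, h⟩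
  rw [mixedMultiplicity, dif_pos hex]
  exact hex.choose_spec.unique h (by omega)

end MixedMultiplicity

end BlowupAlgebras

/-!
The proof shows that `I` has reduction number at most one, `I² = (a₁, …, a_d) I` for a
regular sequence `a₁, …, a_d ∈ I`, and that this makes `G(I)` and `R(I)` Cohen–Macaulay.

**Reduction number.** The residue field being infinite, there are `a₁, …, a_d ∈ I` that form a
regular sequence on `R` and whose images `aᵢt` form a regular sequence on the fiber cone, the
first `d - 1` of them moreover being superficial for the pair `(𝔪, I)`. For the second condition,
if fewer than `d` of the `aᵢt` have been chosen, some form of degree one avoids every associated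
prime of the quotient of `F(I)`: since `F(I)` is Cohen–Macaulay, an associated prime containing
all forms of degree one would make the chosen elements generate a reduction of `I`, and a
reduction needs at least `d` generators (`exists_reesDegreeOne_notMem_of_mem_associatedPrimes`,
`exists_isWeaklyRegular_append_of_infinite`). Superficiality turns passage from `R` to
`R / (a₁, …, aᵢ)` into taking differences of the function `ℓ(R / 𝔪ʳIˢ)` in the variable `s`
(`exists_list_superficial`). With `J = (a₁, …, a_{d-1})` and one general `x ∈ 𝔪` this gives
`e := e_{d-1}(𝔪|I) = ℓ(R / (J + xR))` (`exists_eq_colength_sup_span_singleton`). Now consider the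
lengths of `Iⁿ / (J Iⁿ⁻¹ + 𝔪 Iⁿ)`. For `n = 1` the length is at least `μ(I) - (d - 1) = e`; for
large `n` it is at most `e`, because `J ∩ Iⁿ = J Iⁿ⁻¹` then and `R / J` has dimension one
(`relLength_le_colength`); and it does not decrease with `n`, because multiplication by `a_d t` is
injective on `F(I) / (a₁t, …, a_{d-1}t)`. Hence all the lengths agree, the first multiplication is
surjective, and Nakayama's lemma gives `I² = (a₁, …, a_d) I` (`exists_isWeaklyRegular_sq_le_mul`).

**Associated graded ring.** Put `q = (a₁, …, a_d)` and let `B = R[X₁, …, X_d]` act on the Rees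
algebra through `Xᵢ ↦ aᵢt`. As `I² = qI`, the `B`-module `G(I)` is an extension of `B / IB` by
`IB / qB`, up to a shift in degree: the forms of the regular sequence `a₁, …, a_d` have no
relations beyond the obvious ones. At any maximal ideal, polynomials `pᵢ(aᵢt)` with `pᵢ` monic
form a regular sequence of length `d` on both ends of the extension, hence on `G(I)`
(`isCohenMacaulayRing_associatedGradedRing`).

**Rees algebra.** A maximal ideal that does not contain `I` gives a localization of `R[t]`. At one
that contains `I` but not some `aᵢt`, the element `aᵢ` generates `I R(I)` locally, and
a regular sequence on `G(I)` lifts. At the graded maximal ideal the sequence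
`a₁, a₁t - a₂, …, a_{d-1}t - a_d, a_dt` is regular, by induction on `d`, and generates an ideal
whose radical is the graded maximal ideal (`isCohenMacaulayRing_reesAlgebra`).
-/

open RingTheory.Sequence
open scoped Pointwise TensorProduct

namespace BlowupAlgebras

universe u v

/-! ### Depth of modules over local rings -/

section Depth

variable {A : Type u} [CommRing A] [IsLocalRing A]

/-- If no nonzero element of a finite module over a Noetherian local ring is killed by the maximal
ideal, then the maximal ideal contains an element that is regular on the module. -/
theorem exists_isSMulRegular_of_socle_eq_zero [IsNoetherianRing A] (M : Type v) [AddCommGroup M]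
    [Module A M] [Module.Finite A M] (h : ∀ u : M, (∀ a ∈ maximalIdeal A, a • u = 0) → u = 0) :
    ∃ z ∈ maximalIdeal A, IsSMulRegular M z := by
  by_contra hcon
  push Not at hcon
  have hsub : (maximalIdeal A : Set A) ⊆ ⋃ p ∈ associatedPrimes A M, (p : Set A) := by
    intro z hz
    rw [biUnion_associatedPrimes_eq_compl_regular A M]
    exact hcon z hz
  obtain ⟨p, hp, hle⟩ := (Ideal.subset_union_prime_finite (associatedPrimes.finite A M)
    (f := id) ⊥ ⊥ (fun i hi _ _ => hi.1)).mp hsub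
  obtain ⟨hpp, x, hx⟩ := (isAssociatedPrime_iff (I := p) (M := M)).mp hp
  have hx0 : x = 0 := h x fun a ha => by
    have : a ∈ p := hle ha
    rw [hx, Submodule.mem_colon_singleton] at this
    simpa using this
  apply hpp.ne_top
  rw [hx, hx0]
  ext; simp [Submodule.mem_colon_singleton]

/-- If `x` and `y` are regular on `M`, then `M / xM` and `M / yM` have isomorphic socles; in
particular one socle vanishes if the other one does. -/
theorem socle_quotSMulTop_eq_zero {M : Type v} [AddCommGroup M] [Module A M] {x y : A}
    (hy : y ∈ maximalIdeal A) (hxr : IsSMulRegular M x) (hyr : IsSMulRegular M y)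
    (h : ∀ u : QuotSMulTop y M, (∀ a ∈ maximalIdeal A, a • u = 0) → u = 0) :
    ∀ u : QuotSMulTop x M, (∀ a ∈ maximalIdeal A, a • u = 0) → u = 0 := by
  intro u hu
  obtain ⟨u, rfl⟩ := Submodule.Quotient.mk_surjective _ u
  have key : ∀ a ∈ maximalIdeal A, ∃ w, x • w = a • u := by
    intro a ha
    have := hu a ha
    rw [← Submodule.Quotient.mk_smul, Submodule.Quotient.mk_eq_zero,
      Submodule.mem_smul_pointwise_iff_exists] at this
    obtain ⟨w, -, hw⟩ := this
    exact ⟨w, hw⟩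
  obtain ⟨v, hv⟩ := key y hy
  have hv0 : (Submodule.Quotient.mk v : QuotSMulTop y M) = 0 := by
    apply h
    intro a ha
    obtain ⟨w, hw⟩ := key a ha
    rw [← Submodule.Quotient.mk_smul, Submodule.Quotient.mk_eq_zero,
      Submodule.mem_smul_pointwise_iff_exists]
    refine ⟨w, trivial, hxr ?_⟩
    change x • y • w = x • a • v
    rw [smul_comm x y, hw, smul_comm x a, hv, smul_comm]
  rw [Submodule.Quotient.mk_eq_zero, Submodule.mem_smul_pointwise_iff_exists] at hv0 ⊢
  obtain ⟨w, -, rfl⟩ := hv0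
  refine ⟨w, trivial, hyr ?_⟩
  change y • x • w = y • u
  rw [← hv, smul_comm]

/-- Every regular element of the maximal ideal can be completed to a weakly regular sequence as
long as any given weakly regular sequence in the maximal ideal. This is the part of the theory of
depth that says that all maximal regular sequences have the same length. The proof exchanges the
first elements of two regular sequences by means of a common regular element. -/
theorem exists_isWeaklyRegular_cons [IsNoetherianRing A] (n : ℕ) : ∀ (M : Type v) [AddCommGroup M]
    [Module A M] [Module.Finite A M] (x : A), x ∈ maximalIdeal A → IsSMulRegular M x →
    ∀ rs : List A, (∀ r ∈ rs, r ∈ maximalIdeal A) → IsWeaklyRegular M rs → rs.length = n + 1 →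
    ∃ rs' : List A, (∀ r ∈ rs', r ∈ maximalIdeal A) ∧ IsWeaklyRegular M (x :: rs') ∧
      rs'.length = n := by
  have swap : ∀ (M : Type v) [AddCommGroup M] [Module A M] [Module.Finite A M] (x y : A)
      (rs : List A), (∀ r ∈ x :: y :: rs, r ∈ maximalIdeal A) →
      IsWeaklyRegular M (x :: y :: rs) → IsWeaklyRegular M (y :: x :: rs) := by
    intro M _ _ _ x y rs hmem h
    exact IsLocalRing.isWeaklyRegular_of_perm_of_subset_maximalIdeal h (List.Perm.swap _ _ _) hmem
  induction n with
  | zero =>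
    intro M _ _ _ x hx hxr rs hrs h hl
    exact ⟨[], by simp, (isWeaklyRegular_singleton_iff M x).mpr hxr, rfl⟩
  | succ n ih =>
    intro M _ _ _ x hx hxr rs hrs h hl
    obtain ⟨y, y₂, ys, rfl⟩ : ∃ y y₂ ys, rs = y :: y₂ :: ys := by
      match rs, hl with
      | y :: y₂ :: ys, _ => exact ⟨y, y₂, ys, rfl⟩
    simp only [List.mem_cons, forall_eq_or_imp] at hrs
    obtain ⟨hy, hy₂, hys⟩ := hrs
    obtain ⟨hyr, h'⟩ := (isWeaklyRegular_cons_iff M _ _).mp h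
    obtain ⟨hy₂r, h''⟩ := (isWeaklyRegular_cons_iff _ _ _).mp h'
    -- `M / xM` and `M / yM` have zero socle, which yields an element `z` regular on both
    have hs1 : ∀ u : QuotSMulTop y M, (∀ a ∈ maximalIdeal A, a • u = 0) → u = 0 :=
      fun u hu => hy₂r.right_eq_zero_of_smul (hu y₂ hy₂)
    have hs2 := socle_quotSMulTop_eq_zero hy hxr hyr hs1
    obtain ⟨z, hz, hzr⟩ := exists_isSMulRegular_of_socle_eq_zero
      (QuotSMulTop x M × QuotSMulTop y M) (fun u hu => Prod.ext
        (hs2 u.1 fun a ha => congrArg Prod.fst (hu a ha))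
        (hs1 u.2 fun a ha => congrArg Prod.snd (hu a ha)))
    have hzx : IsSMulRegular (QuotSMulTop x M) z := fun a b hab => by
      have := @hzr (a, 0) (b, 0) (Prod.ext hab rfl)
      exact congrArg Prod.fst this
    have hzy : IsSMulRegular (QuotSMulTop y M) z := fun a b hab => by
      have := @hzr (0, a) (0, b) (Prod.ext rfl hab)
      exact congrArg Prod.snd this
    -- exchange `y` for `z`, and then `z` for `x`
    obtain ⟨rs', hrs', hw', hl'⟩ := ih (QuotSMulTop y M) z hz hzy (y₂ :: ys)
      (by simpa using ⟨hy₂, hys⟩) h' (by simpa using hl)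
    have h1 : IsWeaklyRegular M (z :: y :: rs') :=
      swap M y z rs' (by simpa using ⟨hy, hz, hrs'⟩) (.cons hyr hw')
    have h2 : IsWeaklyRegular M [z, x] :=
      swap M x z [] (by simpa using ⟨hx, hz⟩)
        (.cons hxr ((isWeaklyRegular_singleton_iff _ z).mpr hzx))
    obtain ⟨hzr', h1'⟩ := (isWeaklyRegular_cons_iff M _ _).mp h1
    have hxz := (isWeaklyRegular_singleton_iff _ x).mp ((isWeaklyRegular_cons_iff M _ _).mp h2).2
    obtain ⟨rs'', hrs'', hw'', hl''⟩ := ih (QuotSMulTop z M) x hx hxz (y :: rs')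
      (by simpa using ⟨hy, hrs'⟩) h1' (by simp [hl'])
    refine ⟨z :: rs'', by simpa using ⟨hz, hrs''⟩,
      swap M z x rs'' (by simpa using ⟨hz, hx, hrs''⟩) (.cons hzr' hw''), by simp [hl'']⟩

/-- If `x` is regular on `M` and `q` is an associated prime of `M`, then some associated prime of
`M / xM` contains both `q` and `x`. -/
theorem exists_mem_associatedPrimes_quotSMulTop [IsNoetherianRing A] {M : Type v} [AddCommGroup M]
    [Module A M] [Module.Finite A M] {x : A} (hx : x ∈ maximalIdeal A) (hxr : IsSMulRegular M x)
    {q : Ideal A} (hq : q ∈ associatedPrimes A M) :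
    ∃ q' ∈ associatedPrimes A (QuotSMulTop x M), q ≤ q' ∧ x ∈ q' := by
  obtain ⟨hqp, w, hw⟩ := (isAssociatedPrime_iff (I := q) (M := M)).mp hq
  have hqw : ∀ a, a ∈ q ↔ a • w = 0 := fun a => by
    rw [hw, Submodule.mem_colon_singleton]; simp
  -- the submodule of the elements killed by `q` is nonzero, so by Nakayama's lemma it is not
  -- contained in `x M`
  let N : Submodule A M := {
    carrier := {m | ∀ a ∈ q, a • m = 0}
    add_mem' := fun {m n} hm hn a ha => by rw [smul_add, hm a ha, hn a ha, add_zero]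
    zero_mem' := fun a _ => smul_zero a
    smul_mem' := fun c m hm a ha => by rw [smul_comm, hm a ha, smul_zero] }
  have hwN : w ∈ N := fun a ha => (hqw a).mp ha
  obtain ⟨v, hvN, hv⟩ : ∃ v ∈ N, v ∉ (x • ⊤ : Submodule A M) := by
    by_contra hcon
    push Not at hcon
    have h1 : N ≤ Ideal.span {x} • N := by
      intro v hv
      obtain ⟨v', -, rfl⟩ := Submodule.mem_smul_pointwise_iff_exists _ _ _ |>.mp (hcon v hv)
      refine Submodule.smul_mem_smul (Ideal.mem_span_singleton_self x) fun a ha => ?_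
      have := hv a ha
      rw [smul_comm] at this
      exact hxr.right_eq_zero_of_smul this
    have h2 : N = ⊥ := Submodule.eq_bot_of_le_smul_of_le_jacobson_bot (Ideal.span {x}) N
      (IsNoetherian.noetherian N) h1 (by
        rw [Ideal.span_singleton_le_iff_mem, IsLocalRing.jacobson_eq_maximalIdeal _ bot_ne_top]
        exact hx)
    have hw0 : w = 0 := by rw [h2] at hwN; exact hwN
    exact hqp.ne_top (Ideal.eq_top_iff_one _ |>.mpr ((hqw 1).mpr (by simp [hw0])))
  have hv0 : (Submodule.Quotient.mk v : QuotSMulTop x M) ≠ 0 := by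
    rwa [Ne, Submodule.Quotient.mk_eq_zero]
  obtain ⟨q', hq', hle⟩ := exists_le_isAssociatedPrime_of_isNoetherianRing A _ hv0
  refine ⟨q', hq', fun a ha => hle ?_, hle ?_⟩
  · rw [Submodule.mem_colon_singleton, ← Submodule.Quotient.mk_smul, hvN a ha]
    simp
  · rw [Submodule.mem_colon_singleton, ← Submodule.Quotient.mk_smul, Submodule.mem_bot,
      Submodule.Quotient.mk_eq_zero]
    exact Submodule.smul_mem_pointwise_smul _ _ _ trivial

/-- The depth of a module is at most the dimension of `A / q` for each associated prime `q`. -/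
theorem length_le_ringKrullDim_quotient_of_mem_associatedPrimes [IsNoetherianRing A]
    (rs : List A) :
    ∀ (M : Type v) [AddCommGroup M] [Module A M] [Module.Finite A M],
    (∀ r ∈ rs, r ∈ maximalIdeal A) → IsWeaklyRegular M rs → ∀ q ∈ associatedPrimes A M,
    (rs.length : WithBot ℕ∞) ≤ ringKrullDim (A ⧸ q) := by
  induction rs with
  | nil =>
    intro M _ _ _ _ _ q hq
    have := hq.1
    simpa using ringKrullDim_nonneg_of_nontrivial
  | cons x rs ih =>
    intro M _ _ _ hmem h q hq
    simp only [List.mem_cons, forall_eq_or_imp] at hmem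
    obtain ⟨hxr, h'⟩ := (isWeaklyRegular_cons_iff M _ _).mp h
    obtain ⟨q', hq', hle, hxq'⟩ := exists_mem_associatedPrimes_quotSMulTop hmem.1 hxr hq
    have h1 := ih (QuotSMulTop x M) hmem.2 h' q' hq'
    obtain ⟨hqp, w, hw⟩ := (isAssociatedPrime_iff (I := q) (M := M)).mp hq
    have hxq : x ∉ q := by
      intro hxq
      rw [hw, Submodule.mem_colon_singleton] at hxq
      have hw0 : w = 0 := hxr.right_eq_zero_of_smul hxq
      apply hqp.ne_top
      rw [hw, hw0]
      ext; simp [Submodule.mem_colon_singleton]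
    have h2 : ringKrullDim (A ⧸ q') + 1 ≤ ringKrullDim (A ⧸ q) := by
      refine ringKrullDim_succ_le_of_surjective (Ideal.Quotient.factor hle)
        (Ideal.Quotient.factor_surjective hle) (r := Ideal.Quotient.mk q x) ?_ ?_
      · rw [mem_nonZeroDivisors_iff_ne_zero, Ne, Ideal.Quotient.eq_zero_iff_mem]
        exact hxq
      · simpa [Ideal.Quotient.eq_zero_iff_mem] using hxq'
    refine le_trans ?_ h2
    rw [List.length_cons, Nat.cast_succ]
    gcongr

end Depth

/-! ### Cohen–Macaulay local rings -/

section CohenMacaulayLocal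

/-- `A` is a Noetherian local ring of dimension `n` whose maximal ideal contains a weakly regular
sequence of length `n`. For elements of the maximal ideal, regularity and weak regularity on `A`
agree. -/
structure IsCohenMacaulayOfDim (A : Type u) [CommRing A] [IsLocalRing A] (n : ℕ) : Prop where
  isNoetherianRing : IsNoetherianRing A
  ringKrullDim_eq : ringKrullDim A = n
  exists_isWeaklyRegular : ∃ rs : List A, (∀ r ∈ rs, r ∈ maximalIdeal A) ∧
    IsWeaklyRegular A rs ∧ rs.length = n

theorem length_le_ringKrullDim_of_isWeaklyRegular {A : Type u} [CommRing A] [IsLocalRing A]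
    [IsNoetherianRing A] {rs : List A} (hmem : ∀ r ∈ rs, r ∈ maximalIdeal A)
    (h : IsWeaklyRegular A rs) : (rs.length : WithBot ℕ∞) ≤ ringKrullDim A := by
  have hreg : IsRegular A rs := IsRegular.of_isWeaklyRegular_of_mem_maximalIdeal _ hmem h
  rw [← ringKrullDim_add_length_eq_ringKrullDim_of_isRegular rs hreg]
  have : Nontrivial (A ⧸ Ideal.ofList rs) := by
    have := hreg.quot_ofList_smul_nontrivial (⊤ : Submodule A A)
    rwa [Ideal.smul_eq_mul, Ideal.mul_top] at this
  exact le_add_of_nonneg_left ringKrullDim_nonneg_of_nontrivial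

/-- The depth is attained by a sequence, since it is bounded by the finite dimension. -/
theorem isCohenMacaulayLocalRing_iff {A : Type u} [CommRing A] [IsLocalRing A] :
    IsCohenMacaulayLocalRing A ↔ ∃ n, IsCohenMacaulayOfDim A n := by
  constructor
  · rintro ⟨hN, hd⟩
    obtain ⟨n, hn⟩ : ∃ n : ℕ, ringKrullDim A = n := by
      have h1 := ringKrullDim_ne_top (R := A)
      rw [← hd] at h1 ⊢
      generalize localDepth A = k at h1
      induction k with
      | top => exact absurd rfl h1
      | coe k => exact ⟨k, rfl⟩
    rw [hn] at hd
    replace hd : localDepth A = n := by exact_mod_cast hd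
    refine ⟨n, hN, hn, ?_⟩
    by_contra hcon
    push Not at hcon
    have hle : localDepth A ≤ ((n - 1 : ℕ) : ℕ∞) := by
      refine iSup₂_le fun rs ⟨hmem, hrs⟩ => ?_
      have h1 := length_le_ringKrullDim_of_isWeaklyRegular hmem hrs.toIsWeaklyRegular
      rw [hn] at h1
      have h2 : rs.length ≤ n := by exact_mod_cast h1
      have h3 := hcon rs hmem hrs.toIsWeaklyRegular
      exact_mod_cast (by omega : rs.length ≤ n - 1)
    rw [hd] at hle
    have h4 : n ≤ n - 1 := by exact_mod_cast hle
    exact hcon [] (by simp) (IsWeaklyRegular.nil A A) (by simp; omega)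
  · rintro ⟨n, hN, hn, rs, hmem, hrs, hl⟩
    refine ⟨hN, le_antisymm ?_ ?_⟩
    · rw [hn]
      have : localDepth A ≤ n := by
        refine iSup₂_le fun rs ⟨hmem, hrs⟩ => ?_
        have h1 := length_le_ringKrullDim_of_isWeaklyRegular hmem hrs.toIsWeaklyRegular
        rw [hn] at h1
        exact_mod_cast h1
      exact_mod_cast this
    · rw [hn]
      have : (n : ℕ∞) ≤ localDepth A := by
        rw [← hl]
        exact le_iSup₂_of_le rs ⟨hmem, IsRegular.of_isWeaklyRegular_of_mem_maximalIdeal _ hmem hrs⟩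
          le_rfl
      exact_mod_cast this

theorem isWeaklyRegular_cons_iff_quotient {A : Type u} [CommRing A] (x : A) (rs : List A) :
    IsWeaklyRegular A (x :: rs) ↔ IsSMulRegular A x ∧
      IsWeaklyRegular (A ⧸ Ideal.span {x}) (rs.map (Ideal.Quotient.mk (Ideal.span {x}))) := by
  rw [isWeaklyRegular_cons_iff]
  refine and_congr_right fun _ => ?_
  have e : QuotSMulTop x A ≃ₗ[A] A ⧸ Ideal.span {x} :=
    Submodule.quotEquivOfEq _ _ (by simp [← Submodule.ideal_span_singleton_smul])
  rw [e.isWeaklyRegular_congr]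
  exact (isWeaklyRegular_map_algebraMap_iff (A ⧸ Ideal.span {x}) _ rs).symm

/-- Criterion for a localization to be Cohen–Macaulay, in terms of a sequence in the ring. -/
theorem isCohenMacaulayLocalRing_atPrime {A : Type u} [CommRing A] [IsNoetherianRing A]
    (P : Ideal A) [P.IsPrime] (rs : List A) (hmem : ∀ r ∈ rs, r ∈ P)
    (h : IsWeaklyRegular (Localization.AtPrime P) rs) (hht : P.height ≤ rs.length) :
    IsCohenMacaulayLocalRing (Localization.AtPrime P) := by
  have hN : IsNoetherianRing (Localization.AtPrime P) :=
    IsLocalization.isNoetherianRing P.primeCompl _ inferInstance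
  have hw := (isWeaklyRegular_map_algebraMap_iff (Localization.AtPrime P)
    (Localization.AtPrime P) rs).mpr h
  have hmem' : ∀ r ∈ rs.map (algebraMap A (Localization.AtPrime P)),
      r ∈ maximalIdeal (Localization.AtPrime P) := by
    intro r hr
    obtain ⟨s, hs, rfl⟩ := List.mem_map.mp hr
    exact (IsLocalization.AtPrime.to_map_mem_maximal_iff _ P s).mpr (hmem s hs)
  have hd := IsLocalization.AtPrime.ringKrullDim_eq_height P (Localization.AtPrime P)
  refine isCohenMacaulayLocalRing_iff.mpr ⟨rs.length, hN, le_antisymm ?_ ?_, _, hmem', hw,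
    by simp⟩
  · rw [hd]
    exact_mod_cast hht
  · simpa using length_le_ringKrullDim_of_isWeaklyRegular hmem' hw

/-- Krull's height theorem. -/
theorem height_le_length_of_mem_minimalPrimes {A : Type u} [CommRing A] [IsNoetherianRing A]
    {P : Ideal A} {rs : List A} (h : P ∈ (Ideal.ofList rs).minimalPrimes) :
    P.height ≤ rs.length := by
  classical
  have h1 : Ideal.ofList rs = Ideal.span (rs.toFinset : Set A) := by
    simp [Ideal.ofList]
  rw [h1] at h
  refine (Ideal.height_le_card_of_mem_minimalPrimes_span_finset h).trans ?_
  exact_mod_cast rs.toFinset_card_le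

/-- The quotient by a regular element has smaller dimension, and keeps a regular sequence of the
right length by `exists_isWeaklyRegular_cons`. -/
theorem IsCohenMacaulayOfDim.quotient_span_singleton {A : Type u} [CommRing A] [IsLocalRing A]
    {n : ℕ} (h : IsCohenMacaulayOfDim A (n + 1)) {x : A} (hx : x ∈ maximalIdeal A)
    (hxr : IsSMulRegular A x) [IsLocalRing (A ⧸ Ideal.span {x})] :
    IsCohenMacaulayOfDim (A ⧸ Ideal.span {x}) n := by
  obtain ⟨hN, hd, rs, hmem, hrs, hl⟩ := h
  refine ⟨inferInstance, ?_, ?_⟩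
  · have h1 := ringKrullDim_quotient_span_singleton_succ_eq_ringKrullDim hxr hx
    rw [hd] at h1
    rw [Nat.cast_succ] at h1
    exact ENat.WithBot.add_one_cancel.mp h1
  · obtain ⟨rs', hmem', hrs', hl'⟩ := exists_isWeaklyRegular_cons n A x hx hxr rs hmem hrs hl
    refine ⟨rs'.map (Ideal.Quotient.mk _), ?_, ?_, by simpa using hl'⟩
    · intro r hr
      obtain ⟨s, hs, rfl⟩ := List.mem_map.mp hr
      have := IsLocalHom.of_surjective _ (Ideal.Quotient.mk_surjective (I := Ideal.span {x}))
      exact map_nonunit _ _ (hmem' s hs)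
    · exact ((isWeaklyRegular_cons_iff_quotient x rs').mp hrs').2

/-- Every prime `p` of a Cohen–Macaulay local ring contains a regular sequence of length at least
the height of `p`. If `p` is not minimal, then it contains a regular element, because all
associated primes `q` satisfy `dim A / q = dim A` and hence are minimal. -/
theorem IsCohenMacaulayOfDim.exists_isWeaklyRegular_of_isPrime (n : ℕ) :
    ∀ (A : Type u) [CommRing A] [IsLocalRing A], IsCohenMacaulayOfDim A n →
    ∀ (p : Ideal A) [p.IsPrime], ∃ rs : List A, (∀ r ∈ rs, r ∈ p) ∧ IsWeaklyRegular A rs ∧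
      p.height ≤ rs.length := by
  induction n with
  | zero =>
    intro A _ _ h p _
    refine ⟨[], by simp, .nil A A, ?_⟩
    have h1 := p.height_le_ringKrullDim_of_isPrime
    rw [h.ringKrullDim_eq] at h1
    exact_mod_cast h1
  | succ n ih =>
    intro A _ _ h p _
    have := h.isNoetherianRing
    by_cases hp : p ∈ minimalPrimes A
    · refine ⟨[], by simp, .nil A A, ?_⟩
      rw [Ideal.height_eq_zero_iff.mpr hp]
      simp
    obtain ⟨x, hxp, hxr⟩ : ∃ x ∈ p, IsSMulRegular A x := by
      by_contra hcon
      push Not at hcon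
      have hsub : (p : Set A) ⊆ ⋃ q ∈ associatedPrimes A A, (q : Set A) := by
        rw [biUnion_associatedPrimes_eq_compl_regular A A]
        exact fun z hz => hcon z hz
      obtain ⟨q, hq, hle⟩ := (Ideal.subset_union_prime_finite (associatedPrimes.finite A A)
        (f := id) ⊥ ⊥ (fun i hi _ _ => hi.1)).mp hsub
      have hqp := hq.1
      obtain ⟨rs, hmem, hrs, hl⟩ := h.exists_isWeaklyRegular
      have h1 := length_le_ringKrullDim_quotient_of_mem_associatedPrimes rs A hmem hrs q hq
      apply hp
      obtain ⟨q', hq', hle'⟩ := Ideal.exists_minimalPrimes_le (bot_le : (⊥ : Ideal A) ≤ q)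
      have := hq'.1.1
      suffices hqq : q' = q by
        have hpq : p = q' := le_antisymm (hle.trans hqq.ge)
          (hq'.2 ⟨‹p.IsPrime›, bot_le⟩ (hle.trans hqq.ge))
        rw [hpq]; exact hq'
      by_contra hne
      obtain ⟨y, hy, hy'⟩ := SetLike.exists_of_lt (lt_of_le_of_ne hle' hne)
      have h2 : ringKrullDim (A ⧸ q) + 1 ≤ ringKrullDim (A ⧸ q') := by
        refine ringKrullDim_succ_le_of_surjective (Ideal.Quotient.factor hle')
          (Ideal.Quotient.factor_surjective hle') (r := Ideal.Quotient.mk q' y) ?_ ?_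
        · rw [mem_nonZeroDivisors_iff_ne_zero, Ne, Ideal.Quotient.eq_zero_iff_mem]
          exact hy'
        · simpa [Ideal.Quotient.eq_zero_iff_mem] using hy
      have h3 := ringKrullDim_quotient_le q'
      rw [h.ringKrullDim_eq] at h3
      rw [hl] at h1
      have h4 : ((n + 1 : ℕ) : WithBot ℕ∞) + 1 ≤ (n + 1 : ℕ) :=
        (add_le_add_left h1 1).trans (h2.trans h3)
      have h5 : n + 1 + 1 ≤ n + 1 := by exact_mod_cast h4
      omega
    have hxm : x ∈ maximalIdeal A := le_maximalIdeal (Ideal.IsPrime.ne_top ‹_›) hxp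
    have hle : Ideal.span {x} ≤ p := (Ideal.span_singleton_le_iff_mem p).mpr hxp
    have : Nontrivial (A ⧸ Ideal.span {x}) := Ideal.Quotient.nontrivial_iff.mpr
      (ne_top_of_le_ne_top (Ideal.IsPrime.ne_top ‹_›) hle)
    have : IsLocalRing (A ⧸ Ideal.span {x}) := .of_surjective' _ Ideal.Quotient.mk_surjective
    have hpq : (p.map (Ideal.Quotient.mk (Ideal.span {x}))).IsPrime :=
      Ideal.map_isPrime_of_surjective Ideal.Quotient.mk_surjective (by rwa [Ideal.mk_ker])
    obtain ⟨rs, hmem, hrs, hht⟩ := ih _ (h.quotient_span_singleton hxm hxr)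
      (p.map (Ideal.Quotient.mk (Ideal.span {x})))
    choose! g hg using Ideal.Quotient.mk_surjective (I := Ideal.span {x})
    refine ⟨x :: rs.map g, ?_, ?_, ?_⟩
    · simp only [List.mem_cons, List.mem_map, forall_eq_or_imp, forall_exists_index, and_imp,
        forall_apply_eq_imp_iff₂]
      refine ⟨hxp, fun r hr => ?_⟩
      have h1 := hmem r hr
      rw [← hg r, Ideal.mem_quotient_iff_mem hle] at h1
      exact h1
    · rw [isWeaklyRegular_cons_iff_quotient]
      refine ⟨hxr, ?_⟩
      simpa [Function.comp_def, hg] using hrs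
    · refine (Ideal.height_le_height_add_one_of_mem hxp).trans ?_
      simpa using hht

end CohenMacaulayLocal

/-! ### Polynomial rings over Cohen–Macaulay rings -/

section PolynomialExtension

open Polynomial

/-- Over a domain, a prime of the polynomial ring that contracts to zero has height at most one. -/
theorem height_le_one_of_comap_C_eq_bot {D : Type u} [CommRing D] [IsDomain D] (q : Ideal D[X])
    [q.IsPrime] (hq : q.comap (C : D →+* D[X]) = ⊥) : q.height ≤ 1 := by
  let K := FractionRing D
  let _ : Algebra D[X] K[X] := Polynomial.algebra D K
  have hloc : IsLocalization ((nonZeroDivisors D).map (C : D →+* D[X])) K[X] :=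
    Polynomial.isLocalization (nonZeroDivisors D) K
  have hdisj : Disjoint (((nonZeroDivisors D).map (C : D →+* D[X]) : Submonoid D[X]) : Set D[X])
      (q : Set D[X]) := by
    refine Set.disjoint_left.mpr ?_
    rintro _ ⟨b, hb, rfl⟩ hbq
    have : b ∈ q.comap (C : D →+* D[X]) := hbq
    rw [hq] at this
    exact nonZeroDivisors.ne_zero hb this
  have h1 := IsLocalization.height_map_of_disjoint (S := K[X])
    ((nonZeroDivisors D).map (C : D →+* D[X])) q hdisj
  have := IsLocalization.isPrime_of_isPrime_disjoint _ K[X] q ‹_› hdisj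
  have h2 := Ideal.height_le_ringKrullDim_of_isPrime (I := q.map (algebraMap D[X] K[X]))
  rw [h1, Polynomial.ringKrullDim_of_isNoetherianRing, ringKrullDim_eq_zero_of_field, zero_add]
    at h2
  exact_mod_cast h2

/-- A prime `Q` of `A[X]` has height at most one more than its contraction `p` to `A`, and at most
the height of `p` if `Q = p A[X]`. -/
theorem height_le_height_comap_C_add_one {A : Type u} [CommRing A] [IsNoetherianRing A]
    (Q : Ideal A[X]) [Q.IsPrime] :
    Q.height ≤ (Q.comap (C : A →+* A[X])).height + 1 ∧
      (Q = (Q.comap (C : A →+* A[X])).map C → Q.height ≤ (Q.comap (C : A →+* A[X])).height) := by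
  set p := Q.comap (C : A →+* A[X]) with hp
  have : p.IsPrime := Ideal.comap_isPrime _ _
  have : Q.LiesOver p := ⟨hp⟩
  have h1 := Ideal.height_le_height_add_of_liesOver p Q
  have hle : p.map (algebraMap A A[X]) ≤ Q := Ideal.map_comap_le
  have hq : (Q.map (Ideal.Quotient.mk <| p.map (algebraMap A A[X]))).IsPrime :=
    Ideal.map_isPrime_of_surjective Ideal.Quotient.mk_surjective (by rwa [Ideal.mk_ker])
  have hpC : (p.map (C : A →+* A[X])).IsPrime := Ideal.isPrime_map_C_of_isPrime
  refine ⟨h1.trans (add_le_add le_rfl ?_), fun hQ => h1.trans ?_⟩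
  · let e : (A[X] ⧸ (p.map (algebraMap A A[X]))) ≃+* (A ⧸ p)[X] :=
      (Ideal.polynomialQuotientEquivQuotientPolynomial p).symm
    rw [← e.height_map <| Q.map (Ideal.Quotient.mk <| p.map (algebraMap A A[X]))]
    have := Ideal.map_isPrime_of_equiv e
      (I := Q.map (Ideal.Quotient.mk <| p.map (algebraMap A A[X])))
    apply height_le_one_of_comap_C_eq_bot
    rw [eq_bot_iff]
    intro c hc
    obtain ⟨a, rfl⟩ := Ideal.Quotient.mk_surjective c
    rw [Ideal.mem_comap] at hc
    have h2 : e (Ideal.Quotient.mk _ (C a)) = C (Ideal.Quotient.mk p a) := by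
      have := Ideal.polynomialQuotientEquivQuotientPolynomial_symm_mk p (C a)
      rw [Polynomial.map_C] at this
      exact this
    rw [← h2, Ideal.mem_map_of_equiv] at hc
    obtain ⟨x, hx, hxe⟩ := hc
    rw [e.injective hxe, Ideal.mem_quotient_iff_mem hle] at hx
    exact Ideal.Quotient.eq_zero_iff_mem.mpr hx
  · have h3 : Q.map (Ideal.Quotient.mk <| p.map (algebraMap A A[X])) = ⊥ := by
      rw [Ideal.map_eq_bot_iff_le_ker, Ideal.mk_ker]
      exact hQ.le
    have : (p.map (algebraMap A A[X])).IsPrime := hpC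
    rw [h3, Ideal.height_bot, add_zero]

theorem eq_zero_of_mul_eq_zero_of_isUnit_coeff {B : Type u} [CommRing B] {f h : B[X]} {i : ℕ}
    (hf : IsUnit (f.coeff i)) (hfh : f * h = 0) : h = 0 := by
  have hfr : f ∈ nonZeroDivisors B[X] := by
    rw [Polynomial.mem_nonZeroDivisors_iff]
    intro a ha
    have h1 := congrArg (fun g => g.coeff i) ha
    simp only [coeff_smul, coeff_zero, smul_eq_mul] at h1
    exact (hf.mul_left_eq_zero).mp h1
  exact (mul_left_mem_nonZeroDivisors_eq_zero_iff hfr).mp hfh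

/-- A polynomial that has a coefficient outside `p` is regular modulo the extension of an ideal
`𝔞` of `A`, up to elements outside `p`. This is McCoy's theorem over `A_p / 𝔞 A_p`. -/
theorem exists_C_mul_mem_map_C {A : Type u} [CommRing A] (p 𝔞 : Ideal A) [p.IsPrime]
    {f h : A[X]} (hf : f ∉ p.map (C : A →+* A[X])) (hfh : f * h ∈ 𝔞.map (C : A →+* A[X])) :
    ∃ w ∉ p, C w * h ∈ 𝔞.map (C : A →+* A[X]) := by
  let Ap := Localization.AtPrime p
  let φ : A →+* Ap ⧸ 𝔞.map (algebraMap A Ap) := (Ideal.Quotient.mk _).comp (algebraMap A Ap)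
  have hφ : ∀ a, φ a = 0 → ∃ w ∉ p, w * a ∈ 𝔞 := by
    intro a ha
    have h1 : algebraMap A Ap a ∈ 𝔞.map (algebraMap A Ap) := Ideal.Quotient.eq_zero_iff_mem.mp ha
    rw [IsLocalization.algebraMap_mem_map_algebraMap_iff p.primeCompl] at h1
    exact h1
  have h0 : ∀ a ∈ 𝔞, φ a = 0 := fun a ha =>
    Ideal.Quotient.eq_zero_iff_mem.mpr (Ideal.mem_map_of_mem _ ha)
  obtain ⟨i, hi⟩ : ∃ i, f.coeff i ∉ p := by
    by_contra hcon
    push Not at hcon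
    exact hf (Ideal.mem_map_C_iff.mpr hcon)
  have hh : h.map φ = 0 := by
    have hu : IsUnit ((f.map φ).coeff i) := by
      rw [coeff_map]
      exact (IsLocalization.map_units Ap (⟨_, hi⟩ : p.primeCompl)).map (Ideal.Quotient.mk _)
    refine eq_zero_of_mul_eq_zero_of_isUnit_coeff hu ?_
    rw [← Polynomial.map_mul]
    ext n
    rw [coeff_map, coeff_zero]
    exact h0 _ (Ideal.mem_map_C_iff.mp hfh n)
  have h2 : ∀ n, ∃ w ∉ p, w * h.coeff n ∈ 𝔞 := fun n => hφ _ (by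
    have := congrArg (fun g => g.coeff n) hh
    simpa using this)
  choose w hw hwm using h2
  refine ⟨∏ n ∈ h.support, w n, ?_, ?_⟩
  · rw [Ideal.IsPrime.prod_mem_iff]
    push Not
    exact fun n _ => hw n
  · rw [Ideal.mem_map_C_iff]
    intro n
    rw [coeff_C_mul]
    by_cases hn : n ∈ h.support
    · rw [← Finset.mul_prod_erase _ _ hn, mul_comm (w n), mul_assoc]
      exact Ideal.mul_mem_left _ _ (hwm n)
    · rw [notMem_support_iff.mp hn, mul_zero]
      exact zero_mem _

/-- The polynomial ring inherits the Cohen–Macaulay property: if the prime `p = Q ∩ A` contains a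
regular sequence of length at least the height of `p`, then `Q` contains one on `A[X]_Q` of length
at least the height of `Q`. If `Q ≠ p A[X]`, it is prolonged by any element of `Q` outside
`p A[X]`. -/
theorem exists_isWeaklyRegular_polynomial {A : Type u} [CommRing A] [IsNoetherianRing A]
    (Q : Ideal A[X]) [Q.IsPrime] (L : Type v) [CommRing L] [Algebra A[X] L]
    [IsLocalization.AtPrime L Q] (xs : List A) (hmem : ∀ x ∈ xs, C x ∈ Q)
    (hxs : IsWeaklyRegular A xs) (hht : (Q.comap (C : A →+* A[X])).height ≤ xs.length) :
    ∃ fs : List A[X], (∀ f ∈ fs, f ∈ Q) ∧ IsWeaklyRegular L fs ∧ Q.height ≤ fs.length := by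
  obtain ⟨h1, h2⟩ := height_le_height_comap_C_add_one Q
  have hw : IsWeaklyRegular A[X] (xs.map (C : A →+* A[X])) := hxs.of_flat
  have hwL : IsWeaklyRegular L (xs.map (C : A →+* A[X])) :=
    (isWeaklyRegular_map_algebraMap_iff L L _).mp (hw.of_isLocalization L Q.primeCompl)
  have hmem' : ∀ f ∈ xs.map (C : A →+* A[X]), f ∈ Q := by
    intro f hf
    obtain ⟨x, hx, rfl⟩ := List.mem_map.mp hf
    exact hmem x hx
  by_cases hQ : Q = (Q.comap (C : A →+* A[X])).map C
  · exact ⟨xs.map C, hmem', hwL, (h2 hQ).trans (by simpa using hht)⟩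
  set p := Q.comap (C : A →+* A[X]) with hp
  have hpp : p.IsPrime := Ideal.comap_isPrime _ _
  obtain ⟨f, hfQ, hf⟩ := SetLike.exists_of_lt
    (lt_of_le_of_ne (Ideal.map_comap_le : p.map (C : A →+* A[X]) ≤ Q) (Ne.symm hQ))
  refine ⟨xs.map C ++ [f], ?_, ?_, ?_⟩
  · simp only [List.mem_append, List.mem_singleton]
    rintro g (hg | rfl)
    exacts [hmem' g hg, hfQ]
  · rw [isWeaklyRegular_append_iff, isWeaklyRegular_singleton_iff]
    refine ⟨hwL, ?_⟩
    have hmap : ∀ u : L, u ∈ (Ideal.ofList (xs.map (C : A →+* A[X])) • ⊤ : Submodule A[X] L) ↔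
        u ∈ ((Ideal.ofList xs).map (C : A →+* A[X])).map (algebraMap A[X] L) := by
      intro u
      rw [Ideal.smul_top_eq_map, Ideal.map_ofList C xs]
      rfl
    rw [isSMulRegular_quotient_iff_mem_of_smul_mem]
    intro u hu
    rw [hmap] at hu ⊢
    obtain ⟨g, s, rfl⟩ := IsLocalization.exists_mk'_eq Q.primeCompl u
    have h3 : algebraMap A[X] L (f * g) ∈
        ((Ideal.ofList xs).map (C : A →+* A[X])).map (algebraMap A[X] L) := by
      have h4 := Ideal.mul_mem_left _ (algebraMap A[X] L s) hu
      have h5 : algebraMap A[X] L s * (f • IsLocalization.mk' L g s) =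
          algebraMap A[X] L (f * g) := by
        rw [Algebra.smul_def, mul_left_comm, IsLocalization.mk'_spec'_mk, map_mul]
      rwa [h5] at h4
    rw [IsLocalization.algebraMap_mem_map_algebraMap_iff Q.primeCompl] at h3
    obtain ⟨m, hm, h6⟩ := h3
    rw [mul_left_comm] at h6
    obtain ⟨w, hw, h7⟩ := exists_C_mul_mem_map_C p _ hf h6
    rw [← mul_assoc] at h7
    have h8 : algebraMap A[X] L g ∈
        ((Ideal.ofList xs).map (C : A →+* A[X])).map (algebraMap A[X] L) := by
      rw [IsLocalization.algebraMap_mem_map_algebraMap_iff Q.primeCompl]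
      exact ⟨C w * m, Q.primeCompl.mul_mem hw hm, h7⟩
    rw [IsLocalization.mk'_eq_mul_mk'_one]
    exact Ideal.mul_mem_right _ _ h8
  · refine h1.trans ?_
    simp only [List.length_append, List.length_map, List.length_singleton, Nat.cast_add,
      Nat.cast_one]
    gcongr

end PolynomialExtension

/-! ### The Rees algebra away from the ideal -/

section ReesAlgebraAwayFromIdeal

open Polynomial

variable {R : Type u} [CommRing R] {I : Ideal R}

/-- The element `c tⁿ` of the Rees algebra, for `c ∈ Iⁿ`. -/
noncomputable def reesMonomial (n : ℕ) (c : R) (hc : c ∈ I ^ n) : reesAlgebra I :=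
  ⟨monomial n c, reesAlgebra.monomial_mem.mpr hc⟩

@[simp]
theorem coe_reesMonomial (n : ℕ) (c : R) (hc : c ∈ I ^ n) :
    (reesMonomial n c hc : R[X]) = monomial n c := rfl

theorem coe_algebraMap_reesAlgebra (c : R) :
    ((algebraMap R (reesAlgebra I) c : reesAlgebra I) : R[X]) = C c := rfl

theorem eq_sum_reesMonomial (f : reesAlgebra I) :
    f = ∑ n ∈ (f : R[X]).support, reesMonomial n ((f : R[X]).coeff n) (f.2 n) := by
  apply Subtype.ext
  rw [AddSubmonoidClass.coe_finsetSum]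
  exact Polynomial.as_sum_support _

theorem reesMonomial_one_pow (b : R) (hb : b ∈ I ^ 1) (n : ℕ) :
    reesMonomial 1 b hb ^ n = reesMonomial n (b ^ n)
      (Ideal.pow_mem_pow (by simpa using hb) n) := by
  apply Subtype.ext
  change (monomial 1 b : R[X]) ^ n = monomial n (b ^ n)
  rw [monomial_pow, one_mul]

theorem algebraMap_mul_reesMonomial (a : R) (n : ℕ) (c : R) (hc : c ∈ I ^ n) :
    algebraMap R (reesAlgebra I) a * reesMonomial n c hc =
      reesMonomial n (a * c) (Ideal.mul_mem_left _ _ hc) :=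
  Subtype.ext (C_mul_monomial ..)

/-- At a prime `P` that does not contain `I`, the Rees algebra is a localization of the polynomial
ring `R[t]`; so it inherits the Cohen–Macaulay property from `R`. -/
theorem isCohenMacaulayLocalRing_reesAlgebra_of_notMem [IsLocalRing R]
    (hR : IsCohenMacaulayLocalRing R) (P : Ideal (reesAlgebra I)) [P.IsPrime] {b : R} (hb : b ∈ I)
    (hbP : algebraMap R (reesAlgebra I) b ∉ P) :
    IsCohenMacaulayLocalRing (Localization.AtPrime P) := by
  have := hR.1
  let L := Localization.AtPrime P
  have hb1 : b ∈ I ^ 1 := by simpa using hb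
  let ι : reesAlgebra I →+* L := algebraMap (reesAlgebra I) L
  let β : P.primeCompl := ⟨algebraMap R (reesAlgebra I) b, hbP⟩
  -- `t` acts on the localization as `b t / b`
  let τ : L := IsLocalization.mk' L (reesMonomial 1 b hb1) β
  let ψ : R[X] →+* L := eval₂RingHom (ι.comp (algebraMap R (reesAlgebra I))) τ
  have hβ : IsUnit (ι β) := IsLocalization.map_units L β
  have hβτ : ι β * τ = ι (reesMonomial 1 b hb1) := IsLocalization.mk'_spec' L _ β
  have hψ : ∀ g : reesAlgebra I, ψ g = ι g := by
    intro g
    rw [eq_sum_reesMonomial g, AddSubmonoidClass.coe_finsetSum, map_sum, map_sum]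
    refine Finset.sum_congr rfl fun n _ => ?_
    refine (hβ.pow n).mul_left_cancel ?_
    have h1 : ψ (monomial n ((g : R[X]).coeff n)) =
        ι (algebraMap R (reesAlgebra I) ((g : R[X]).coeff n)) * τ ^ n := by
      simp [ψ]
    rw [coe_reesMonomial, h1, mul_left_comm, ← mul_pow, hβτ, ← map_pow, ← map_pow, ← map_mul,
      ← map_mul, reesMonomial_one_pow]
    congr 1
    rw [algebraMap_mul_reesMonomial, ← map_pow, algebraMap_mul_reesMonomial]
    simp [mul_comm]
  have hmul : ∀ f : R[X], ∃ n, C (b ^ n) * f ∈ reesAlgebra I := by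
    intro f
    refine ⟨f.natDegree, fun i => ?_⟩
    rw [coeff_C_mul]
    by_cases hi : i ≤ f.natDegree
    · exact Ideal.mul_mem_right _ _ (Ideal.pow_le_pow_right hi (Ideal.pow_mem_pow hb _))
    · rw [coeff_eq_zero_of_natDegree_lt (by omega), mul_zero]
      exact zero_mem _
  have hψb : ∀ n, ψ (C (b ^ n)) = ι (β : reesAlgebra I) ^ n := fun n => by
    simp only [map_pow, ψ, coe_eval₂RingHom, eval₂_C]
    rfl
  -- The facts about the localization at `P` come before the `R[t]`-algebra structure on it, which
  -- induces a second algebra structure over the Rees algebra.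
  have hLN : IsNoetherianRing L := IsLocalization.isNoetherianRing P.primeCompl _ inferInstance
  have hmax : ∀ s, ι s ∈ maximalIdeal L ↔ s ∈ P := IsLocalization.AtPrime.to_map_mem_maximal_iff L P
  have hsurj : ∀ z : L, ∃ g s : reesAlgebra I, s ∉ P ∧ z * ι s = ι g := by
    intro z
    obtain ⟨g, s, rfl⟩ := IsLocalization.exists_mk'_eq P.primeCompl z
    exact ⟨g, s, s.2, IsLocalization.mk'_spec L g s⟩
  have hzero : ∀ x, ι x = 0 → ∃ s : reesAlgebra I, s ∉ P ∧ s * x = 0 := by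
    intro x hx
    obtain ⟨s, hs⟩ := (IsLocalization.map_eq_zero_iff P.primeCompl L _).mp hx
    exact ⟨s, s.2, hs⟩
  let _ : Algebra R[X] L := ψ.toAlgebra
  let Q : Ideal R[X] := (maximalIdeal L).comap ψ
  have hQ : Q.IsPrime := Ideal.comap_isPrime _ _
  have hPQ : ∀ s : reesAlgebra I, s ∉ P → (s : R[X]) ∈ Q.primeCompl := by
    intro s hs hsQ
    have h1 : ψ s ∈ maximalIdeal L := hsQ
    rw [hψ] at h1
    exact hs ((hmax s).mp h1)
  have hloc : IsLocalization.AtPrime L Q := by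
    refine ⟨?_, ?_, ?_⟩
    · rintro ⟨y, hy⟩
      by_contra hu
      exact hy ((mem_maximalIdeal _).mpr hu)
    · intro z
      obtain ⟨g, s, hs, hgs⟩ := hsurj z
      refine ⟨⟨g, ⟨s, hPQ s hs⟩⟩, ?_⟩
      change z * ψ s = ψ g
      rw [hψ, hψ, hgs]
    · intro f g hfg
      have h0 : ψ (f - g) = 0 := by
        rw [map_sub, sub_eq_zero]
        exact hfg
      obtain ⟨n, hn⟩ := hmul (f - g)
      have h1 : ι ⟨_, hn⟩ = 0 := by
        rw [← hψ, map_mul, h0, mul_zero]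
      obtain ⟨s, hsP, hs⟩ := hzero _ h1
      have h2 : (s : R[X]) * (C (b ^ n) * (f - g)) = 0 := congrArg Subtype.val hs
      refine ⟨⟨(s : reesAlgebra I) * C (b ^ n), Q.primeCompl.mul_mem (hPQ s hsP) ?_⟩, ?_⟩
      · intro hmem
        have h3 : ψ (C (b ^ n)) ∈ maximalIdeal L := hmem
        rw [hψb] at h3
        exact h3 (hβ.pow n)
      · rw [← sub_eq_zero, ← mul_sub, mul_assoc]
        exact h2
  obtain ⟨n, hn⟩ := isCohenMacaulayLocalRing_iff.mp hR
  obtain ⟨xs, hxs, hw, hht⟩ := hn.exists_isWeaklyRegular_of_isPrime n R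
    (Q.comap (C : R →+* R[X]))
  obtain ⟨fs, hfs, hfw, hfht⟩ := exists_isWeaklyRegular_polynomial Q L xs hxs hw hht
  have hd := IsLocalization.AtPrime.ringKrullDim_eq_height Q L
  have hmem' : ∀ r ∈ fs.map (algebraMap R[X] L), r ∈ maximalIdeal L := by
    intro r hr
    obtain ⟨f, hf, rfl⟩ := List.mem_map.mp hr
    exact hfs f hf
  have hw' := (isWeaklyRegular_map_algebraMap_iff L L fs).mpr hfw
  refine isCohenMacaulayLocalRing_iff.mpr ⟨fs.length, hLN, le_antisymm ?_ ?_, _, hmem', hw',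
    by simp⟩
  · rw [hd]
    exact_mod_cast hfht
  · simpa using length_le_ringKrullDim_of_isWeaklyRegular hmem' hw'

end ReesAlgebraAwayFromIdeal

/-! ### Regular sequences and exact sequences -/

section ExactSequences

variable {S : Type u} [CommRing S] {M₁ M₂ M₃ : Type v} [AddCommGroup M₁] [Module S M₁]
  [AddCommGroup M₂] [Module S M₂] [AddCommGroup M₃] [Module S M₃]

/-- A short exact sequence stays exact on the left modulo an element that is regular on the last
term. -/
theorem quotSMulTop_map_injective {f : M₁ →ₗ[S] M₂} {g : M₂ →ₗ[S] M₃} (hf : Function.Injective f)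
    (hfg : Function.Exact f g) {r : S} (hr : IsSMulRegular M₃ r) :
    Function.Injective (QuotSMulTop.map r f) := by
  rw [injective_iff_map_eq_zero]
  intro x hx
  obtain ⟨x, rfl⟩ := Submodule.Quotient.mk_surjective _ x
  rw [QuotSMulTop.map_apply_mk, Submodule.Quotient.mk_eq_zero,
    Submodule.mem_smul_pointwise_iff_exists] at hx
  obtain ⟨y, -, hy⟩ := hx
  have h1 : g y = 0 := by
    apply hr.right_eq_zero_of_smul
    rw [← map_smul, hy]
    exact hfg.apply_apply_eq_zero x
  obtain ⟨z, rfl⟩ := (hfg y).mp h1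
  rw [Submodule.Quotient.mk_eq_zero, Submodule.mem_smul_pointwise_iff_exists]
  exact ⟨z, trivial, hf (by rw [map_smul, hy])⟩

theorem isWeaklyRegular_of_exact (rs : List S) : ∀ {M₁ M₂ M₃ : Type v} [AddCommGroup M₁]
    [Module S M₁] [AddCommGroup M₂] [Module S M₂] [AddCommGroup M₃] [Module S M₃]
    {f : M₁ →ₗ[S] M₂} {g : M₂ →ₗ[S] M₃}, Function.Injective f → Function.Exact f g →
    Function.Surjective g → IsWeaklyRegular M₁ rs → IsWeaklyRegular M₃ rs →
    IsWeaklyRegular M₂ rs := by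
  induction rs with
  | nil => intro _ _ M₃ _ _ _ _ _ _ f g _ _ _ _ _; exact .nil S _
  | cons r rs ih =>
    intro M₁ M₂ M₃ _ _ _ _ _ _ f g hf hfg hg h₁ h₃
    rw [isWeaklyRegular_cons_iff] at h₁ h₃ ⊢
    refine ⟨isSMulRegular_of_range_eq_ker hf hfg.linearMap_ker_eq.symm h₁.1 h₃.1, ?_⟩
    exact ih (quotSMulTop_map_injective hf hfg h₃.1) (QuotSMulTop.map_exact r hfg hg)
      (QuotSMulTop.map_surjective r hg) h₁.2 h₃.2

theorem isWeaklyRegular_of_exact_left (rs : List S) : ∀ {M₁ M₂ M₃ : Type v} [AddCommGroup M₁]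
    [Module S M₁] [AddCommGroup M₂] [Module S M₂] [AddCommGroup M₃] [Module S M₃]
    {f : M₁ →ₗ[S] M₂} {g : M₂ →ₗ[S] M₃}, Function.Injective f → Function.Exact f g →
    Function.Surjective g → IsWeaklyRegular M₂ rs → IsWeaklyRegular M₃ rs →
    IsWeaklyRegular M₁ rs := by
  induction rs with
  | nil => intro M₁ _ _ _ _ _ _ _ _ f g _ _ _ _ _; exact .nil S _
  | cons r rs ih =>
    intro M₁ M₂ M₃ _ _ _ _ _ _ f g hf hfg hg h₂ h₃
    rw [isWeaklyRegular_cons_iff] at h₂ h₃ ⊢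
    refine ⟨fun x y hxy => hf (h₂.1 ?_), ?_⟩
    · change r • f x = r • f y
      rw [← map_smul, ← map_smul]
      exact congrArg f hxy
    · exact ih (quotSMulTop_map_injective hf hfg h₃.1) (QuotSMulTop.map_exact r hfg hg)
        (QuotSMulTop.map_surjective r hg) h₂.2 h₃.2

theorem isWeaklyRegular_neg_cons {M : Type v} [AddCommGroup M] [Module S M] {x : S} {rs : List S}
    (h : IsWeaklyRegular M (x :: rs)) : IsWeaklyRegular M (-x :: rs) := by
  rw [isWeaklyRegular_cons_iff] at h ⊢
  refine ⟨fun a b hab => h.1 (by simpa using hab), ?_⟩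
  have e : QuotSMulTop (-x) M ≃ₗ[S] QuotSMulTop x M := Submodule.quotEquivOfEq _ _ (by
    rw [← Submodule.ideal_span_singleton_smul, ← Submodule.ideal_span_singleton_smul,
      Ideal.span_singleton_neg])
  exact (e.isWeaklyRegular_congr rs).mpr h.2

end ExactSequences

/-! ### Powers of an ideal generated by a regular sequence -/

section PowersOfRegularSequences

variable {R : Type u} [CommRing R]

theorem mem_left_of_mem_mul {I J : Ideal R} {x : R} (h : x ∈ I * J) : x ∈ I :=
  Ideal.mul_le_left h

theorem isWeaklyRegular_append_singleton_iff (l : List R) (a : R) :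
    IsWeaklyRegular R (l ++ [a]) ↔ IsWeaklyRegular R l ∧
      ∀ c, a * c ∈ Ideal.ofList l → c ∈ Ideal.ofList l := by
  rw [isWeaklyRegular_append_iff, isWeaklyRegular_singleton_iff,
    isSMulRegular_quotient_iff_mem_of_smul_mem]
  simp

theorem ofList_append_singleton (l : List R) (a : R) :
    Ideal.ofList (l ++ [a]) = Ideal.ofList l ⊔ Ideal.span {a} := by
  rw [Ideal.ofList_append, Ideal.ofList_singleton]

theorem sup_span_singleton_pow_succ_le (q : Ideal R) (a : R) (n : ℕ) :
    (q ⊔ Ideal.span {a}) ^ (n + 1) ≤ q ^ (n + 1) ⊔ Ideal.span {a} * (q ⊔ Ideal.span {a}) ^ n := by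
  induction n with
  | zero => simp
  | succ n ih =>
    rw [pow_succ' _ (n + 1)]
    nth_rewrite 1 [Ideal.sup_mul]
    refine sup_le ?_ le_sup_right
    refine (Ideal.mul_mono_right ih).trans ?_
    rw [Ideal.mul_sup, ← pow_succ']
    refine sup_le_sup_left ?_ _
    rw [mul_left_comm, pow_succ' _ n]
    exact Ideal.mul_mono_right (Ideal.mul_mono_left le_sup_left)

theorem exists_add_mul_of_mem_sup_pow_mul {q J : Ideal R} {a c : R} {n : ℕ}
    (hc : c ∈ (q ⊔ Ideal.span {a}) ^ (n + 1) * J) :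
    ∃ p ∈ q ^ (n + 1) * J, ∃ w ∈ (q ⊔ Ideal.span {a}) ^ n * J, c = p + a * w := by
  have h1 := Ideal.mul_mono_left (K := J) (sup_span_singleton_pow_succ_le q a n) hc
  rw [Ideal.sup_mul, mul_assoc] at h1
  obtain ⟨p, hp, y, hy, rfl⟩ := Submodule.mem_sup.mp h1
  obtain ⟨w, hw, rfl⟩ := Ideal.mem_span_singleton_mul.mp hy
  exact ⟨p, hp, w, hw, rfl⟩

/-- If `b` is regular modulo an ideal `J` that contains the ideal `q` of a regular sequence, then
`b` is regular on `qⁿ / qⁿ J`. -/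
theorem mem_pow_mul_of_mul_mem {l : List R} (hl : IsWeaklyRegular R l) :
    ∀ J : Ideal R, Ideal.ofList l ≤ J → ∀ b : R, (∀ c, b * c ∈ J → c ∈ J) →
    ∀ n, ∀ u ∈ Ideal.ofList l ^ n, b * u ∈ Ideal.ofList l ^ n * J →
      u ∈ Ideal.ofList l ^ n * J := by
  induction l using List.reverseRecOn with
  | nil =>
    intro J _ b hb n u hu hbu
    rw [Ideal.ofList_nil] at *
    cases n with
    | zero => simpa using hb u (by simpa using hbu)
    | succ n => simpa [pow_succ] using hu
  | append_singleton l a ih =>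
    obtain ⟨hl', ha⟩ := (isWeaklyRegular_append_singleton_iff l a).mp hl
    replace ih := ih hl'
    rw [ofList_append_singleton]
    set q' := Ideal.ofList l with hq'
    -- `a` is regular modulo the powers of `q'`
    have hpow : ∀ n c, a * c ∈ q' ^ n → c ∈ q' ^ n := by
      intro n
      induction n with
      | zero => simp
      | succ n ihn =>
        intro c hc
        rw [pow_succ] at hc ⊢
        exact ih q' le_rfl a ha n c (ihn c (mem_left_of_mem_mul hc)) hc
    intro J hJ b hb n
    have hqJ : q' ≤ J := le_sup_left.trans hJ
    have haJ : a ∈ J := hJ (le_sup_right (a := q') (Ideal.mem_span_singleton_self a))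
    have hle : ∀ n, q' ^ n ≤ (q' ⊔ Ideal.span {a}) ^ n :=
      fun n => Ideal.pow_right_mono le_sup_left n
    induction n with
    | zero =>
      intro u _ hbu
      simpa using hb u (by simpa using hbu)
    | succ n ihn =>
      intro u hu hbu
      obtain ⟨u', hu', v, hv, rfl⟩ : ∃ u' ∈ q' ^ (n + 1), ∃ v ∈ (q' ⊔ Ideal.span {a}) ^ n,
          u = u' + a * v := by
        simpa using exists_add_mul_of_mem_sup_pow_mul (J := ⊤) (by simpa using hu)
      obtain ⟨p, hp, w, hw, hpw⟩ := exists_add_mul_of_mem_sup_pow_mul hbu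
      -- `b v` lies in `qⁿ J`, so the inductive hypothesis on the exponent applies to `v`
      have h1 : b * v - w ∈ q' ^ (n + 1) := by
        apply hpow
        have : a * (b * v - w) = p - b * u' := by linear_combination hpw
        rw [this]
        exact sub_mem (mem_left_of_mem_mul hp) (Ideal.mul_mem_left _ _ hu')
      have h2 : q' ^ (n + 1) ≤ (q' ⊔ Ideal.span {a}) ^ n * J := by
        rw [pow_succ]
        exact Ideal.mul_mono (hle n) hqJ
      have h3 : b * v ∈ (q' ⊔ Ideal.span {a}) ^ n * J := by
        have := add_mem (h2 h1) hw
        simpa using this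
      have h4 : a * v ∈ (q' ⊔ Ideal.span {a}) ^ (n + 1) * J := by
        rw [pow_succ', mul_assoc]
        exact Ideal.mul_mem_mul (le_sup_right (a := q') (Ideal.mem_span_singleton_self a))
          (ihn v hv h3)
      have h5 : b * u' ∈ (q' ⊔ Ideal.span {a}) ^ (n + 1) * J := by
        have : b * u' = b * (u' + a * v) - b * (a * v) := by ring
        rw [this]
        exact sub_mem hbu (Ideal.mul_mem_left _ _ h4)
      -- `b u'` lies in `q'ⁿ⁺¹ J`, so the inductive hypothesis on the sequence applies to `u'`
      obtain ⟨p₂, hp₂, w₂, -, hpw₂⟩ := exists_add_mul_of_mem_sup_pow_mul h5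
      have h6 : w₂ ∈ q' ^ (n + 1) := by
        apply hpow
        have : a * w₂ = b * u' - p₂ := by linear_combination -hpw₂
        rw [this]
        exact sub_mem (Ideal.mul_mem_left _ _ hu') (mem_left_of_mem_mul hp₂)
      have h7 : b * u' ∈ q' ^ (n + 1) * J := by
        rw [hpw₂, mul_comm a]
        exact add_mem hp₂ (Ideal.mul_mem_mul h6 haJ)
      exact add_mem (Ideal.mul_mono_left (hle _) (ih J hqJ b hb _ u' hu' h7)) h4

theorem mem_pow_of_mul_mem {l : List R} (hl : IsWeaklyRegular R l) {a : R}
    (ha : ∀ c, a * c ∈ Ideal.ofList l → c ∈ Ideal.ofList l) (n : ℕ) :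
    ∀ c, a * c ∈ Ideal.ofList l ^ n → c ∈ Ideal.ofList l ^ n := by
  induction n with
  | zero => simp
  | succ n ihn =>
    intro c hc
    rw [pow_succ] at hc ⊢
    exact mem_pow_mul_of_mul_mem hl _ le_rfl a ha n c (ihn c (mem_left_of_mem_mul hc)) hc

/-- The last element `a` of a regular sequence satisfies `(qⁿ⁺¹ I : a) = qⁿ I` for every ideal
`I` that contains the ideal `q` of the sequence. -/
theorem mem_pow_mul_of_mul_mem_pow_succ_mul {l : List R} {a : R} (hl : IsWeaklyRegular R (l ++ [a]))
    {I : Ideal R} (hI : Ideal.ofList (l ++ [a]) ≤ I) {n : ℕ} {c : R}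
    (hc : a * c ∈ Ideal.ofList (l ++ [a]) ^ (n + 1) * I) :
    c ∈ Ideal.ofList (l ++ [a]) ^ n * I := by
  obtain ⟨hl', ha⟩ := (isWeaklyRegular_append_singleton_iff l a).mp hl
  rw [ofList_append_singleton] at hc hI ⊢
  obtain ⟨p, hp, w, hw, hpw⟩ := exists_add_mul_of_mem_sup_pow_mul hc
  have h1 : c - w ∈ Ideal.ofList l ^ (n + 1) := by
    apply mem_pow_of_mul_mem hl' ha
    have : a * (c - w) = p := by linear_combination hpw
    rw [this]
    exact mem_left_of_mem_mul hp
  have h2 : Ideal.ofList l ^ (n + 1) ≤ (Ideal.ofList l ⊔ Ideal.span {a}) ^ n * I := by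
    rw [pow_succ]
    exact Ideal.mul_mono (Ideal.pow_right_mono le_sup_left n) (le_sup_left.trans hI)
  simpa using add_mem (h2 h1) hw

/-- If `I² = q I` then `Iⁿ⁺¹ = qⁿ I`. -/
theorem pow_succ_eq_pow_mul {q I : Ideal R} (hq : q ≤ I) (h : I ^ 2 ≤ q * I) (n : ℕ) :
    I ^ (n + 1) = q ^ n * I := by
  refine le_antisymm ?_ ?_
  · induction n with
    | zero => simp
    | succ n ih =>
      calc I ^ (n + 1 + 1) = I ^ (n + 1) * I := pow_succ _ _
        _ ≤ q ^ n * I * I := Ideal.mul_mono_left ih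
        _ = q ^ n * I ^ 2 := by ring
        _ ≤ q ^ n * (q * I) := Ideal.mul_mono_right h
        _ = q ^ (n + 1) * I := by ring
  · rw [pow_succ]
    exact Ideal.mul_mono_left (Ideal.pow_right_mono hq n)

end PowersOfRegularSequences

/-! ### Regular sequences of monic polynomials -/

section MonicSequences

open Polynomial

/-- A monic polynomial prolongs a regular sequence of constants. -/
theorem isWeaklyRegular_cons_map_C {D : Type u} [CommRing D] {f : D[X]} (hf : f.Monic) {rs : List D}
    (hrs : IsWeaklyRegular D rs) : IsWeaklyRegular D[X] (f :: rs.map C) := by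
  rw [isWeaklyRegular_cons_iff_quotient]
  refine ⟨?_, ?_⟩
  · intro x y hxy
    exact hf.isRegular.left hxy
  · have : Module.Free D (D[X] ⧸ Ideal.span {f}) := hf.free_quotient
    have h := hrs.of_flat (S := D[X] ⧸ Ideal.span {f})
    rw [List.map_map]
    exact h

/-- Transport of weak regularity along a ring isomorphism. -/
theorem isWeaklyRegular_of_ringEquiv {A B : Type*} [CommRing A] [CommRing B] (e : A ≃+* B)
    {rs : List A} (h : IsWeaklyRegular B (rs.map e)) : IsWeaklyRegular A rs := by
  refine (AddEquiv.isWeaklyRegular_congr (e := e.toAddEquiv) (as := rs) (bs := rs.map e) ?_).mpr h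
  rw [List.forall₂_map_right_iff, List.forall₂_same]
  intro r _ x
  exact map_mul e r x

/-- Monic polynomials in different variables form a regular sequence. -/
theorem isWeaklyRegular_mvPolynomial_of_monic {R : Type u} [CommRing R] :
    ∀ {d : ℕ} (f : Fin d → R[X]), (∀ i, (f i).Monic) →
      IsWeaklyRegular (MvPolynomial (Fin d) R)
        (List.ofFn fun i => aeval (MvPolynomial.X i : MvPolynomial (Fin d) R) (f i)) := by
  intro d
  induction d with
  | zero => intro f _; simp
  | succ d ih =>
    intro f hf
    have h1 := isWeaklyRegular_cons_map_C ((hf 0).map (algebraMap R (MvPolynomial (Fin d) R)))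
      (ih (fun i => f i.succ) fun i => hf i.succ)
    refine isWeaklyRegular_of_ringEquiv (MvPolynomial.finSuccEquiv R d).toRingEquiv ?_
    convert h1
    rw [List.ofFn_succ, List.map_cons, List.map_ofFn, List.map_ofFn]
    congr 1
    · change MvPolynomial.finSuccEquiv R d _ = _
      rw [← aeval_algHom_apply, MvPolynomial.finSuccEquiv_X_zero, ← aeval_map_algebraMap
        (MvPolynomial (Fin d) R), aeval_X_left_apply]
    · congr 1
      funext i
      change MvPolynomial.finSuccEquiv R d _ = _
      rw [← aeval_algHom_apply, MvPolynomial.finSuccEquiv_X_succ]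
      exact aeval_algebraMap_apply (MvPolynomial (Fin d) R)[X] _ (f i.succ)

theorem isWeaklyRegular_mvPolynomial_quotient {R : Type u} [CommRing R] (J : Ideal R) {d : ℕ}
    (f : Fin d → R[X]) (hf : ∀ i, (f i).Monic) :
    IsWeaklyRegular (MvPolynomial (Fin d) R ⧸ J.map (MvPolynomial.C (σ := Fin d)))
      (List.ofFn fun i => aeval (MvPolynomial.X i : MvPolynomial (Fin d) R) (f i)) := by
  rw [← isWeaklyRegular_map_algebraMap_iff
    (MvPolynomial (Fin d) R ⧸ J.map (MvPolynomial.C (σ := Fin d)))]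
  refine isWeaklyRegular_of_ringEquiv
    (MvPolynomial.quotientEquivQuotientMvPolynomial (σ := Fin d) J).symm.toRingEquiv ?_
  have h := isWeaklyRegular_mvPolynomial_of_monic (fun i => (f i).map (Ideal.Quotient.mk J))
    fun i => (hf i).map _
  refine (congrArg _ ?_).mp h
  rw [List.map_ofFn, List.map_ofFn]
  congr 1
  funext i
  change _ = (MvPolynomial.quotientEquivQuotientMvPolynomial (σ := Fin d) J).symm
    (Ideal.Quotient.mk _ _)
  symm
  rw [AlgEquiv.symm_apply_eq]
  have h1 : aeval (MvPolynomial.X i : MvPolynomial (Fin d) (R ⧸ J))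
        ((f i).map (Ideal.Quotient.mk J)) =
      aeval (MvPolynomial.X i : MvPolynomial (Fin d) (R ⧸ J)) (f i) :=
    aeval_map_algebraMap (R ⧸ J) _ (f i)
  have h2 : MvPolynomial.quotientEquivQuotientMvPolynomial (σ := Fin d) J (MvPolynomial.X i) =
      Ideal.Quotient.mk _ (MvPolynomial.X i) := by
    simp [MvPolynomial.quotientEquivQuotientMvPolynomial]
  rw [h1, ← aeval_algHom_apply (MvPolynomial.quotientEquivQuotientMvPolynomial (σ := Fin d) J), h2]
  exact (aeval_algHom_apply (Ideal.Quotient.mkₐ R (J.map (MvPolynomial.C (σ := Fin d))))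
    (MvPolynomial.X i) (f i)).symm

end MonicSequences

/-! ### The relations between the forms of a regular sequence -/

section PolynomialMap

open Polynomial

variable {R : Type u} [CommRing R]

/-- The inductive step of `mem_map_C_of_forall_coeff_mem`: `Φ` extends to a polynomial ring in one
more variable, which is sent to `a t`. -/
theorem mem_map_C_of_forall_coeff_eval₂_mem {D : Type u} [CommRing D] [Algebra R D]
    (Φ : D →ₐ[R] R[X]) {q' : Ideal R} {a : R} (ha : ∀ n c, a * c ∈ q' ^ n → c ∈ q' ^ n)
    (hΦ : ∀ F n, (Φ F).coeff n ∈ q' ^ n) {J : Ideal R} (hJ : q' ⊔ Ideal.span {a} ≤ J)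
    (hΦJ : ∀ F, (∀ n, (Φ F).coeff n ∈ q' ^ n * J) → F ∈ J.map (algebraMap R D))
    (p : D[X]) (hp : ∀ n, (eval₂ (Φ : D →+* R[X]) (monomial 1 a) p).coeff n ∈
      (q' ⊔ Ideal.span {a}) ^ n * J) : ∀ k, p.coeff k ∈ J.map (algebraMap R D) := by
  have hqJ : q' ≤ J := le_sup_left.trans hJ
  have haJ : a ∈ J := hJ (Ideal.mem_sup_right (Ideal.mem_span_singleton_self a))
  have haq : a ∈ q' ⊔ Ideal.span {a} := Ideal.mem_sup_right (Ideal.mem_span_singleton_self a)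
  induction hN : p.natDegree using Nat.strong_induction_on generalizing p with
  | _ N ih =>
  subst hN
  set w := eval₂ (Φ : D →+* R[X]) (monomial 1 a) p.divX with hw
  have hsplit : eval₂ (Φ : D →+* R[X]) (monomial 1 a) p = w * monomial 1 a + Φ (p.coeff 0) := by
    conv_lhs => rw [← divX_mul_X_add p]
    rw [eval₂_add, eval₂_mul_X, eval₂_C]
    rfl
  have hcoeff : ∀ n, (eval₂ (Φ : D →+* R[X]) (monomial 1 a) p).coeff (n + 1) =
      w.coeff n * a + (Φ (p.coeff 0)).coeff (n + 1) := by
    intro n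
    rw [hsplit, coeff_add, coeff_mul_monomial]
  have hcoeff0 : (eval₂ (Φ : D →+* R[X]) (monomial 1 a) p).coeff 0 =
      (Φ (p.coeff 0)).coeff 0 := by
    rw [hsplit, coeff_add, ← C_mul_X_pow_eq_monomial, pow_one, ← mul_assoc, coeff_mul_X_zero,
      zero_add]
  -- the quotient `w` of `p(a t)` by `a t` satisfies the hypothesis again
  have hwJ : ∀ n, w.coeff n ∈ (q' ⊔ Ideal.span {a}) ^ n * J := by
    intro n
    have h1 := hp (n + 1)
    rw [hcoeff] at h1
    obtain ⟨x, hx, y, hy, hxy⟩ := exists_add_mul_of_mem_sup_pow_mul h1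
    have h2 : w.coeff n - y ∈ q' ^ (n + 1) := by
      apply ha
      have : a * (w.coeff n - y) = x - (Φ (p.coeff 0)).coeff (n + 1) := by
        linear_combination hxy
      rw [this]
      exact sub_mem (mem_left_of_mem_mul hx) (hΦ _ _)
    have h3 : q' ^ (n + 1) ≤ (q' ⊔ Ideal.span {a}) ^ n * J := by
      rw [pow_succ]
      exact Ideal.mul_mono (Ideal.pow_right_mono le_sup_left n) hqJ
    simpa using add_mem (h3 h2) hy
  have h0 : ∀ n, (Φ (p.coeff 0)).coeff n ∈ q' ^ n * J := by
    intro n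
    cases n with
    | zero => simpa [hcoeff0] using hp 0
    | succ n =>
      have h1 : (Φ (p.coeff 0)).coeff (n + 1) ∈ (q' ⊔ Ideal.span {a}) ^ (n + 1) * J := by
        rw [← sub_eq_of_eq_add' (hcoeff n)]
        refine sub_mem (hp _) ?_
        rw [pow_succ, mul_comm _ (q' ⊔ Ideal.span {a}), mul_assoc, mul_comm (w.coeff n)]
        exact Ideal.mul_mem_mul haq (hwJ n)
      obtain ⟨x, hx, y, -, hxy⟩ := exists_add_mul_of_mem_sup_pow_mul h1
      have h2 : y ∈ q' ^ (n + 1) := by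
        apply ha
        rw [← sub_eq_of_eq_add' hxy]
        exact sub_mem (hΦ _ _) (mem_left_of_mem_mul hx)
      rw [hxy, mul_comm a]
      exact add_mem hx (Ideal.mul_mem_mul h2 haJ)
  intro k
  cases k with
  | zero => exact hΦJ _ h0
  | succ k =>
    rw [← coeff_divX]
    by_cases hdeg : p.natDegree = 0
    · rw [coeff_divX, coeff_eq_zero_of_natDegree_lt (by omega)]
      exact zero_mem _
    · refine ih p.divX.natDegree ?_ p.divX hwJ rfl k
      rw [natDegree_divX_eq_natDegree_tsub_one]
      omega

/-- The map `R[X₁, …, X_d] → R[t]` that sends `Xᵢ` to `aᵢ t`. -/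
noncomputable def polynomialMap {d : ℕ} (a : Fin d → R) : MvPolynomial (Fin d) R →ₐ[R] R[X] :=
  MvPolynomial.aeval fun i => monomial 1 (a i)

theorem polynomialMap_X {d : ℕ} (a : Fin d → R) (i : Fin d) :
    polynomialMap a (MvPolynomial.X i) = monomial 1 (a i) :=
  MvPolynomial.aeval_X _ _

theorem coeff_polynomialMap_mem {d : ℕ} {a : Fin d → R} {q : Ideal R} (hq : ∀ i, a i ∈ q)
    (F : MvPolynomial (Fin d) R) : polynomialMap a F ∈ reesAlgebra q := by
  induction F using MvPolynomial.induction_on with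
  | C c =>
    rw [← MvPolynomial.algebraMap_eq, AlgHom.commutes]
    exact (reesAlgebra q).algebraMap_mem c
  | add p p' hp hp' => rw [map_add]; exact add_mem hp hp'
  | mul_X p i hp =>
    rw [map_mul, polynomialMap_X]
    exact mul_mem hp (reesAlgebra.monomial_mem.mpr (by simpa using hq i))

theorem coeff_polynomialMap_mem_mul {d : ℕ} {a : Fin d → R} {q : Ideal R} (hq : ∀ i, a i ∈ q)
    {J : Ideal R} {F : MvPolynomial (Fin d) R} (hF : F ∈ J.map (MvPolynomial.C (σ := Fin d)))
    (n : ℕ) : (polynomialMap a F).coeff n ∈ q ^ n * J := by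
  refine Submodule.span_induction (p := fun F _ => ∀ n, (polynomialMap a F).coeff n ∈ q ^ n * J)
    ?_ ?_ ?_ ?_ (hF : F ∈ Ideal.span _) n
  · rintro _ ⟨c, hc, rfl⟩ n
    rw [← MvPolynomial.algebraMap_eq, AlgHom.commutes, algebraMap_eq, coeff_C]
    split_ifs with h
    · subst h; simpa using hc
    · exact zero_mem _
  · simp
  · intro x y _ _ hx hy n
    rw [map_add, coeff_add]
    exact add_mem (hx n) (hy n)
  · intro x y _ hy n
    rw [smul_eq_mul, map_mul, coeff_mul]
    refine Ideal.sum_mem _ fun p hp => ?_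
    rw [← Finset.HasAntidiagonal.mem_antidiagonal.mp hp, pow_add, mul_assoc]
    exact Ideal.mul_mem_mul (coeff_polynomialMap_mem hq x p.1) (hy p.2)

/-- Let `q ⊆ J` be generated by a regular sequence. If `F(a₁ t, …, a_d t)` has its coefficients of
degree `n` in `qⁿ J` for all `n`, then `F` has its coefficients in `J`. In other words,
`⨁ₙ qⁿ / qⁿ J` is a polynomial ring over `R / J`. -/
theorem mem_map_C_of_forall_coeff_mem : ∀ {d : ℕ} {a : Fin d → R},
    IsWeaklyRegular R (List.ofFn a).reverse → ∀ {J : Ideal R},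
    Ideal.ofList (List.ofFn a).reverse ≤ J → ∀ F : MvPolynomial (Fin d) R,
    (∀ n, (polynomialMap a F).coeff n ∈ Ideal.ofList (List.ofFn a).reverse ^ n * J) →
    F ∈ J.map (MvPolynomial.C (σ := Fin d)) := by
  intro d
  induction d with
  | zero =>
    intro a _ J _ F hF
    obtain ⟨c, rfl⟩ := MvPolynomial.C_surjective (Fin 0) F
    have := hF 0
    rw [← MvPolynomial.algebraMap_eq, AlgHom.commutes] at this
    exact Ideal.mem_map_of_mem _ (by simpa [algebraMap_eq] using this)
  | succ d ih =>
    intro a ha J hJ F hF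
    rw [List.ofFn_succ, List.reverse_cons] at ha hJ hF
    obtain ⟨hl, ha0⟩ := (isWeaklyRegular_append_singleton_iff _ _).mp ha
    rw [ofList_append_singleton] at hJ hF
    have key := mem_map_C_of_forall_coeff_eval₂_mem (polynomialMap fun i => a i.succ)
      (mem_pow_of_mul_mem hl ha0)
      (fun F n => coeff_polynomialMap_mem (fun i => Ideal.subset_span (by simp)) F n) hJ
      (ih hl (le_sup_left.trans hJ)) (MvPolynomial.finSuccEquiv R d F) ?_
    · rw [MvPolynomial.mem_map_C_iff]
      intro m
      have h1 := MvPolynomial.finSuccEquiv_coeff_coeff (m.tail) F (m 0)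
      rw [Finsupp.cons_tail] at h1
      rw [← h1]
      exact MvPolynomial.mem_map_C_iff.mp (key (m 0)) _
    · intro n
      have h2 : eval₂ ((polynomialMap fun i => a i.succ : _ →ₐ[R] R[X]) :
          MvPolynomial (Fin d) R →+* R[X]) (monomial 1 (a 0)) (MvPolynomial.finSuccEquiv R d F) =
          polynomialMap a F := by
        clear hF
        induction F using MvPolynomial.induction_on with
        | C c =>
          rw [← MvPolynomial.algebraMap_eq, AlgHom.commutes, AlgEquiv.commutes]
          change eval₂ _ _ (C (algebraMap R (MvPolynomial (Fin d) R) c)) = _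
          rw [eval₂_C]
          exact AlgHom.commutes (polynomialMap fun i => a i.succ) c
        | add p p' hp hp' => rw [map_add, map_add, eval₂_add, hp, hp']
        | mul_X p i hp =>
          rw [map_mul, map_mul, eval₂_mul, hp, polynomialMap_X]
          congr 1
          cases i using Fin.cases with
          | zero => rw [MvPolynomial.finSuccEquiv_X_zero, eval₂_X]
          | succ i =>
            rw [MvPolynomial.finSuccEquiv_X_succ, eval₂_C]
            exact polynomialMap_X _ i
      rw [h2]
      exact hF n

/-- Every monomial `c tⁿ` with `c ∈ qⁿ J` comes from a polynomial with coefficients in `J`. -/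
theorem exists_polynomialMap_eq_monomial {d : ℕ} (a : Fin d → R) {J : Ideal R} (n : ℕ) {c : R}
    (hc : c ∈ Ideal.span (Set.range a) ^ n * J) :
    ∃ F ∈ J.map (MvPolynomial.C (σ := Fin d)), polynomialMap a F = monomial n c := by
  induction n generalizing c with
  | zero =>
    refine ⟨MvPolynomial.C c, Ideal.mem_map_of_mem _ (by simpa using hc), ?_⟩
    rw [← MvPolynomial.algebraMap_eq, AlgHom.commutes]
    rfl
  | succ n ih =>
    rw [pow_succ', mul_assoc] at hc
    refine Submodule.mul_induction_on hc ?_ ?_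
    · intro x hx y hy
      obtain ⟨F, hF, hFy⟩ := ih hy
      refine Submodule.span_induction (p := fun x _ => ∃ F ∈ J.map (MvPolynomial.C (σ := Fin d)),
        polynomialMap a F = monomial (n + 1) (x * y)) ?_ ?_ ?_ ?_ hx
      · rintro _ ⟨i, rfl⟩
        refine ⟨MvPolynomial.X i * F, Ideal.mul_mem_left _ _ hF, ?_⟩
        rw [map_mul, polynomialMap_X, hFy, monomial_mul_monomial, add_comm]
      · exact ⟨0, zero_mem _, by simp⟩
      · rintro x x' - - ⟨F, hF, h⟩ ⟨F', hF', h'⟩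
        exact ⟨F + F', add_mem hF hF', by rw [map_add, h, h', add_mul, map_add]⟩
      · rintro r x - ⟨F, hF, h⟩
        refine ⟨MvPolynomial.C r * F, Ideal.mul_mem_left _ _ hF, ?_⟩
        rw [map_mul, h, ← MvPolynomial.algebraMap_eq, AlgHom.commutes, algebraMap_eq,
          C_mul_monomial, smul_eq_mul, mul_assoc]
    · rintro x y ⟨F, hF, h⟩ ⟨F', hF', h'⟩
      exact ⟨F + F', add_mem hF hF', by rw [map_add, h, h', map_add]⟩

end PolynomialMap

/-! ### Regular sequences on the associated graded ring -/

section AssociatedGradedRing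

open Polynomial

variable {R : Type u} [CommRing R] {I : Ideal R}

/-- A shortcut for instance search. -/
noncomputable instance ReesQuotient.instModule (I J : Ideal R) :
    Module (reesAlgebra I) (ReesQuotient I J) :=
  Submodule.Quotient.module _

/-- The graded map `R[X₁, …, X_d] → R(I)` that sends `Xᵢ` to `aᵢ t`. -/
noncomputable def reesMap {d : ℕ} (a : Fin d → R) (ha : ∀ i, a i ∈ I) :
    MvPolynomial (Fin d) R →ₐ[R] reesAlgebra I :=
  MvPolynomial.aeval fun i => reesMonomial 1 (a i) (by simpa using ha i)

theorem reesMap_X {d : ℕ} (a : Fin d → R) (ha : ∀ i, a i ∈ I) (i : Fin d) :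
    reesMap a ha (MvPolynomial.X i) = reesMonomial 1 (a i) (by simpa using ha i) :=
  MvPolynomial.aeval_X _ _

theorem coe_reesMap {d : ℕ} (a : Fin d → R) (ha : ∀ i, a i ∈ I) (F : MvPolynomial (Fin d) R) :
    (reesMap a ha F : R[X]) = polynomialMap a F := by
  have : (reesAlgebra I).val.comp (reesMap a ha) = polynomialMap a := by
    refine MvPolynomial.algHom_ext fun i => ?_
    rw [AlgHom.comp_apply, reesMap_X, polynomialMap_X]
    rfl
  exact DFunLike.congr_fun this F

theorem span_range_eq_ofList_reverse {d : ℕ} (a : Fin d → R) :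
    Ideal.span (Set.range a) = Ideal.ofList (List.ofFn a).reverse := by
  congr 1
  ext x
  simp [List.mem_ofFn]

variable {d : ℕ} {a : Fin d → R} (ha : ∀ i, a i ∈ I)

/-- The map `I R[X₁, …, X_d] → R(I)` that sends `F` to `F(a₁ t, …, a_d t) t`. -/
noncomputable def reesShift : (I.map (MvPolynomial.C (σ := Fin d))) →+ reesAlgebra I where
  toFun F := ⟨X * polynomialMap a F.1, fun n => by
    cases n with
    | zero => simp
    | succ n =>
      rw [coeff_X_mul, pow_succ]
      exact coeff_polynomialMap_mem_mul ha F.2 n⟩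
  map_zero' := Subtype.ext (by simp)
  map_add' F F' := Subtype.ext (by simp [mul_add])

theorem coe_reesShift (F : I.map (MvPolynomial.C (σ := Fin d))) :
    (reesShift ha F : R[X]) = X * polynomialMap a F.1 := rfl

theorem reesShift_smul (F : I.map (MvPolynomial.C (σ := Fin d))) (b : MvPolynomial (Fin d) R) :
    reesShift ha (b • F) = reesMap a ha b * reesShift ha F := by
  apply Subtype.ext
  rw [MulMemClass.coe_mul, coe_reesShift, coe_reesShift, coe_reesMap, mul_left_comm, ← map_mul]
  rfl

theorem exists_polynomialMap_eq {J : Ideal R} {p : R[X]}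
    (hp : ∀ n, p.coeff n ∈ Ideal.span (Set.range a) ^ n * J) :
    ∃ F ∈ J.map (MvPolynomial.C (σ := Fin d)), polynomialMap a F = p := by
  choose F hF hFp using fun n => exists_polynomialMap_eq_monomial a n (hp n)
  refine ⟨∑ n ∈ p.support, F n, sum_mem fun n _ => hF n, ?_⟩
  rw [map_sum]
  simp only [hFp]
  exact (Polynomial.as_sum_support p).symm

/-- Let `q = (a₁, …, a_d)` with `a₁, …, a_d` a regular sequence in `I`, and let `I² = q I`. Then the
`fᵢ(aᵢ t)` form a regular sequence on `G(I)` whenever the `fᵢ` are monic. Indeed, as a module over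
`B = R[X₁, …, X_d]` the ring `G(I)` is an extension of `I B / q B` by `B / I B`, and `I B / q B` is
the kernel of `B / q B → B / I B`. -/
theorem isWeaklyRegular_associatedGradedRing (hw : IsWeaklyRegular R (List.ofFn a).reverse)
    (hI : I ^ 2 ≤ Ideal.span (Set.range a) * I) (f : Fin d → R[X]) (hf : ∀ i, (f i).Monic) :
    IsWeaklyRegular (AssociatedGradedRing I)
      (List.ofFn fun i => aeval (reesMonomial 1 (a i) (by simpa using ha i) : reesAlgebra I)
        (f i)) := by
  let B := MvPolynomial (Fin d) R
  let _ : Algebra B (reesAlgebra I) := (reesMap a ha).toRingHom.toAlgebra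
  have halg : ∀ b : B, algebraMap B (reesAlgebra I) b = reesMap a ha b := fun _ => rfl
  set q : Ideal R := Ideal.span (Set.range a) with hq
  have haq : ∀ i, a i ∈ q := fun i => Ideal.subset_span ⟨i, rfl⟩
  have hqI : q ≤ I := Ideal.span_le.mpr (by rintro _ ⟨i, rfl⟩; exact ha i)
  have hq' := span_range_eq_ofList_reverse a
  have hpow := pow_succ_eq_pow_mul hqI hI
  have hmem : ∀ {J : Ideal R}, q ≤ J → ∀ F : B, (∀ n, (polynomialMap a F).coeff n ∈ q ^ n * J) →
      F ∈ J.map (MvPolynomial.C (σ := Fin d)) := by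
    intro J hJ F hF
    rw [hq, hq'] at hJ hF
    exact mem_map_C_of_forall_coeff_mem hw hJ F hF
  let IB : Ideal B := I.map (MvPolynomial.C (σ := Fin d))
  let qB : Ideal B := q.map (MvPolynomial.C (σ := Fin d))
  have hqIB : qB ≤ IB := Ideal.map_mono hqI
  let rs : List B := List.ofFn fun i => aeval (MvPolynomial.X i : B) (f i)
  have hrs : rs.map (algebraMap B (reesAlgebra I)) =
      List.ofFn fun i => aeval (reesMonomial 1 (a i) (by simpa using ha i) : reesAlgebra I)
        (f i) := by
    rw [List.map_ofFn]
    congr 1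
    funext i
    change reesMap a ha _ = _
    rw [← aeval_algHom_apply, reesMap_X]
  rw [← hrs, isWeaklyRegular_map_algebraMap_iff]
  -- the embedding of `B / I B` into `G(I)`
  have hlift : IB ≤ LinearMap.ker (Algebra.linearMap B (AssociatedGradedRing I)) := by
    intro F hF
    rw [LinearMap.mem_ker, Algebra.linearMap_apply]
    change Ideal.Quotient.mk _ (reesMap a ha F) = 0
    rw [Ideal.Quotient.eq_zero_iff_mem, mem_map_reesAlgebra_iff]
    intro n
    rw [coe_reesMap, mul_comm]
    exact Ideal.mul_mono_left (Ideal.pow_right_mono hqI n) (coeff_polynomialMap_mem_mul haq hF n)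
  let g : (B ⧸ IB) →ₗ[B] AssociatedGradedRing I := Submodule.liftQ IB (Algebra.linearMap B _) hlift
  have hgmk : ∀ F : B, g (Submodule.Quotient.mk F) = Ideal.Quotient.mk _ (reesMap a ha F) :=
    fun F => rfl
  have hg : Function.Injective g := by
    rw [injective_iff_map_eq_zero]
    intro x hx
    obtain ⟨F, rfl⟩ := Submodule.Quotient.mk_surjective _ x
    rw [hgmk, Ideal.Quotient.eq_zero_iff_mem, mem_map_reesAlgebra_iff] at hx
    rw [Submodule.Quotient.mk_eq_zero]
    refine hmem hqI F fun n => ?_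
    have := hx n
    rwa [coe_reesMap, ← pow_succ', hpow] at this
  -- the cokernel of `g` is `I B / q B`, by means of `reesShift`
  let N' : Submodule B IB := Submodule.comap (Submodule.subtype IB) qB
  let h₀ : IB →ₗ[B] reesAlgebra I :=
    { toFun := reesShift ha
      map_add' := map_add _
      map_smul' := fun b F => reesShift_smul ha F b }
  let h : IB →ₗ[B] (AssociatedGradedRing I ⧸ LinearMap.range g) :=
    (LinearMap.range g).mkQ ∘ₗ (Algebra.linearMap (reesAlgebra I)
      (AssociatedGradedRing I)).restrictScalars B ∘ₗ h₀
  have hmk : ∀ F, h F = (LinearMap.range g).mkQ (Ideal.Quotient.mk _ (reesShift ha F)) :=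
    fun _ => rfl
  have hsurj : Function.Surjective h := by
    intro x
    obtain ⟨y, rfl⟩ := Submodule.Quotient.mk_surjective _ x
    obtain ⟨y, rfl⟩ := Ideal.Quotient.mk_surjective y
    obtain ⟨F, hF, hFy⟩ := exists_polynomialMap_eq (a := a) (J := I) (p := (y : R[X]).divX) (by
      intro n
      rw [coeff_divX, ← hpow]
      exact y.2 (n + 1))
    refine ⟨⟨F, hF⟩, ?_⟩
    rw [hmk, Submodule.mkQ_apply, eq_comm, Submodule.Quotient.eq]
    refine ⟨Submodule.Quotient.mk (MvPolynomial.C ((y : R[X]).coeff 0)), ?_⟩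
    rw [hgmk, ← map_sub]
    congr 1
    apply Subtype.ext
    rw [coe_reesMap, AddSubgroupClass.coe_sub, coe_reesShift, hFy, eq_sub_iff_add_eq',
      ← MvPolynomial.algebraMap_eq, AlgHom.commutes]
    exact X_mul_divX_add _
  have hker : LinearMap.ker h = N' := by
    ext F
    rw [LinearMap.mem_ker, hmk, Submodule.mkQ_apply, Submodule.Quotient.mk_eq_zero]
    constructor
    · rintro ⟨y, hy⟩
      obtain ⟨F', rfl⟩ := Submodule.Quotient.mk_surjective _ y
      rw [hgmk, Ideal.Quotient.eq, mem_map_reesAlgebra_iff] at hy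
      refine hmem le_rfl F.1 fun n => ?_
      have h1 := hy (n + 1)
      rw [AddSubgroupClass.coe_sub, coe_reesShift, coe_reesMap, coeff_sub, coeff_X_mul,
        ← pow_succ', hpow] at h1
      have h2 := sub_mem (coeff_polynomialMap_mem haq F' (n + 1)) (mem_left_of_mem_mul h1)
      rw [sub_sub_cancel, pow_succ] at h2
      exact h2
    · intro hF
      obtain ⟨F', -, hF'⟩ := exists_polynomialMap_eq (a := a) (J := ⊤)
          (p := X * polynomialMap a F.1) (by
        intro n
        rw [Ideal.mul_top]
        cases n with
        | zero => simp
        | succ n =>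
          rw [coeff_X_mul, pow_succ]
          exact coeff_polynomialMap_mem_mul haq hF n)
      refine ⟨Submodule.Quotient.mk F', ?_⟩
      rw [hgmk]
      congr 1
      apply Subtype.ext
      rw [coe_reesMap, coe_reesShift, hF']
  -- `I B / q B` is the kernel of `B / q B → B / I B`
  let k : (IB ⧸ N') →ₗ[B] B ⧸ qB := Submodule.mapQ N' qB IB.subtype le_rfl
  have hk : Function.Injective k := by
    rw [injective_iff_map_eq_zero]
    intro x hx
    obtain ⟨F, rfl⟩ := Submodule.Quotient.mk_surjective _ x
    rw [Submodule.mapQ_apply, Submodule.Quotient.mk_eq_zero] at hx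
    rw [Submodule.Quotient.mk_eq_zero]
    exact hx
  let p : (B ⧸ qB) →ₗ[B] B ⧸ IB := Submodule.mapQ qB IB LinearMap.id hqIB
  have hp : Function.Surjective p := by
    intro x
    obtain ⟨F, rfl⟩ := Submodule.Quotient.mk_surjective _ x
    exact ⟨Submodule.Quotient.mk F, rfl⟩
  have hkp : Function.Exact k p := by
    intro x
    obtain ⟨F, rfl⟩ := Submodule.Quotient.mk_surjective _ x
    rw [Submodule.mapQ_apply, LinearMap.id_apply, Submodule.Quotient.mk_eq_zero]
    constructor
    · intro hF
      exact ⟨Submodule.Quotient.mk ⟨F, hF⟩, rfl⟩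
    · rintro ⟨y, hy⟩
      obtain ⟨F', rfl⟩ := Submodule.Quotient.mk_surjective _ y
      rw [Submodule.mapQ_apply, Submodule.Quotient.eq] at hy
      have := sub_mem F'.2 (hqIB hy)
      simpa using this
  have hwI : IsWeaklyRegular (B ⧸ IB) rs := isWeaklyRegular_mvPolynomial_quotient I f hf
  have hwq : IsWeaklyRegular (B ⧸ qB) rs := isWeaklyRegular_mvPolynomial_quotient q f hf
  have hwK := isWeaklyRegular_of_exact_left rs hk hkp hp hwq hwI
  have e : (IB ⧸ N') ≃ₗ[B] (AssociatedGradedRing I ⧸ LinearMap.range g) :=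
    (Submodule.quotEquivOfEq _ _ hker.symm).trans (h.quotKerEquivOfSurjective hsurj)
  exact isWeaklyRegular_of_exact rs hg (LinearMap.exact_map_mkQ_range g)
    (Submodule.mkQ_surjective _) hwI ((e.isWeaklyRegular_congr rs).mp hwK)

end AssociatedGradedRing

/-! ### Maximal ideals of the associated graded ring -/

section MaximalIdeals

open Polynomial

variable {R : Type u} [CommRing R] {I : Ideal R}

/-- The inclusion `c ↦ c t` of `I` as the degree one part of the Rees algebra. -/
noncomputable def reesDegreeOne (I : Ideal R) : I →ₗ[R] reesAlgebra I where
  toFun c := reesMonomial 1 c (by simp)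
  map_add' b c := Subtype.ext (map_add _ _ _)
  map_smul' b c := Subtype.ext (by
    change monomial 1 (b * (c : R)) = b • monomial 1 (c : R)
    rw [smul_monomial, smul_eq_mul])

/-- The Rees algebra is generated in degree one. -/
theorem mem_of_reesDegreeOne_mem {A : Subalgebra R (reesAlgebra I)}
    (h : ∀ c, reesDegreeOne I c ∈ A) (x : reesAlgebra I) : x ∈ A := by
  have h1 : reesAlgebra I ≤ A.map (reesAlgebra I).val := by
    refine (adjoin_monomial_eq_reesAlgebra I).ge.trans (Algebra.adjoin_le ?_)
    rintro _ ⟨c, hc, rfl⟩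
    exact ⟨_, h ⟨c, hc⟩, rfl⟩
  obtain ⟨y, hy, hyx⟩ := h1 x.2
  rwa [← Subtype.ext hyx]

/-- A product of two elements of degree one lies in the ideal generated by `q t`, in the form
`∑ aᵢ t · cᵢ t`, as soon as `I² = q I`. -/
theorem exists_reesDegreeOne_mul_eq {d : ℕ} {a : Fin d → R} (ha : ∀ i, a i ∈ I)
    (hI : I ^ 2 ≤ Ideal.span (Set.range a) * I) (b c : I) :
    ∃ e : Fin d → I, reesDegreeOne I b * reesDegreeOne I c =
      ∑ i, reesDegreeOne I ⟨a i, ha i⟩ * reesDegreeOne I (e i) := by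
  have h1 : (b * c : R) ∈ Ideal.span (Set.range a) * I :=
    hI (by rw [pow_two]; exact Ideal.mul_mem_mul b.2 c.2)
  have h2 : ∃ e : Fin d → I, (b * c : R) = ∑ i, a i * e i := by
    refine Submodule.mul_induction_on h1 ?_ ?_
    · intro x hx y hy
      obtain ⟨r, rfl⟩ := (Submodule.mem_span_range_iff_exists_fun R).mp hx
      refine ⟨fun i => ⟨r i * y, Ideal.mul_mem_left _ _ hy⟩, ?_⟩
      rw [Finset.sum_mul]
      exact Finset.sum_congr rfl fun i _ => by rw [smul_eq_mul]; ring
    · rintro x y ⟨e, rfl⟩ ⟨e', rfl⟩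
      refine ⟨fun i => e i + e' i, ?_⟩
      rw [← Finset.sum_add_distrib]
      exact Finset.sum_congr rfl fun i _ => by rw [Submodule.coe_add]; ring
  obtain ⟨e, he⟩ := h2
  refine ⟨e, Subtype.ext ?_⟩
  rw [AddSubmonoidClass.coe_finsetSum]
  change monomial 1 (b : R) * monomial 1 (c : R) =
    ∑ i, monomial 1 (a i) * monomial 1 (e i : R)
  simp only [monomial_mul_monomial]
  rw [he, map_sum]

/-- If `I² = q I` then `R(I)` is integral over the subring generated by `q t`, so a homomorphism to
a domain that makes the `aᵢ t` integral over `R` makes everything integral. This is the determinant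
trick: `c t` maps the finite module spanned by `I t` to itself. -/
theorem isIntegral_map_of_isIntegral {K : Type*} [CommRing K] [IsDomain K] [Algebra R K]
    [IsNoetherianRing R] (ψ : reesAlgebra I →ₐ[R] K) {d : ℕ} {a : Fin d → R} (ha : ∀ i, a i ∈ I)
    (hI : I ^ 2 ≤ Ideal.span (Set.range a) * I)
    (hψ : ∀ i, IsIntegral R (ψ (reesDegreeOne I ⟨a i, ha i⟩))) (x : reesAlgebra I) :
    IsIntegral R (ψ x) := by
  have key : ∀ b, IsIntegral R (ψ (reesDegreeOne I b)) := by
    intro b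
    by_cases hb : ψ (reesDegreeOne I b) = 0
    · rw [hb]; exact isIntegral_zero
    let A := integralClosure R K
    let τ : I →ₗ[R] K := ψ.toLinearMap ∘ₗ reesDegreeOne I
    let N : Submodule A K := Submodule.span A (Set.range τ)
    have hN : N.FG := by
      obtain ⟨s, hs⟩ : (LinearMap.range τ).FG := by
        rw [LinearMap.range_eq_map]
        exact Submodule.FG.map _ (Module.finite_def.mp inferInstance)
      refine ⟨s, ?_⟩
      rw [← Submodule.span_span_of_tower R A (s : Set K), hs]
      rfl
    have h1 : IsIntegral A (ψ (reesDegreeOne I b)) := by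
      refine isIntegral_of_smul_mem_submodule N ?_ hN _ ?_
      · exact (Submodule.ne_bot_iff _).mpr ⟨_, Submodule.subset_span ⟨b, rfl⟩, hb⟩
      · intro n hn
        refine Submodule.span_induction ?_ ?_ ?_ ?_ hn
        · rintro _ ⟨c, rfl⟩
          obtain ⟨e, he⟩ := exists_reesDegreeOne_mul_eq ha hI b c
          have h2 : ψ (reesDegreeOne I b) • τ c = ∑ i, (⟨_, hψ i⟩ : A) • τ (e i) := by
            change ψ _ * ψ _ = ∑ i, ψ _ * ψ _
            rw [← map_mul, he, map_sum]
            simp only [map_mul]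
          rw [h2]
          exact Submodule.sum_mem _ fun i _ =>
            Submodule.smul_mem _ _ (Submodule.subset_span ⟨_, rfl⟩)
        · rw [smul_zero]; exact zero_mem _
        · intro x y _ _ hx hy
          rw [smul_add]
          exact add_mem hx hy
        · intro r x _ hx
          rw [smul_comm]
          exact Submodule.smul_mem _ _ hx
    exact isIntegral_trans _ h1
  exact mem_of_reesDegreeOne_mem (A := (integralClosure R K).comap ψ) key x

theorem isMaximal_of_isIntegral_quotient {A : Type*} [CommRing A] [Algebra R A] (P : Ideal A)
    [P.IsPrime] (hm : (P.comap (algebraMap R A)).IsMaximal) [Algebra.IsIntegral R (A ⧸ P)] :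
    P.IsMaximal := by
  have h3 : (⊥ : Ideal (A ⧸ P)).comap (algebraMap R (A ⧸ P)) = P.comap (algebraMap R A) := by
    ext r
    rw [Ideal.mem_comap, Ideal.mem_comap, Ideal.mem_bot]
    exact Ideal.Quotient.eq_zero_iff_mem
  have h2 : (⊥ : Ideal (A ⧸ P)).IsMaximal :=
    Ideal.isMaximal_of_isIntegral_of_isMaximal_comap (R := R) ⊥ (h3 ▸ hm)
  exact Ideal.Quotient.maximal_of_isField _ (Ring.isField_iff_maximal_bot.mpr h2)

/-- A prime of `R(I)` over the maximal ideal that contains monic polynomials in the `aᵢ t` is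
maximal, if `I² = q I`. -/
theorem isMaximal_of_aeval_mem [IsNoetherianRing R] {d : ℕ} {a : Fin d → R} (ha : ∀ i, a i ∈ I)
    (hI : I ^ 2 ≤ Ideal.span (Set.range a) * I) (f : Fin d → R[X]) (hf : ∀ i, (f i).Monic)
    (P : Ideal (reesAlgebra I)) [P.IsPrime]
    (hm : (P.comap (algebraMap R (reesAlgebra I))).IsMaximal)
    (hP : ∀ i, aeval (reesDegreeOne I ⟨a i, ha i⟩) (f i) ∈ P) : P.IsMaximal := by
  have hint := isIntegral_map_of_isIntegral (K := reesAlgebra I ⧸ P) (Ideal.Quotient.mkₐ R P) ha hI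
    (fun i =>
    ⟨f i, hf i, by
      change aeval (Ideal.Quotient.mkₐ R P _) (f i) = 0
      rw [aeval_algHom_apply]
      exact Ideal.Quotient.eq_zero_iff_mem.mpr (hP i)⟩)
  have h1 : Algebra.IsIntegral R (reesAlgebra I ⧸ P) := ⟨fun x => by
    obtain ⟨x, rfl⟩ := Ideal.Quotient.mk_surjective x
    exact hint x⟩
  exact isMaximal_of_isIntegral_quotient P hm

/-- Elements of a finitely generated algebra are integral modulo a maximal ideal lying over a
maximal ideal. -/
theorem exists_monic_aeval_mem {A : Type*} [CommRing A] [Algebra R A] [Algebra.FiniteType R A]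
    (P : Ideal A) [P.IsMaximal] (hm : (P.comap (algebraMap R A)).IsMaximal) (x : A) :
    ∃ f : R[X], f.Monic ∧ aeval x f ∈ P := by
  let p := P.comap (algebraMap R A)
  let _ : Field (R ⧸ p) := Ideal.Quotient.field p
  let _ : Field (A ⧸ P) := Ideal.Quotient.field P
  let _ : Algebra (R ⧸ p) (A ⧸ P) := (Ideal.quotientMap P (algebraMap R A) le_rfl).toAlgebra
  have : IsScalarTower R (R ⧸ p) (A ⧸ P) := IsScalarTower.of_algebraMap_eq fun r => rfl
  have : Algebra.FiniteType (R ⧸ p) (A ⧸ P) :=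
    Algebra.FiniteType.of_restrictScalars_finiteType R _ _
  have := finite_of_finite_type_of_isJacobsonRing (R ⧸ p) (A ⧸ P)
  have h1 : IsIntegral (R ⧸ p) (Ideal.Quotient.mk P x) := Algebra.IsIntegral.isIntegral _
  have h2 : Algebra.IsIntegral R (R ⧸ p) :=
    ⟨(algebraMap R (R ⧸ p)).isIntegral_of_surjective Ideal.Quotient.mk_surjective⟩
  obtain ⟨f, hf, hfx⟩ := isIntegral_trans (R := R) _ h1
  refine ⟨f, hf, ?_⟩
  rw [← Ideal.Quotient.eq_zero_iff_mem]
  change aeval (Ideal.Quotient.mkₐ R P x) f = 0 at hfx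
  rwa [aeval_algHom_apply] at hfx

theorem isWeaklyRegular_localization_quotient {A : Type u} [CommRing A] (J : Ideal A) {rs : List A}
    (h : IsWeaklyRegular (A ⧸ J) rs) (Q : Ideal (A ⧸ J)) [Q.IsPrime] :
    IsWeaklyRegular (Localization.AtPrime Q) (rs.map (Ideal.Quotient.mk J)) := by
  have h2 := (isWeaklyRegular_map_algebraMap_iff (A ⧸ J) (A ⧸ J) rs).mpr h
  exact (isWeaklyRegular_map_algebraMap_iff _ _ _).mp
    (h2.of_isLocalization (Localization.AtPrime Q) Q.primeCompl)

/-- If `I² = q I` with `q ⊆ I` generated by a regular sequence, then the associated graded ring of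
the `𝔪`-primary ideal `I` is Cohen–Macaulay. A maximal ideal contains monic polynomials in the
`aᵢ t`; these form a regular sequence, and the maximal ideal is minimal over them. -/
theorem isCohenMacaulayRing_associatedGradedRing [IsLocalRing R] [IsNoetherianRing R]
    (hrad : I.radical = maximalIdeal R) {d : ℕ} {a : Fin d → R} (ha : ∀ i, a i ∈ I)
    (hw : IsWeaklyRegular R (List.ofFn a).reverse)
    (hI : I ^ 2 ≤ Ideal.span (Set.range a) * I) :
    IsCohenMacaulayRing (AssociatedGradedRing I) := by
  have hN : IsNoetherianRing (AssociatedGradedRing I) :=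
    inferInstanceAs (IsNoetherianRing (reesAlgebra I ⧸ _))
  refine ⟨hN, ?_⟩
  intro Q _
  let π : reesAlgebra I →+* AssociatedGradedRing I := Ideal.Quotient.mk _
  have hπ : Function.Surjective π := Ideal.Quotient.mk_surjective
  have hmax : ∀ P : Ideal (AssociatedGradedRing I), P.IsPrime →
      ((P.comap π).comap (algebraMap R (reesAlgebra I))).IsMaximal := by
    intro P hP
    have h1 : I ≤ (P.comap π).comap (algebraMap R (reesAlgebra I)) := by
      intro c hc
      rw [Ideal.mem_comap, Ideal.mem_comap]
      have : π (algebraMap R _ c) = 0 := Ideal.Quotient.eq_zero_iff_mem.mpr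
        (Ideal.mem_map_of_mem _ hc)
      rw [this]
      exact zero_mem _
    have h2 : maximalIdeal R ≤ (P.comap π).comap (algebraMap R (reesAlgebra I)) := by
      rw [← hrad]
      exact (Ideal.IsPrime.radical_le_iff inferInstance).mpr h1
    rw [← (maximalIdeal.isMaximal R).eq_of_le (Ideal.IsPrime.ne_top inferInstance) h2]
    exact maximalIdeal.isMaximal R
  have hQ : (Q.comap π).IsMaximal := Ideal.comap_isMaximal_of_surjective π hπ
  choose f hf hfm using fun i => exists_monic_aeval_mem (Q.comap π) (hmax Q inferInstance)
    (reesDegreeOne I ⟨a i, ha i⟩)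
  have h1 := isWeaklyRegular_associatedGradedRing ha hw hI f hf
  have h3 := isWeaklyRegular_localization_quotient _ h1 Q
  rw [List.map_ofFn] at h3
  refine isCohenMacaulayLocalRing_atPrime Q _ ?_ h3 ?_
  · intro r hr
    obtain ⟨i, rfl⟩ := List.mem_ofFn.mp hr
    exact hfm i
  · apply height_le_length_of_mem_minimalPrimes
    refine ⟨⟨inferInstance, ?_⟩, ?_⟩
    · refine Ideal.span_le.mpr fun r hr => ?_
      obtain ⟨i, rfl⟩ := List.mem_ofFn.mp hr
      exact hfm i
    · rintro P ⟨hP, hPle⟩ hPQ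
      have h4 : (P.comap π).IsMaximal := by
        refine isMaximal_of_aeval_mem ha hI f hf _ (hmax P hP) fun i => ?_
        exact hPle (Ideal.subset_span (List.mem_ofFn.mpr ⟨i, rfl⟩))
      have h5 := h4.eq_of_le hQ.ne_top (Ideal.comap_mono hPQ)
      exact (Ideal.comap_injective_of_surjective π hπ h5).ge

end MaximalIdeals

/-! ### A chain of elements of the Rees algebra -/

section RegularSequenceOnRees

open Polynomial

theorem mem_pointwise_smul_top_iff {A : Type u} [CommRing A] {x z : A} :
    z ∈ (x • ⊤ : Submodule A A) ↔ ∃ u, z = x * u := by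
  rw [Submodule.mem_smul_pointwise_iff_exists]
  exact ⟨fun ⟨u, _, hu⟩ => ⟨u, hu.symm⟩, fun ⟨u, hu⟩ => ⟨u, trivial, hu.symm⟩⟩

/-- If `(x : y) = J` then `A / x A` is an extension of `A / (x, y)` by `A / J`. -/
theorem isWeaklyRegular_quotSMulTop_of_surjective {A B : Type u} [CommRing A] [CommRing B]
    (φ : A →+* B) (hφ : Function.Surjective φ) {J : Ideal A} {x y : A} (hx : φ x = 0)
    (hy : φ y = 0) (hJ : ∀ z, z ∈ J ↔ ∃ u, y * z = x * u)
    (hker : ∀ z, φ z = 0 → ∃ u v, z = x * u + y * v) {rs : List A}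
    (hJw : IsWeaklyRegular (A ⧸ J) rs) (hB : IsWeaklyRegular B (rs.map φ)) :
    IsWeaklyRegular (QuotSMulTop x A) rs := by
  let _ : Algebra A B := φ.toAlgebra
  have hBw : IsWeaklyRegular B rs := (isWeaklyRegular_map_algebraMap_iff B B rs).mp hB
  let f : (A ⧸ J) →ₗ[A] QuotSMulTop x A := Submodule.mapQ J (x • ⊤) (LinearMap.lsmul A A y) (by
    intro z hz
    exact mem_pointwise_smul_top_iff.mpr ((hJ z).mp hz))
  let g : QuotSMulTop x A →ₗ[A] B := Submodule.liftQ _ (Algebra.linearMap A B) (by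
    intro z hz
    obtain ⟨u, rfl⟩ := mem_pointwise_smul_top_iff.mp hz
    rw [LinearMap.mem_ker, Algebra.linearMap_apply]
    change φ (x * u) = 0
    rw [map_mul, hx, zero_mul])
  refine isWeaklyRegular_of_exact rs (f := f) (g := g) ?_ ?_ ?_ hJw hBw
  · rw [injective_iff_map_eq_zero]
    intro z hz
    obtain ⟨z, rfl⟩ := Submodule.Quotient.mk_surjective _ z
    rw [Submodule.mapQ_apply, Submodule.Quotient.mk_eq_zero, mem_pointwise_smul_top_iff] at hz
    rw [Submodule.Quotient.mk_eq_zero]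
    exact (hJ z).mpr hz
  · intro z
    obtain ⟨z, rfl⟩ := Submodule.Quotient.mk_surjective _ z
    constructor
    · intro hz
      obtain ⟨u, v, rfl⟩ := hker z hz
      refine ⟨Submodule.Quotient.mk v, ?_⟩
      rw [Submodule.mapQ_apply, Submodule.Quotient.eq, mem_pointwise_smul_top_iff]
      refine ⟨-u, ?_⟩
      change y * v - (x * u + y * v) = _
      ring
    · rintro ⟨w, hw⟩
      obtain ⟨w, rfl⟩ := Submodule.Quotient.mk_surjective _ w
      rw [← hw]
      change φ (y * w) = 0
      rw [map_mul, hy, zero_mul]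
  · intro b
    obtain ⟨z, rfl⟩ := hφ b
    exact ⟨Submodule.Quotient.mk z, rfl⟩

variable {R : Type u} [CommRing R]

/-- The map `R(I) → R'(I R')` induced by a ring homomorphism `R → R'`. -/
noncomputable def reesAlgebraMap {R' : Type*} [CommRing R'] (φ : R →+* R') (I : Ideal R) :
    reesAlgebra I →+* reesAlgebra (I.map φ) :=
  ((mapRingHom φ).comp (reesAlgebra I).val.toRingHom).codRestrict (reesAlgebra (I.map φ)) (by
    intro f n
    change ((f : R[X]).map φ).coeff n ∈ _
    rw [coeff_map, ← Ideal.map_pow]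
    exact Ideal.mem_map_of_mem _ (f.2 n))

theorem coe_reesAlgebraMap {R' : Type*} [CommRing R'] (φ : R →+* R') (I : Ideal R)
    (f : reesAlgebra I) : (reesAlgebraMap φ I f : R'[X]) = (f : R[X]).map φ := rfl

theorem reesAlgebraMap_algebraMap {R' : Type*} [CommRing R'] (φ : R →+* R') (I : Ideal R) (r : R) :
    reesAlgebraMap φ I (algebraMap R _ r) = algebraMap R' _ (φ r) :=
  Subtype.ext (map_C φ)

theorem reesAlgebraMap_reesDegreeOne {R' : Type*} [CommRing R'] (φ : R →+* R') (I : Ideal R)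
    (c : I) : reesAlgebraMap φ I (reesDegreeOne I c) =
      reesDegreeOne (I.map φ) ⟨φ c, Ideal.mem_map_of_mem φ c.2⟩ :=
  Subtype.ext (map_monomial φ)

theorem reesAlgebraMap_surjective {R' : Type*} [CommRing R'] (φ : R →+* R')
    (hφ : Function.Surjective φ) (I : Ideal R) : Function.Surjective (reesAlgebraMap φ I) := by
  intro g
  have h : ∀ n, ∃ c ∈ I ^ n, φ c = (g : R'[X]).coeff n := fun n => by
    have := g.2 n
    rw [← Ideal.map_pow] at this
    exact (Ideal.mem_map_iff_of_surjective φ hφ).mp this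
  choose c hc hcg using h
  refine ⟨∑ n ∈ (g : R'[X]).support, reesMonomial n (c n) (hc n), Subtype.ext ?_⟩
  rw [coe_reesAlgebraMap, AddSubmonoidClass.coe_finsetSum, Polynomial.map_sum]
  simp only [coe_reesMonomial, map_monomial, hcg]
  exact (Polynomial.as_sum_support _).symm

variable {I : Ideal R}

/-- The elements `a₁ t - a₂, …, a_{d-1} t - a_d, a_d t` of the Rees algebra. Together with `a₁` they
form a system of parameters at the graded maximal ideal. -/
noncomputable def reesChain (a : I) : List I → List (reesAlgebra I)
  | [] => [reesDegreeOne I a]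
  | b :: l => (reesDegreeOne I a - algebraMap R _ (b : R)) :: reesChain b l

/-- Modulo `I` the elements of the chain become `a₁ t, …, a_d t`. -/
theorem map_mk_reesChain (a : I) (l : List I) :
    (reesChain a l).map (Ideal.Quotient.mk (I.map (algebraMap R (reesAlgebra I)))) =
      ((a :: l).map (reesDegreeOne I)).map
        (Ideal.Quotient.mk (I.map (algebraMap R (reesAlgebra I)))) := by
  induction l generalizing a with
  | nil => rfl
  | cons b l ih =>
    rw [reesChain, List.map_cons, ih, List.map_cons, List.map_cons, map_sub,
      Ideal.Quotient.eq_zero_iff_mem.mpr (Ideal.mem_map_of_mem _ b.2), sub_zero]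
    rfl

/-- The map `I → I R'`. -/
def idealMap {R' : Type*} [CommRing R'] (φ : R →+* R') (I : Ideal R) (c : I) : I.map φ :=
  ⟨φ c, Ideal.mem_map_of_mem φ c.2⟩

theorem map_reesAlgebraMap_reesChain {R' : Type*} [CommRing R'] (φ : R →+* R') (a : I)
    (l : List I) : (reesChain a l).map (reesAlgebraMap φ I) =
      reesChain (idealMap φ I a) (l.map (idealMap φ I)) := by
  induction l generalizing a with
  | nil => simp [reesChain, reesAlgebraMap_reesDegreeOne, idealMap]
  | cons b l ih =>
    rw [reesChain, List.map_cons, ih, List.map_cons, reesChain, map_sub,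
      reesAlgebraMap_reesDegreeOne, reesAlgebraMap_algebraMap]
    rfl

/-- The case `fᵢ = X` of `isWeaklyRegular_associatedGradedRing`. -/
theorem isWeaklyRegular_map_reesDegreeOne (l : List I)
    (hw : IsWeaklyRegular R (l.map ((↑) : I → R)).reverse)
    (hI : I ^ 2 ≤ Ideal.ofList (l.map ((↑) : I → R)) * I) :
    IsWeaklyRegular (AssociatedGradedRing I) (l.map (reesDegreeOne I)) := by
  have h1 : (List.ofFn fun i => ((l.get i : I) : R)) = l.map ((↑) : I → R) := by
    conv_rhs => rw [← List.ofFn_get l, List.map_ofFn]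
    rfl
  have h := isWeaklyRegular_associatedGradedRing (a := fun i => ((l.get i : I) : R))
    (fun i => (l.get i).2) (by rwa [h1]) (by
      rw [span_range_eq_ofList_reverse, h1]
      refine hI.trans (Ideal.mul_mono_left (le_of_eq ?_))
      simp [Ideal.ofList]) (fun _ => X) fun _ => monic_X
  simp only [aeval_X] at h
  have h2 : l.map (reesDegreeOne I) = List.ofFn (fun i : Fin l.length =>
      (reesMonomial 1 ((l.get i : I) : R) (by simp) : reesAlgebra I)) := by
    conv_lhs => rw [← List.ofFn_get l, List.map_ofFn]
    rfl
  rw [h2]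
  exact h

/-- `(Iⁿ⁺¹ : a) = Iⁿ` for a member `a` of a regular sequence whose ideal `q` satisfies
`I² = q I`. -/
theorem mem_pow_of_mul_mem_pow_succ {a : R} {l : List R} (hw : IsWeaklyRegular R (l ++ [a]))
    (hl : Ideal.ofList (l ++ [a]) ≤ I) (hI : I ^ 2 ≤ Ideal.ofList (l ++ [a]) * I) {n : ℕ} {c : R}
    (hc : a * c ∈ I ^ (n + 1)) : c ∈ I ^ n := by
  cases n with
  | zero => simp
  | succ n =>
    rw [pow_succ_eq_pow_mul hl hI] at hc ⊢
    exact mem_pow_mul_of_mul_mem_pow_succ_mul hw hl hc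

end RegularSequenceOnRees

/-! ### A regular sequence in the graded maximal ideal of the Rees algebra -/

section GradedMaximalIdeal

open Polynomial

variable {R : Type u} [CommRing R] {I : Ideal R}

theorem isSMulRegular_algebraMap_reesAlgebra {a : R} (ha : IsSMulRegular R a) :
    IsSMulRegular (reesAlgebra I) (algebraMap R (reesAlgebra I) a) := by
  intro f g hfg
  apply Subtype.ext
  ext n
  apply ha
  have h1 : C a * (f : R[X]) = C a * (g : R[X]) := congrArg Subtype.val hfg
  have h2 := congrArg (fun g => g.coeff n) h1
  simpa using h2

theorem exists_eq_C_mul_of_dvd {a : R} {f : R[X]} (h : ∀ n, ∃ c, f.coeff n = a * c) :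
    ∃ g : R[X], f = C a * g := by
  choose c hc using h
  refine ⟨∑ n ∈ f.support, monomial n (c n), ?_⟩
  rw [Finset.mul_sum]
  simp only [C_mul_monomial, ← hc]
  exact Polynomial.as_sum_support f

/-- If `a, b` is a regular sequence in both orders, a relation `b f = a g` of polynomials is
trivial. -/
theorem exists_of_C_mul_eq_C_mul {a b : R} (ha : IsSMulRegular R a)
    (hb : ∀ c, b * c ∈ Ideal.span {a} → c ∈ Ideal.span {a}) {f g : R[X]}
    (h : C b * f = C a * g) : ∃ z, f = C a * z ∧ g = C b * z := by
  obtain ⟨z, rfl⟩ : ∃ z, f = C a * z := by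
    refine exists_eq_C_mul_of_dvd fun n => ?_
    have h1 : b * f.coeff n ∈ Ideal.span {a} := by
      rw [← coeff_C_mul, h, coeff_C_mul]
      exact Ideal.mul_mem_right _ _ (Ideal.mem_span_singleton_self a)
    obtain ⟨c, hc⟩ := Ideal.mem_span_singleton.mp (hb _ h1)
    exact ⟨c, hc⟩
  refine ⟨z, rfl, ?_⟩
  ext n
  apply ha
  have h1 := congrArg (fun p => p.coeff n) h
  simp only [coeff_C_mul] at h1
  change a * _ = a * _
  rw [coeff_C_mul, ← h1]
  ring

/-- The second quotient by `X` of the relation `u X² = (a X - b) z + w`. -/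
theorem eq_add_of_mul_X_mul_X_eq {a b : R} {u w z : R[X]}
    (h : u * X * X = (C a * X - C b) * z + w) :
    u = (C a * X - C b) * z.divX.divX + C a * C (z.coeff 1) + w.divX.divX := by
  have hz : z.divX.divX * X + C (z.coeff 1) = z.divX := by
    conv_rhs => rw [← divX_mul_X_add z.divX, coeff_divX]
  have h3 : (C a * X - C b) * z.divX.divX + C a * C (z.coeff 1) =
      C a * z.divX - C b * z.divX.divX := by linear_combination C a * hz
  ext n
  have h1 := congrArg (fun p => p.coeff (n + 2)) h
  have h4 : (C a * X - C b) * z = C a * (X * z) - C b * z := by ring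
  rw [h4] at h1
  simp only [coeff_mul_X, coeff_add, coeff_sub, coeff_C_mul, coeff_X_mul] at h1
  rw [h3, h1]
  simp only [coeff_add, coeff_sub, coeff_C_mul, coeff_divX]

/-- The case of two elements: `a, a t - b, b t` is a regular sequence on the Rees algebra. -/
theorem isWeaklyRegular_reesChain_pair (a b : I) (ha : IsSMulRegular R (a : R))
    (hb : ∀ c, (b : R) * c ∈ Ideal.span {(a : R)} → c ∈ Ideal.span {(a : R)})
    (hVV : ∀ n c, (a : R) * c ∈ I ^ (n + 1) → c ∈ I ^ n)
    (hI : I ^ 2 ≤ Ideal.ofList [(a : R), (b : R)] * I) :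
    IsWeaklyRegular (reesAlgebra I) (algebraMap R (reesAlgebra I) (a : R) :: reesChain a [b]) := by
  set α : reesAlgebra I := algebraMap R (reesAlgebra I) (a : R) with hα
  set θ : reesAlgebra I := reesDegreeOne I a - algebraMap R (reesAlgebra I) (b : R) with hθ
  set β : reesAlgebra I := reesDegreeOne I b with hβ
  have hαc : (α : R[X]) = C (a : R) := rfl
  have hθc : (θ : R[X]) = C (a : R) * X - C (b : R) := by
    rw [C_mul_X_eq_monomial]; rfl
  have hβc : (β : R[X]) = C (b : R) * X := by
    rw [C_mul_X_eq_monomial]; rfl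
  have hchain : α :: reesChain a [b] = ([α] ++ [θ]) ++ [β] := rfl
  rw [hchain, isWeaklyRegular_append_singleton_iff, isWeaklyRegular_append_singleton_iff,
    Ideal.ofList_singleton, isWeaklyRegular_singleton_iff]
  refine ⟨⟨isSMulRegular_algebraMap_reesAlgebra ha, ?_⟩, ?_⟩
  · intro u hu
    obtain ⟨v, hv⟩ := Ideal.mem_span_singleton.mp hu
    have hv' := congrArg (Subtype.val : reesAlgebra I → R[X]) hv
    simp only [MulMemClass.coe_mul, hθc, hαc] at hv'
    obtain ⟨w, hw, hw'⟩ := exists_of_C_mul_eq_C_mul (f := (u : R[X]))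
      (g := (u : R[X]) * X - (v : R[X])) ha hb
      (by linear_combination -hv')
    -- `(a X - b) w = v`
    have hrel : C (a : R) * w * X - (v : R[X]) = C (b : R) * w := by rw [← hw, hw']
    have hwmem : ∀ n, w.coeff n ∈ I ^ n := by
      intro n
      apply hVV
      have h1 := congrArg (fun p => p.coeff (n + 1)) hrel
      simp only [coeff_sub, coeff_mul_X, coeff_C_mul] at h1
      rw [sub_eq_iff_eq_add.mp h1]
      refine add_mem ?_ (v.2 _)
      rw [pow_succ']
      refine Ideal.mul_mem_mul b.2 (hVV n _ ?_)
      rw [← coeff_C_mul, ← hw]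
      exact u.2 _
    have hu_eq : u = α * ⟨w, hwmem⟩ := Subtype.ext hw
    rw [hu_eq]
    exact Ideal.mul_mem_right _ _ (Ideal.mem_span_singleton_self α)
  · intro u hu
    rw [Ideal.ofList_append, Ideal.ofList_singleton, Ideal.ofList_singleton] at hu ⊢
    set 𝔞 : Ideal (reesAlgebra I) := Ideal.span {α} ⊔ Ideal.span {θ} with h𝔞
    have hα𝔞 : α ∈ 𝔞 := Ideal.mem_sup_left (Ideal.mem_span_singleton_self α)
    have hθ𝔞 : θ ∈ 𝔞 := Ideal.mem_sup_right (Ideal.mem_span_singleton_self θ)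
    obtain ⟨w₀, hw₀, v₀, hv₀, huv⟩ := Submodule.mem_sup.mp hu
    obtain ⟨w, rfl⟩ := Ideal.mem_span_singleton.mp hw₀
    obtain ⟨v, rfl⟩ := Ideal.mem_span_singleton.mp hv₀
    have huv' := congrArg (Subtype.val : reesAlgebra I → R[X]) huv
    simp only [MulMemClass.coe_mul, hθc, hαc, hβc, AddMemClass.coe_add] at huv'
    obtain ⟨z, hz, hz'⟩ := exists_of_C_mul_eq_C_mul (f := (u : R[X]) * X + (v : R[X]))
      (g := (w : R[X]) + (v : R[X]) * X) ha hb (by linear_combination -huv')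
    have hzmem : ∀ n, z.coeff (n + 2) ∈ I ^ n := by
      intro n
      apply hVV
      rw [← coeff_C_mul, ← hz, coeff_add, coeff_mul_X]
      exact add_mem (u.2 _) (Ideal.pow_le_pow_right (by omega) (v.2 (n + 2)))
    let y : reesAlgebra I := ⟨z.divX.divX, fun n => by
      rw [coeff_divX, coeff_divX]; exact hzmem n⟩
    -- the part of `w` in degrees at least two, which lies in the ideal
    have hwI : ∀ n, ∃ g ∈ 𝔞, (g : R[X]) = monomial n ((w : R[X]).coeff (n + 2)) := by
      intro n
      have h1 : (w : R[X]).coeff (n + 2) ∈ Ideal.ofList [(a : R), (b : R)] * I ^ (n + 1) := by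
        have h2 : I ^ (n + 2) ≤ Ideal.ofList [(a : R), (b : R)] * I ^ (n + 1) := by
          calc I ^ (n + 2) = I ^ 2 * I ^ n := by ring
            _ ≤ Ideal.ofList [(a : R), (b : R)] * I * I ^ n := Ideal.mul_mono_left hI
            _ = Ideal.ofList [(a : R), (b : R)] * I ^ (n + 1) := by ring
        exact h2 (w.2 _)
      rw [Ideal.ofList_cons, Ideal.ofList_singleton, Ideal.sup_mul] at h1
      obtain ⟨p, hp, p', hp', hpp⟩ := Submodule.mem_sup.mp h1
      obtain ⟨p, hpI, rfl⟩ := Ideal.mem_span_singleton_mul.mp hp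
      obtain ⟨p', hpI', rfl⟩ := Ideal.mem_span_singleton_mul.mp hp'
      refine ⟨α * reesMonomial n p (Ideal.pow_le_pow_right (by omega) hpI) -
        θ * reesMonomial n p' (Ideal.pow_le_pow_right (by omega) hpI') +
        α * reesMonomial (n + 1) p' hpI', ?_, ?_⟩
      · exact add_mem (sub_mem (Ideal.mul_mem_right _ _ hα𝔞) (Ideal.mul_mem_right _ _ hθ𝔞))
          (Ideal.mul_mem_right _ _ hα𝔞)
      · rw [← hpp]
        simp only [MulMemClass.coe_mul, hθc, hαc, AddMemClass.coe_add, AddSubgroupClass.coe_sub,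
          coe_reesMonomial, map_add, ← C_mul_X_pow_eq_monomial, C_mul]
        ring
    choose g hg hgc using hwI
    let ω : reesAlgebra I := ∑ n ∈ (w : R[X]).divX.divX.support, g n
    have hω : (ω : R[X]) = (w : R[X]).divX.divX := by
      rw [AddSubmonoidClass.coe_finsetSum]
      simp only [hgc]
      conv_rhs => rw [Polynomial.as_sum_support (w : R[X]).divX.divX]
      simp only [coeff_divX]
    have hω𝔞 : ω ∈ 𝔞 := sum_mem fun n _ => hg n
    have hu_eq : u = θ * y + α * algebraMap R _ (z.coeff 1) + ω := by
      apply Subtype.ext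
      simp only [MulMemClass.coe_mul, hθc, hαc, AddMemClass.coe_add, hω]
      change (u : R[X]) = (C (a : R) * X - C (b : R)) * z.divX.divX +
        C (a : R) * C (z.coeff 1) + (w : R[X]).divX.divX
      exact eq_add_of_mul_X_mul_X_eq (by linear_combination X * hz - hz')
    rw [hu_eq]
    exact add_mem (add_mem (Ideal.mul_mem_right _ _ hθ𝔞) (Ideal.mul_mem_right _ _ hα𝔞)) hω𝔞

theorem isWeaklyRegular_quotient_congr {A : Type u} [CommRing A] (J : Ideal A) {rs rs' : List A}
    (h : rs.map (Ideal.Quotient.mk J) = rs'.map (Ideal.Quotient.mk J))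
    (hrs : IsWeaklyRegular (A ⧸ J) rs) : IsWeaklyRegular (A ⧸ J) rs' := by
  have h1 := (isWeaklyRegular_map_algebraMap_iff (A ⧸ J) (A ⧸ J) rs).mpr hrs
  exact (isWeaklyRegular_map_algebraMap_iff (A ⧸ J) (A ⧸ J) rs').mp
    ((congrArg (IsWeaklyRegular (A ⧸ J)) h).mp h1)

/-- In the Rees algebra, `(a : a t)` is the ideal generated by `I`. -/
theorem mem_map_algebraMap_iff_exists_reesDegreeOne_mul {a : I} (ha : IsSMulRegular R (a : R))
    (z : reesAlgebra I) : z ∈ I.map (algebraMap R (reesAlgebra I)) ↔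
      ∃ u, reesDegreeOne I a * z = algebraMap R (reesAlgebra I) (a : R) * u := by
  have hDc : (reesDegreeOne I a : R[X]) = C (a : R) * X := by
    rw [C_mul_X_eq_monomial]; rfl
  rw [mem_map_reesAlgebra_iff]
  constructor
  · intro hz
    refine ⟨⟨X * (z : R[X]), fun n => ?_⟩, Subtype.ext ?_⟩
    · cases n with
      | zero => simp
      | succ n => rw [coeff_X_mul, pow_succ']; exact hz n
    · rw [MulMemClass.coe_mul, hDc, mul_assoc]; rfl
  · rintro ⟨u, hu⟩ n
    have h1 := congrArg (fun f : reesAlgebra I => (f : R[X]).coeff (n + 1)) hu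
    have h2 : (C (a : R) * X * (z : R[X])).coeff (n + 1) =
        (C (a : R) * (u : R[X])).coeff (n + 1) := by
      rw [← hDc]; exact h1
    rw [mul_assoc, coeff_C_mul, coeff_C_mul, coeff_X_mul] at h2
    rw [ha h2, ← pow_succ']
    exact u.2 _

/-- The kernel of `R(I) → R'(I R')` with `R' = R / a R` is generated by `a` and `a t`. -/
theorem exists_eq_add_of_reesAlgebraMap_eq_zero {a : I}
    (hVV : ∀ n c, (a : R) * c ∈ I ^ (n + 1) → c ∈ I ^ n) (z : reesAlgebra I)
    (hz : reesAlgebraMap (Ideal.Quotient.mk (Ideal.span {(a : R)})) I z = 0) :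
    ∃ u v, z = algebraMap R (reesAlgebra I) (a : R) * u + reesDegreeOne I a * v := by
  have hz' : (z : R[X]).map (Ideal.Quotient.mk (Ideal.span {(a : R)})) = 0 :=
    congrArg Subtype.val hz
  obtain ⟨g, hg⟩ : ∃ g, (z : R[X]) = C (a : R) * g := by
    refine exists_eq_C_mul_of_dvd fun n => ?_
    have h1 := congrArg (fun p => p.coeff n) hz'
    rw [coeff_map, coeff_zero, Ideal.Quotient.eq_zero_iff_mem] at h1
    obtain ⟨c, hc⟩ := Ideal.mem_span_singleton.mp h1
    exact ⟨c, hc⟩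
  refine ⟨algebraMap R _ (g.coeff 0), ⟨g.divX, fun n => ?_⟩, Subtype.ext ?_⟩
  · rw [coeff_divX]
    apply hVV
    rw [← coeff_C_mul, ← hg]
    exact z.2 _
  · have hDc : (reesDegreeOne I a : R[X]) = C (a : R) * X := by
      rw [C_mul_X_eq_monomial]; rfl
    change (z : R[X]) = C (a : R) * C (g.coeff 0) + (reesDegreeOne I a : R[X]) * g.divX
    rw [hDc, hg]
    conv_lhs => rw [← divX_mul_X_add g]
    ring

/-- The form of `mem_pow_of_mul_mem_pow_succ` for the first element of the sequence. -/
theorem mem_pow_of_mul_mem_pow_succ_of_perm [IsLocalRing R] [IsNoetherianRing R]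
    (hIm : I ≤ maximalIdeal R) {a : I} {l : List I}
    (hw : IsWeaklyRegular R ((a :: l).map ((↑) : I → R)))
    (hI : I ^ 2 ≤ Ideal.ofList ((a :: l).map ((↑) : I → R)) * I) (n : ℕ) (c : R)
    (hc : (a : R) * c ∈ I ^ (n + 1)) : c ∈ I ^ n := by
  have hperm : ((a :: l).map ((↑) : I → R)).Perm (l.map ((↑) : I → R) ++ [(a : R)]) :=
    (List.perm_append_singleton _ _).symm
  have hof : Ideal.ofList ((a :: l).map ((↑) : I → R)) =
      Ideal.ofList (l.map ((↑) : I → R) ++ [(a : R)]) := by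
    rw [Ideal.ofList_append, List.map_cons, Ideal.ofList_cons, Ideal.ofList_singleton, sup_comm]
  have hmem : ∀ r ∈ (a :: l).map ((↑) : I → R), r ∈ I := by
    intro r hr
    obtain ⟨x, -, rfl⟩ := List.mem_map.mp hr
    exact x.2
  refine mem_pow_of_mul_mem_pow_succ
    (IsLocalRing.isWeaklyRegular_of_perm_of_subset_maximalIdeal hw hperm
      fun r hr => hIm (hmem r hr)) ?_ (hof ▸ hI) hc
  rw [← hof]
  exact Ideal.span_le.mpr hmem

/-- Let `l` be a regular sequence of length at least two in `I` with `I² = (l) I`. Then its first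
element and the chain of `l` form a regular sequence on the Rees algebra. The induction step uses
that `R(I) / a R(I)` with `R' = R / a R` is an extension of `R'(I R')` by `G(I)`. -/
theorem isWeaklyRegular_reesChain : ∀ (n : ℕ) {R : Type u} [CommRing R] [IsLocalRing R]
    [IsNoetherianRing R] {I : Ideal R} (_ : I ≤ maximalIdeal R) (a b : I) (l : List I)
    (_ : l.length = n) (_ : IsWeaklyRegular R ((a :: b :: l).map ((↑) : I → R)))
    (_ : I ^ 2 ≤ Ideal.ofList ((a :: b :: l).map ((↑) : I → R)) * I),
    IsWeaklyRegular (reesAlgebra I)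
      (algebraMap R (reesAlgebra I) (a : R) :: reesChain a (b :: l)) := by
  intro n
  induction n with
  | zero =>
    intro R _ _ _ I hIm a b l hl hw hI
    obtain rfl := List.length_eq_zero_iff.mp hl
    have h1 : IsWeaklyRegular R ([(a : R)] ++ [(b : R)]) := hw
    obtain ⟨ha, hb⟩ := (isWeaklyRegular_append_singleton_iff _ _).mp h1
    rw [Ideal.ofList_singleton] at hb
    exact isWeaklyRegular_reesChain_pair a b ((isWeaklyRegular_singleton_iff _ _).mp ha) hb
      (mem_pow_of_mul_mem_pow_succ_of_perm hIm hw hI) hI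
  | succ n ih =>
    intro R _ _ _ I hIm a b l hl hw hI
    obtain ⟨c, l, rfl⟩ := List.exists_cons_of_length_eq_add_one hl
    have hw' := hw
    rw [List.map_cons, isWeaklyRegular_cons_iff_quotient] at hw'
    obtain ⟨ha, hwq⟩ := hw'
    have ham : (a : R) ∈ maximalIdeal R := hIm a.2
    have hnt : Nontrivial (R ⧸ Ideal.span {(a : R)}) := by
      rw [Ideal.Quotient.nontrivial_iff]
      exact ne_top_of_le_ne_top (maximalIdeal.isMaximal R).ne_top
        ((Ideal.span_singleton_le_iff_mem _).mpr ham)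
    have hloc : IsLocalRing (R ⧸ Ideal.span {(a : R)}) :=
      IsLocalRing.of_surjective' _ Ideal.Quotient.mk_surjective
    set φ : R →+* R ⧸ Ideal.span {(a : R)} := Ideal.Quotient.mk _ with hφ
    have hφs : Function.Surjective φ := Ideal.Quotient.mk_surjective
    have hφloc : IsLocalHom φ := IsLocalHom.of_surjective _ hφs
    have hφa : φ (a : R) = 0 := Ideal.Quotient.eq_zero_iff_mem.mpr (Ideal.mem_span_singleton_self _)
    have hIm' : I.map φ ≤ maximalIdeal (R ⧸ Ideal.span {(a : R)}) := by
      refine Ideal.map_le_iff_le_comap.mpr (hIm.trans ?_)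
      exact fun x hx hu => hx (hφloc.map_nonunit x hu)
    have hmap : ∀ l : List I, (l.map (idealMap φ I)).map ((↑) : I.map φ → _) =
        (l.map ((↑) : I → R)).map φ := by
      intro l
      rw [List.map_map, List.map_map]
      rfl
    have hperm : ((a :: b :: c :: l).map ((↑) : I → R)).Perm
        ((a :: b :: c :: l).map ((↑) : I → R)).reverse := (List.reverse_perm _).symm
    have hmem : ∀ r ∈ (a :: b :: c :: l).map ((↑) : I → R), r ∈ maximalIdeal R := by
      intro r hr
      obtain ⟨x, -, rfl⟩ := List.mem_map.mp hr
      exact hIm x.2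
    refine (isWeaklyRegular_cons_iff _ _ _).mpr ⟨isSMulRegular_algebraMap_reesAlgebra ha, ?_⟩
    refine isWeaklyRegular_quotSMulTop_of_surjective (reesAlgebraMap φ I)
      (reesAlgebraMap_surjective φ hφs I) (y := reesDegreeOne I a) ?_ ?_
      (mem_map_algebraMap_iff_exists_reesDegreeOne_mul ha)
      (exists_eq_add_of_reesAlgebraMap_eq_zero (mem_pow_of_mul_mem_pow_succ_of_perm hIm hw hI))
      ?_ ?_
    · rw [reesAlgebraMap_algebraMap, hφa, map_zero]
    · rw [reesAlgebraMap_reesDegreeOne]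
      simp only [hφa]
      exact map_zero (reesDegreeOne (I.map φ))
    · exact isWeaklyRegular_quotient_congr _ (map_mk_reesChain a (b :: c :: l)).symm
        (isWeaklyRegular_map_reesDegreeOne _
          (IsLocalRing.isWeaklyRegular_of_perm_of_subset_maximalIdeal hw hperm hmem) hI)
    · rw [map_reesAlgebraMap_reesChain, List.map_cons, List.map_cons, reesChain]
      have h0 : reesDegreeOne (I.map φ) (idealMap φ I a) = 0 := by
        have : idealMap φ I a = 0 := Subtype.ext hφa
        rw [this, map_zero]
      rw [h0, zero_sub]
      apply isWeaklyRegular_neg_cons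
      refine ih hIm' _ _ _ (by simpa using hl) ?_ ?_
      · rw [← List.map_cons, ← List.map_cons, hmap]
        exact hwq
      · rw [← List.map_cons, ← List.map_cons, hmap]
        have h2 := Ideal.map_mono (f := φ) hI
        rw [Ideal.map_pow, Ideal.map_mul, Ideal.map_ofList, List.map_cons, List.map_cons,
          Ideal.ofList_cons, hφa, Ideal.span_singleton_zero, bot_sup_eq] at h2
        exact h2

end GradedMaximalIdeal

/-! ### Cohen–Macaulayness of the Rees algebra -/

section CohenMacaulayRees

open Polynomial

variable {R : Type u} [CommRing R] {I : Ideal R}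

/-- If `J A_P = x A_P` with `x` regular, then `x` followed by a regular sequence on `A / J` is a
regular sequence on `A_P`. -/
theorem isWeaklyRegular_localization_cons {A : Type u} [CommRing A] (P : Ideal A) [P.IsPrime]
    {J : Ideal A} {x y : A} (hy : y ∉ P) (hxJ : x ∈ J) (hJ : ∀ z ∈ J, ∃ w, y * z = x * w)
    (hx : IsSMulRegular A x) {rs : List A} (h : IsWeaklyRegular (A ⧸ J) rs) :
    IsWeaklyRegular (Localization.AtPrime P) (x :: rs) := by
  let L := Localization.AtPrime P
  have hxL : IsSMulRegular L x := by
    have h1 := ((isWeaklyRegular_singleton_iff A x).mpr hx).of_isLocalization L P.primeCompl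
    exact (isWeaklyRegular_singleton_iff L x).mp
      ((isWeaklyRegular_map_algebraMap_iff L L [x]).mp h1)
  have hJL : (J • ⊤ : Submodule A L) = x • ⊤ := by
    apply le_antisymm
    · rw [Submodule.smul_le]
      intro z hz u _
      obtain ⟨w, hw⟩ := hJ z hz
      rw [Submodule.mem_smul_pointwise_iff_exists]
      have hu : IsUnit (algebraMap A L y) := IsLocalization.map_units L (⟨y, hy⟩ : P.primeCompl)
      obtain ⟨v, hv⟩ := hu
      refine ⟨(↑v⁻¹ : L) * (algebraMap A L w * u), trivial, ?_⟩
      have h2 : algebraMap A L y * algebraMap A L z = algebraMap A L x * algebraMap A L w := by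
        rw [← map_mul, hw, map_mul]
      rw [Algebra.smul_def, Algebra.smul_def]
      calc algebraMap A L x * (↑v⁻¹ * (algebraMap A L w * u))
          = ↑v⁻¹ * (algebraMap A L x * algebraMap A L w) * u := by ring
        _ = ↑v⁻¹ * (v * algebraMap A L z) * u := by rw [← h2, hv]
        _ = algebraMap A L z * u := by rw [Units.inv_mul_cancel_left]
    · rw [← Submodule.ideal_span_singleton_smul]
      exact Submodule.smul_mono_left ((Ideal.span_singleton_le_iff_mem _).mpr hxJ)
  rw [isWeaklyRegular_cons_iff]
  refine ⟨hxL, ?_⟩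
  let e : L ⊗[A] (A ⧸ J) ≃ₗ[A] QuotSMulTop x L :=
    (TensorProduct.tensorQuotEquivQuotSMul L J).trans (Submodule.quotEquivOfEq _ _ hJL)
  exact (e.isWeaklyRegular_congr rs).mp h.isWeaklyRegular_lTensor

theorem reesDegreeOne_mul_algebraMap (a b : I) :
    algebraMap R (reesAlgebra I) (b : R) * reesDegreeOne I a =
      algebraMap R (reesAlgebra I) (a : R) * reesDegreeOne I b := by
  apply Subtype.ext
  change C (b : R) * monomial 1 (a : R) = C (a : R) * monomial 1 (b : R)
  rw [C_mul_monomial, C_mul_monomial, mul_comm]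

/-- The Rees algebra is Cohen–Macaulay at the maximal ideals `P` that contain `I` but not all of
the `aᵢ t`. If `aᵢ t ∉ P`, then `aᵢ` generates `I R(I)_P`, so a regular sequence on `G(I)` lifts. -/
theorem isCohenMacaulayLocalRing_of_reesDegreeOne_notMem [IsNoetherianRing R] {d : ℕ}
    {a : Fin d → R} (ha : ∀ i, a i ∈ I) (hw : IsWeaklyRegular R (List.ofFn a).reverse)
    (hI : I ^ 2 ≤ Ideal.span (Set.range a) * I) (P : Ideal (reesAlgebra I)) [P.IsMaximal]
    (hmax : ∀ Q : Ideal (reesAlgebra I), Q.IsPrime → (∀ c ∈ I, algebraMap R _ c ∈ Q) →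
      (Q.comap (algebraMap R (reesAlgebra I))).IsMaximal)
    (hIP : ∀ c ∈ I, algebraMap R (reesAlgebra I) c ∈ P) (i : Fin d)
    (hreg : IsSMulRegular R (a i)) (hi : reesDegreeOne I ⟨a i, ha i⟩ ∉ P) :
    IsCohenMacaulayLocalRing (Localization.AtPrime P) := by
  choose f hf hfm using fun j => exists_monic_aeval_mem P (hmax P inferInstance hIP)
    (reesDegreeOne I ⟨a j, ha j⟩)
  let α : reesAlgebra I := algebraMap R (reesAlgebra I) (a i)
  let rs : List (reesAlgebra I) := List.ofFn fun j => aeval (reesDegreeOne I ⟨a j, ha j⟩) (f j)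
  have h1 : IsWeaklyRegular (AssociatedGradedRing I) rs :=
    isWeaklyRegular_associatedGradedRing ha hw hI f hf
  have hα : IsSMulRegular (reesAlgebra I) α := isSMulRegular_algebraMap_reesAlgebra hreg
  have h2 : IsWeaklyRegular (Localization.AtPrime P) (α :: rs) :=
    isWeaklyRegular_localization_cons P hi (Ideal.mem_map_of_mem _ (ha i))
      (fun z hz => (mem_map_algebraMap_iff_exists_reesDegreeOne_mul hreg z).mp hz) hα h1
  have hmem : ∀ r ∈ α :: rs, r ∈ P := by
    intro r hr
    rcases List.mem_cons.mp hr with rfl | hr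
    · exact hIP _ (ha i)
    · obtain ⟨j, rfl⟩ := List.mem_ofFn.mp hr
      exact hfm j
  refine isCohenMacaulayLocalRing_atPrime P (α :: rs) hmem h2
    (height_le_length_of_mem_minimalPrimes ?_)
  refine ⟨⟨inferInstance, Ideal.span_le.mpr hmem⟩, ?_⟩
  rintro Q ⟨hQ, hQle⟩ hQP
  have hrsQ : ∀ r ∈ α :: rs, r ∈ Q := fun r hr => hQle (Ideal.subset_span hr)
  have hIQ : ∀ c ∈ I, algebraMap R _ c ∈ Q := by
    intro c hc
    have h3 : algebraMap R (reesAlgebra I) c * reesDegreeOne I ⟨a i, ha i⟩ ∈ Q := by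
      rw [reesDegreeOne_mul_algebraMap ⟨a i, ha i⟩ ⟨c, hc⟩]
      exact Ideal.mul_mem_right _ _ (hrsQ _ List.mem_cons_self)
    exact (hQ.mem_or_mem h3).resolve_right fun h => hi (hQP h)
  have hQm : Q.IsMaximal := isMaximal_of_aeval_mem ha hI f hf Q (hmax Q hQ hIQ) fun j =>
    hrsQ _ (List.mem_cons_of_mem _ (List.mem_ofFn.mpr ⟨j, rfl⟩))
  exact (hQm.eq_of_le (Ideal.IsPrime.ne_top inferInstance) hQP).ge

/-- A prime that contains `a₁` and the chain `a₁ t - a₂, …, a_d t` contains all `aᵢ` and `aᵢ t`,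
because `aᵢ₊₁² = aᵢ₊₁ · aᵢ t = aᵢ · aᵢ₊₁ t` modulo it. -/
theorem mem_of_forall_reesChain_mem {P : Ideal (reesAlgebra I)} [P.IsPrime] (a : I) (l : List I)
    (ha : algebraMap R (reesAlgebra I) (a : R) ∈ P) (h : ∀ x ∈ reesChain a l, x ∈ P) :
    ∀ x ∈ a :: l, algebraMap R (reesAlgebra I) (x : R) ∈ P ∧ reesDegreeOne I x ∈ P := by
  induction l generalizing a with
  | nil =>
    intro x hx
    obtain rfl := List.mem_singleton.mp hx
    exact ⟨ha, h _ (List.mem_singleton_self _)⟩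
  | cons b l ih =>
    have h1 : reesDegreeOne I a - algebraMap R _ (b : R) ∈ P := h _ List.mem_cons_self
    have hb : algebraMap R (reesAlgebra I) (b : R) ∈ P := by
      have h2 : algebraMap R (reesAlgebra I) (b : R) *
          algebraMap R (reesAlgebra I) (b : R) ∈ P := by
        have h3 := Ideal.mul_mem_left P (algebraMap R (reesAlgebra I) (b : R)) h1
        rw [mul_sub, reesDegreeOne_mul_algebraMap] at h3
        have h4 := sub_mem (Ideal.mul_mem_right (reesDegreeOne I b) P ha) h3
        rwa [sub_sub_cancel] at h4
      exact (Ideal.IsPrime.mem_or_mem inferInstance h2).elim id id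
    have hDa : reesDegreeOne I a ∈ P := by simpa using add_mem h1 hb
    intro x hx
    rcases List.mem_cons.mp hx with rfl | hx
    · exact ⟨ha, hDa⟩
    · exact ih b hb (fun y hy => h y (List.mem_cons_of_mem _ hy)) x hx

/-- The graded maximal ideal is the only maximal ideal that contains all of `I t`. -/
theorem le_of_reesDegreeOne_mem {P Q : Ideal (reesAlgebra I)} (hP : P ≠ ⊤)
    (hm : (Q.comap (algebraMap R (reesAlgebra I))).IsMaximal) (hQP : Q ≤ P)
    (hQ : ∀ c, reesDegreeOne I c ∈ Q) : P ≤ Q := by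
  intro x hx
  have h1 : x ∈ (⊥ : Subalgebra R (reesAlgebra I ⧸ Q)).comap (Ideal.Quotient.mkₐ R Q) := by
    refine mem_of_reesDegreeOne_mem (fun c => ?_) x
    rw [Subalgebra.mem_comap]
    have : Ideal.Quotient.mkₐ R Q (reesDegreeOne I c) = 0 :=
      Ideal.Quotient.eq_zero_iff_mem.mpr (hQ c)
    rw [this]
    exact zero_mem _
  rw [Subalgebra.mem_comap] at h1
  obtain ⟨r, hr⟩ := Algebra.mem_bot.mp h1
  have h2 : algebraMap R _ r - x ∈ Q := Ideal.Quotient.eq.mp hr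
  have h3 : algebraMap R (reesAlgebra I) r ∈ P := by
    have := add_mem (hQP h2) hx
    rwa [sub_add_cancel] at this
  have h4 : Q.comap (algebraMap R (reesAlgebra I)) = P.comap (algebraMap R (reesAlgebra I)) :=
    hm.eq_of_le (Ideal.comap_ne_top _ hP) (Ideal.comap_mono hQP)
  have h5 : r ∈ Q.comap (algebraMap R (reesAlgebra I)) := by
    rw [h4]; exact h3
  have := sub_mem (Ideal.mem_comap.mp h5) h2
  rwa [sub_sub_cancel] at this

/-- The Rees algebra is Cohen–Macaulay at its graded maximal ideal, with the system of parameters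
`a₁, a₁ t - a₂, …, a_{d-1} t - a_d, a_d t`. -/
theorem isCohenMacaulayLocalRing_of_reesDegreeOne_mem [IsLocalRing R] [IsNoetherianRing R]
    (hIm : I ≤ maximalIdeal R) (a b : I) (l : List I)
    (hw : IsWeaklyRegular R ((a :: b :: l).map ((↑) : I → R)))
    (hI : I ^ 2 ≤ Ideal.ofList ((a :: b :: l).map ((↑) : I → R)) * I)
    (P : Ideal (reesAlgebra I)) [P.IsMaximal]
    (hmax : ∀ Q : Ideal (reesAlgebra I), Q.IsPrime → (∀ c ∈ I, algebraMap R _ c ∈ Q) →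
      (Q.comap (algebraMap R (reesAlgebra I))).IsMaximal)
    (hIP : ∀ c ∈ I, algebraMap R (reesAlgebra I) c ∈ P)
    (hP : ∀ c, reesDegreeOne I c ∈ P) :
    IsCohenMacaulayLocalRing (Localization.AtPrime P) := by
  have h1 := isWeaklyRegular_reesChain l.length hIm a b l rfl hw hI
  set rs := algebraMap R (reesAlgebra I) (a : R) :: reesChain a (b :: l) with hrs
  have h2 : IsWeaklyRegular (Localization.AtPrime P) rs :=
    (isWeaklyRegular_map_algebraMap_iff _ _ _).mp
      (h1.of_isLocalization (Localization.AtPrime P) P.primeCompl)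
  have hchain : ∀ (a : I) (l : List I), ∀ x ∈ reesChain a l, x ∈ P := by
    intro a l
    induction l generalizing a with
    | nil =>
      intro x hx
      obtain rfl := List.mem_singleton.mp hx
      exact hP a
    | cons b l ih =>
      intro x hx
      rcases List.mem_cons.mp hx with rfl | hx
      · exact sub_mem (hP a) (hIP _ b.2)
      · exact ih b x hx
  have hmem : ∀ r ∈ rs, r ∈ P := by
    intro r hr
    rcases List.mem_cons.mp hr with rfl | hr
    · exact hIP _ a.2
    · exact hchain _ _ r hr
  refine isCohenMacaulayLocalRing_atPrime P rs hmem h2 (height_le_length_of_mem_minimalPrimes ?_)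
  refine ⟨⟨inferInstance, Ideal.span_le.mpr hmem⟩, ?_⟩
  rintro Q ⟨hQ, hQle⟩ hQP
  have hrsQ : ∀ r ∈ rs, r ∈ Q := fun r hr => hQle (Ideal.subset_span hr)
  have h3 := mem_of_forall_reesChain_mem a (b :: l) (hrsQ _ List.mem_cons_self)
    fun x hx => hrsQ x (List.mem_cons_of_mem _ hx)
  set L : List I := a :: b :: l with hL
  have hofL : Ideal.ofList (L.map ((↑) : I → R)) ≤ Q.comap (algebraMap R (reesAlgebra I)) := by
    refine Ideal.span_le.mpr fun r hr => ?_
    obtain ⟨x, hx, rfl⟩ := List.mem_map.mp hr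
    exact (h3 x hx).1
  have hIQ : ∀ c ∈ I, algebraMap R (reesAlgebra I) c ∈ Q := by
    intro c hc
    have h4 : c ^ 2 ∈ Q.comap (algebraMap R (reesAlgebra I)) :=
      hofL (mem_left_of_mem_mul (hI (Ideal.pow_mem_pow hc 2)))
    rw [Ideal.mem_comap, map_pow] at h4
    exact hQ.mem_of_pow_mem 2 h4
  have hDQ : ∀ c, reesDegreeOne I c ∈ Q := by
    intro c
    have h5 : (List.ofFn fun i => ((L.get i : I) : R)) = L.map ((↑) : I → R) := by
      conv_rhs => rw [← List.ofFn_get L, List.map_ofFn]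
      rfl
    obtain ⟨e, he⟩ := exists_reesDegreeOne_mul_eq (a := fun i => ((L.get i : I) : R))
      (fun i => (L.get i).2) (by
        rw [span_range_eq_ofList_reverse, h5]
        refine hI.trans (Ideal.mul_mono_left (le_of_eq ?_))
        simp [Ideal.ofList]) c c
    have h4 : reesDegreeOne I c * reesDegreeOne I c ∈ Q := by
      rw [he]
      exact sum_mem fun i _ => Ideal.mul_mem_right _ _ (h3 _ (List.get_mem L i)).2
    exact (hQ.mem_or_mem h4).elim id id
  exact le_of_reesDegreeOne_mem (Ideal.IsPrime.ne_top inferInstance) (hmax Q hQ hIQ) hQP hDQ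

/-- If `I² = q I` with `q ⊆ I` generated by a regular sequence of length at least two, then the Rees
algebra of the `𝔪`-primary ideal `I` is Cohen–Macaulay. The three cases are the maximal ideals that
do not contain `I`, those that contain `I` but not all `aᵢ t`, and the graded maximal ideal. -/
theorem isCohenMacaulayRing_reesAlgebra [IsLocalRing R] (hR : IsCohenMacaulayLocalRing R)
    (hrad : I.radical = maximalIdeal R) {d : ℕ} (hd : 2 ≤ d) {a : Fin d → R} (ha : ∀ i, a i ∈ I)
    (hw : IsWeaklyRegular R (List.ofFn a)) (hI : I ^ 2 ≤ Ideal.span (Set.range a) * I) :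
    IsCohenMacaulayRing (reesAlgebra I) := by
  have hRN := hR.1
  refine ⟨inferInstance, ?_⟩
  intro P _
  have hIm : I ≤ maximalIdeal R := Ideal.le_radical.trans hrad.le
  have hmem : ∀ r ∈ List.ofFn a, r ∈ maximalIdeal R := by
    intro r hr
    obtain ⟨i, rfl⟩ := List.mem_ofFn.mp hr
    exact hIm (ha i)
  have hmax : ∀ Q : Ideal (reesAlgebra I), Q.IsPrime → (∀ c ∈ I, algebraMap R _ c ∈ Q) →
      (Q.comap (algebraMap R (reesAlgebra I))).IsMaximal := by
    intro Q hQ hIQ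
    have h2 : maximalIdeal R ≤ Q.comap (algebraMap R (reesAlgebra I)) := by
      rw [← hrad]
      exact (Ideal.IsPrime.radical_le_iff inferInstance).mpr hIQ
    rw [← (maximalIdeal.isMaximal R).eq_of_le (Ideal.IsPrime.ne_top inferInstance) h2]
    exact maximalIdeal.isMaximal R
  by_cases hIP : ∀ c ∈ I, algebraMap R (reesAlgebra I) c ∈ P
  swap
  · push Not at hIP
    obtain ⟨b, hb, hbP⟩ := hIP
    exact isCohenMacaulayLocalRing_reesAlgebra_of_notMem hR P hb hbP
  by_cases hDP : ∀ i, reesDegreeOne I ⟨a i, ha i⟩ ∈ P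
  swap
  · push Not at hDP
    obtain ⟨i, hi⟩ := hDP
    have hreg : IsSMulRegular R (a i) := by
      classical
      have h1 := IsLocalRing.isWeaklyRegular_of_perm_of_subset_maximalIdeal hw
        (List.perm_cons_erase (List.mem_ofFn.mpr ⟨i, rfl⟩ : a i ∈ List.ofFn a)) hmem
      exact ((isWeaklyRegular_cons_iff _ _ _).mp h1).1
    exact isCohenMacaulayLocalRing_of_reesDegreeOne_notMem ha
      (IsLocalRing.isWeaklyRegular_of_perm_of_subset_maximalIdeal hw
        (List.reverse_perm _).symm hmem)
      hI P hmax hIP i hreg hi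
  have hall : ∀ c, reesDegreeOne I c ∈ P := by
    intro c
    obtain ⟨e, he⟩ := exists_reesDegreeOne_mul_eq ha hI c c
    have h4 : reesDegreeOne I c * reesDegreeOne I c ∈ P := by
      rw [he]
      exact sum_mem fun i _ => Ideal.mul_mem_right _ _ (hDP i)
    exact (Ideal.IsPrime.mem_or_mem inferInstance h4).elim id id
  obtain ⟨n, rfl⟩ : ∃ n, d = n + 2 := ⟨d - 2, by omega⟩
  have hlist : ((⟨a 0, ha 0⟩ :: ⟨a 1, ha 1⟩ :: List.ofFn fun i : Fin n =>
      (⟨a i.succ.succ, ha _⟩ : I)) : List I).map ((↑) : I → R) = List.ofFn a := by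
    rw [List.ofFn_succ, List.ofFn_succ, List.map_cons, List.map_cons, List.map_ofFn]
    rfl
  refine isCohenMacaulayLocalRing_of_reesDegreeOne_mem hIm _ _ _ (hlist ▸ hw) ?_ P hmax hIP hall
  rw [hlist]
  refine hI.trans (Ideal.mul_mono_left (Ideal.span_mono ?_))
  rintro _ ⟨i, rfl⟩
  exact List.mem_ofFn.mpr ⟨i, rfl⟩

end CohenMacaulayRees

/-! ### Socles modulo regular sequences -/

section Socles

/-- A regular sequence on a module can be prolonged to the length of any other one. -/
theorem exists_isWeaklyRegular_append {A : Type u} [CommRing A] [IsLocalRing A]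
    [IsNoetherianRing A] (rs : List A) : ∀ (M : Type v) [AddCommGroup M] [Module A M]
    [Module.Finite A M] (ts : List A), (∀ r ∈ rs, r ∈ maximalIdeal A) → IsWeaklyRegular M rs →
    (∀ r ∈ ts, r ∈ maximalIdeal A) → IsWeaklyRegular M ts → rs.length ≤ ts.length →
    ∃ rs' : List A, (∀ r ∈ rs', r ∈ maximalIdeal A) ∧ IsWeaklyRegular M (rs ++ rs') ∧
      rs.length + rs'.length = ts.length := by
  induction rs with
  | nil => intro M _ _ _ ts _ _ hts hw _; exact ⟨ts, hts, hw, by simp⟩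
  | cons x rs ih =>
    intro M _ _ _ ts hrs hw hts hw' hl
    obtain ⟨n, hn⟩ : ∃ n, ts.length = n + 1 := ⟨ts.length - 1, by simp at hl; omega⟩
    obtain ⟨hx, hrs'⟩ := List.forall_mem_cons.mp hrs
    rw [isWeaklyRegular_cons_iff] at hw
    obtain ⟨ts', hts', hw'', hl'⟩ := exists_isWeaklyRegular_cons n M x hx hw.1 ts hts hw' hn
    rw [isWeaklyRegular_cons_iff] at hw''
    obtain ⟨rs'', h1, h2, h3⟩ := ih (QuotSMulTop x M) ts' hrs' hw.2 hts' hw''.2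
      (by simp at hl; omega)
    refine ⟨rs'', h1, ?_, ?_⟩
    · rw [List.cons_append, isWeaklyRegular_cons_iff]
      exact ⟨hw.1, h2⟩
    · simp only [List.length_cons]
      omega

/-- A Cohen–Macaulay local ring modulo a regular sequence that is shorter than its dimension has no
socle. -/
theorem IsCohenMacaulayOfDim.mem_ofList_of_forall_mul_mem {A : Type u} [CommRing A] [IsLocalRing A]
    {n : ℕ} (h : IsCohenMacaulayOfDim A n) {rs : List A} (hrs : ∀ r ∈ rs, r ∈ maximalIdeal A)
    (hw : IsWeaklyRegular A rs) (hl : rs.length < n) {u : A}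
    (hu : ∀ x ∈ maximalIdeal A, x * u ∈ Ideal.ofList rs) : u ∈ Ideal.ofList rs := by
  have := h.isNoetherianRing
  obtain ⟨ts, hts, hwt, htl⟩ := h.exists_isWeaklyRegular
  obtain ⟨rs', h1, h2, h3⟩ := exists_isWeaklyRegular_append rs A ts hrs hw hts hwt (by omega)
  cases rs' with
  | nil => simp at h3; omega
  | cons x rs' =>
    have h4 : rs ++ x :: rs' = (rs ++ [x]) ++ rs' := by simp
    rw [h4, isWeaklyRegular_append_iff, isWeaklyRegular_append_singleton_iff] at h2
    exact h2.1.2 u (hu x (h1 x List.mem_cons_self))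

/-- In a Cohen–Macaulay local ring of dimension `n`, a regular sequence of length `n` generates an
ideal that is primary to the maximal ideal. -/
theorem IsCohenMacaulayOfDim.exists_pow_le_ofList_of_le_length {A : Type u} [CommRing A]
    [IsLocalRing A] {n : ℕ} (h : IsCohenMacaulayOfDim A n) {rs : List A}
    (hw : IsWeaklyRegular A rs) (hl : n ≤ rs.length) :
    ∃ N, maximalIdeal A ^ N ≤ Ideal.ofList rs := by
  have := h.isNoetherianRing
  have hrad : maximalIdeal A ≤ (Ideal.ofList rs).radical := by
    rw [Ideal.radical_eq_sInf]
    refine le_sInf fun P hP => ?_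
    obtain ⟨hle, hPp⟩ := hP
    have h1 : IsWeaklyRegular (Localization.AtPrime P) (rs.map (algebraMap A _)) :=
      hw.of_isLocalization (Localization.AtPrime P) P.primeCompl
    have hloc : IsNoetherianRing (Localization.AtPrime P) :=
      IsLocalization.isNoetherianRing P.primeCompl _ inferInstance
    have h2 : ∀ r ∈ rs.map (algebraMap A (Localization.AtPrime P)),
        r ∈ maximalIdeal (Localization.AtPrime P) := by
      intro r hr
      obtain ⟨x, hx, rfl⟩ := List.mem_map.mp hr
      exact (IsLocalization.AtPrime.to_map_mem_maximal_iff _ P x).mpr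
        (hle (Ideal.subset_span hx))
    have h3 := length_le_ringKrullDim_of_isWeaklyRegular h2 h1
    rw [IsLocalization.AtPrime.ringKrullDim_eq_height P] at h3
    have h4 : (maximalIdeal A).height ≤ P.height := by
      have h5 := IsLocalRing.maximalIdeal_height_eq_ringKrullDim (R := A)
      rw [h.ringKrullDim_eq] at h5
      have h6 : (maximalIdeal A).height = n := by exact_mod_cast h5
      rw [h6]
      have h7 : (n : WithBot ℕ∞) ≤ (P.height : WithBot ℕ∞) := by
        refine le_trans ?_ h3
        rw [List.length_map]
        exact_mod_cast hl
      exact_mod_cast h7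
    by_contra hne
    have hlt : P < maximalIdeal A := lt_of_le_of_ne (le_maximalIdeal hPp.ne_top)
      fun he => hne he.ge
    have hfin : P.FiniteHeight := inferInstance
    exact absurd h4 (not_le.mpr (Ideal.height_strict_mono_of_isPrime hlt))
  exact Ideal.exists_pow_le_of_le_radical_of_fg hrad (IsNoetherian.noetherian _)

/-- In a Cohen–Macaulay local ring, a regular sequence with a nonzero socle modulo it generates an
ideal that is primary to the maximal ideal. -/
theorem IsCohenMacaulayOfDim.exists_pow_le_ofList {A : Type u} [CommRing A] [IsLocalRing A]
    {n : ℕ} (h : IsCohenMacaulayOfDim A n) {rs : List A} (hrs : ∀ r ∈ rs, r ∈ maximalIdeal A)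
    (hw : IsWeaklyRegular A rs) {u : A} (hu : ∀ x ∈ maximalIdeal A, x * u ∈ Ideal.ofList rs)
    (hu' : u ∉ Ideal.ofList rs) : ∃ N, maximalIdeal A ^ N ≤ Ideal.ofList rs := by
  refine h.exists_pow_le_ofList_of_le_length hw ?_
  by_contra hl
  exact hu' (h.mem_ofList_of_forall_mul_mem hrs hw (by omega) hu)

/-- The global form of `IsCohenMacaulayOfDim.exists_pow_le_ofList`: if `M` is the annihilator of an
element `u` modulo a regular sequence, then a power of `M` lies in the ideal of the sequence
locally at `M`. -/
theorem exists_forall_mem_pow_exists_mul_mem {B : Type u} [CommRing B]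
    (M : Ideal B) [M.IsPrime] (hM : IsCohenMacaulayLocalRing (Localization.AtPrime M)) {rs : List B}
    (hrs : ∀ r ∈ rs, r ∈ M) (hw : IsWeaklyRegular B rs) {u : B}
    (hu : ∀ s, s * u ∈ Ideal.ofList rs ↔ s ∈ M) :
    ∃ N, ∀ x ∈ M ^ N, ∃ s ∉ M, s * x ∈ Ideal.ofList rs := by
  obtain ⟨n, hn⟩ := isCohenMacaulayLocalRing_iff.mp hM
  let L := Localization.AtPrime M
  have hof : Ideal.ofList (rs.map (algebraMap B L)) = (Ideal.ofList rs).map (algebraMap B L) :=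
    (Ideal.map_ofList _ _).symm
  have hmax : M.map (algebraMap B L) = maximalIdeal L := Localization.AtPrime.map_eq_maximalIdeal
  obtain ⟨N, hN⟩ := hn.exists_pow_le_ofList (rs := rs.map (algebraMap B L))
    (u := algebraMap B L u) (by
      intro r hr
      obtain ⟨x, hx, rfl⟩ := List.mem_map.mp hr
      exact (IsLocalization.AtPrime.to_map_mem_maximal_iff L M x).mpr (hrs x hx))
    (hw.of_isLocalization L M.primeCompl) (by
      intro x hx
      rw [← hmax] at hx
      rw [hof]
      have h1 : M.map (algebraMap B L) * Ideal.span {algebraMap B L u} ≤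
          (Ideal.ofList rs).map (algebraMap B L) := by
        rw [← Set.image_singleton, ← Ideal.map_span, ← Ideal.map_mul]
        refine Ideal.map_mono (Ideal.mul_le.mpr fun s hs v hv => ?_)
        obtain ⟨w, rfl⟩ := Ideal.mem_span_singleton'.mp hv
        rw [mul_left_comm]
        exact Ideal.mul_mem_left _ _ ((hu s).mpr hs)
      exact h1 (Ideal.mul_mem_mul hx (Ideal.mem_span_singleton_self _)))
    (by
      rw [hof, IsLocalization.algebraMap_mem_map_algebraMap_iff M.primeCompl]
      rintro ⟨s, hs, hsu⟩
      exact hs ((hu s).mp hsu))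
  refine ⟨N, fun x hx => ?_⟩
  have h2 : algebraMap B L x ∈ (Ideal.ofList rs).map (algebraMap B L) := by
    rw [← hof]
    apply hN
    rw [← hmax, ← Ideal.map_pow]
    exact Ideal.mem_map_of_mem _ hx
  rw [IsLocalization.algebraMap_mem_map_algebraMap_iff M.primeCompl] at h2
  obtain ⟨s, hs, h3⟩ := h2
  exact ⟨s, hs, h3⟩

end Socles

/-! ### Superficial elements for one ideal -/

section Superficial

open Polynomial

/-- If every associated prime of `A / J` that contains `x` also contains `E`, then a power of `E`
kills the annihilator of `x` in `A / J`. -/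
theorem exists_pow_mul_mem_of_associatedPrimes {A : Type u} [CommRing A] [IsNoetherianRing A]
    (J E : Ideal A) (x : A) (h : ∀ Q ∈ associatedPrimes A (A ⧸ J), x ∈ Q → E ≤ Q) :
    ∃ c, ∀ f, x * f ∈ J → ∀ e ∈ E ^ c, e * f ∈ J := by
  let N : Submodule A (A ⧸ J) := LinearMap.ker (LinearMap.lsmul A (A ⧸ J) x)
  have hxN : x ∈ Module.annihilator A N := by
    rw [Module.mem_annihilator]
    rintro ⟨n, hn⟩
    exact Subtype.ext hn
  have hE : E ≤ (Module.annihilator A N).radical := by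
    rw [← Ideal.sInf_minimalPrimes]
    refine le_sInf fun Q hQ => ?_
    have hQ' := Module.associatedPrimes.minimalPrimes_annihilator_subset_associatedPrimes A N hQ
    exact h Q (associatedPrimes.subset_of_injective N.injective_subtype hQ') (hQ.1.2 hxN)
  obtain ⟨c, hc⟩ := Ideal.exists_pow_le_of_le_radical_of_fg hE (IsNoetherian.noetherian _)
  refine ⟨c, fun f hf e he => ?_⟩
  have h1 : Ideal.Quotient.mk J f ∈ N := by
    rw [LinearMap.mem_ker]
    exact Ideal.Quotient.eq_zero_iff_mem.mpr hf
  have h2 := Module.mem_annihilator.mp (hc he) ⟨_, h1⟩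
  have h3 : Ideal.Quotient.mk J (e * f) = 0 := congrArg Subtype.val h2
  exact Ideal.Quotient.eq_zero_iff_mem.mp h3

theorem reesMonomial_mem_pow {T : Type u} [CommRing T] {L : Ideal T} (n : ℕ) (c : T)
    (hc : c ∈ L ^ n) :
    reesMonomial n c hc ∈ Ideal.span (Set.range (reesDegreeOne L)) ^ n := by
  induction n generalizing c with
  | zero => simp
  | succ n ih =>
    have h1 : c ∈ L * L ^ n := by rwa [← pow_succ']
    have key : ∀ c ∈ L * L ^ n, ∃ g ∈ Ideal.span (Set.range (reesDegreeOne L)) ^ (n + 1),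
        (g : T[X]) = monomial (n + 1) c := by
      intro c hc
      refine Submodule.mul_induction_on hc ?_ ?_
      · intro x hx y hy
        refine ⟨reesDegreeOne L ⟨x, hx⟩ * reesMonomial n y hy, ?_, ?_⟩
        · rw [pow_succ']
          exact Ideal.mul_mem_mul (Ideal.subset_span ⟨_, rfl⟩) (ih y hy)
        · change monomial 1 x * monomial n y = _
          rw [monomial_mul_monomial, add_comm]
      · rintro x y ⟨g, hg, h⟩ ⟨g', hg', h'⟩
        exact ⟨g + g', add_mem hg hg', by rw [AddMemClass.coe_add, h, h', map_add]⟩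
    obtain ⟨g, hg, hgc⟩ := key c h1
    have : reesMonomial (n + 1) c hc = g := Subtype.ext hgc.symm
    rwa [this]

/-- If `a t` avoids the associated primes of `G(L)` that do not contain `L t`, then
`(Lⁿ⁺² : a) ∩ Lⁿ = Lⁿ⁺¹` for all large `n`. -/
theorem exists_forall_mem_pow_succ_of_mul_mem {T : Type u} [CommRing T] [IsNoetherianRing T]
    {L : Ideal T} (a : L)
    (h : ∀ Q ∈ associatedPrimes (reesAlgebra L) (AssociatedGradedRing L), reesDegreeOne L a ∈ Q →
      ∀ c, reesDegreeOne L c ∈ Q) :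
    ∃ N, ∀ n ≥ N, ∀ z ∈ L ^ n, (a : T) * z ∈ L ^ (n + 2) → z ∈ L ^ (n + 1) := by
  classical
  set J : Ideal (reesAlgebra L) := L.map (algebraMap T (reesAlgebra L)) with hJ
  set E : Ideal (reesAlgebra L) := Ideal.span (Set.range (reesDegreeOne L)) with hE
  obtain ⟨c, hc⟩ := exists_pow_mul_mem_of_associatedPrimes J E (reesDegreeOne L a) (by
    intro Q hQ ha
    refine Ideal.span_le.mpr ?_
    rintro _ ⟨y, rfl⟩
    exact h Q hQ ha y)
  -- the elements killed by `a t` modulo `L`; the positive part to the power `c` kills them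
  let N : Ideal (reesAlgebra L) :=
    Submodule.comap (LinearMap.mulLeft (reesAlgebra L) (reesDegreeOne L a)) J
  have hN : ∀ f, f ∈ N ↔ reesDegreeOne L a * f ∈ J := fun f => Iff.rfl
  obtain ⟨S, hS⟩ : N.FG := IsNoetherian.noetherian N
  -- in degrees above `c + e`, generators of degree at most `e` occur with coefficients of degree at
  -- least `c`
  let e := S.sup fun f => (f : T[X]).natDegree
  refine ⟨c + e, fun n hn z hz haz => ?_⟩
  have hzN : reesMonomial n z hz ∈ N := by
    rw [hN, hJ, mem_map_reesAlgebra_iff]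
    intro k
    change (monomial 1 (a : T) * monomial n z).coeff k ∈ _
    rw [monomial_mul_monomial, coeff_monomial]
    split_ifs with hk
    · rw [← hk, ← pow_succ']
      convert haz using 2
      omega
    · exact zero_mem _
  rw [← hS, Submodule.mem_span_finset] at hzN
  obtain ⟨g, -, hg⟩ := hzN
  have h1 : z = ∑ f ∈ S, ((g f : T[X]) * (f : T[X])).coeff n := by
    have h2 := congrArg (fun p : reesAlgebra L => (p : T[X]).coeff n) hg
    simp only [AddSubmonoidClass.coe_finsetSum, finsetSum_coeff, coe_reesMonomial,
      coeff_monomial_same] at h2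
    exact h2.symm
  rw [h1]
  refine sum_mem fun f hf => ?_
  rw [coeff_mul]
  refine sum_mem fun p hp => ?_
  have hp' : p.1 + p.2 = n := Finset.HasAntidiagonal.mem_antidiagonal.mp hp
  by_cases hdeg : e < p.2
  · have : (f : T[X]).natDegree ≤ e :=
      Finset.le_sup (f := fun f : reesAlgebra L => (f : T[X]).natDegree) hf
    rw [coeff_eq_zero_of_natDegree_lt (by omega : (f : T[X]).natDegree < p.2), mul_zero]
    exact zero_mem _
  · have hfN : f ∈ N := hS ▸ Submodule.subset_span hf
    have h3 : reesMonomial p.1 _ ((g f).2 p.1) * f ∈ J :=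
      hc f hfN _ (Ideal.pow_le_pow_right (by omega) (reesMonomial_mem_pow _ _ _))
    rw [hJ, mem_map_reesAlgebra_iff] at h3
    have h4 := h3 n
    rw [MulMemClass.coe_mul, coe_reesMonomial, ← hp', add_comm p.1, coeff_monomial_mul,
      add_comm p.2, hp', ← pow_succ'] at h4
    exact h4

end Superficial

/-! ### Superficial elements for a pair of ideals -/

section SuperficialPairs

open Polynomial

/-- A form of the Artin–Rees lemma: `(Kⁿ⁺ᵏ : a) ⊆ Kⁿ` for a regular element `a`. -/
theorem exists_forall_mem_pow_of_mul_mem_pow_add {S : Type u} [CommRing S] [IsNoetherianRing S]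
    (K : Ideal S) {a : S} (ha : IsSMulRegular S a) :
    ∃ k, ∀ n z, a * z ∈ K ^ (n + k) → z ∈ K ^ n := by
  obtain ⟨k, hk⟩ := Ideal.exists_pow_inf_eq_pow_smul K (Ideal.span {a} : Submodule S S)
  refine ⟨k, fun n z hz => ?_⟩
  have h1 : a * z ∈ (K ^ (n + k) • ⊤ ⊓ Ideal.span {a} : Submodule S S) :=
    ⟨by simpa using hz, Ideal.mul_mem_right _ _ (Ideal.mem_span_singleton_self a)⟩
  rw [hk (n + k) (by omega), Nat.add_sub_cancel] at h1
  have h2 : a * z ∈ K ^ n * Ideal.span {a} :=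
    Ideal.mul_mono_right (I := K ^ n) inf_le_right h1
  obtain ⟨w, hw, hwz⟩ := Ideal.mem_mul_span_singleton.mp h2
  have h3 : w = z := ha (by
    change a * w = a * z
    rw [← hwz, mul_comm])
  rwa [← h3]

/-- A regular element `a ∈ L` in general position is superficial for `K` and `L` uniformly in the
exponent of `K`, as long as `K` contains a power of `L`. The uniformity comes from working with the
ideal `𝔏` that `L` generates in the Rees algebra of `K`. -/
theorem exists_forall_mem_pow_mul_pow_of_mul_mem {S : Type u} [CommRing S] [IsNoetherianRing S]
    (K L : Ideal S) {l : ℕ} (hl : L ^ l ≤ K) (a : L) (ha : IsSMulRegular S (a : S))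
    {𝔏 : Ideal (reesAlgebra K)} (h𝔏 : 𝔏 = L.map (algebraMap S (reesAlgebra K))) (a' : 𝔏)
    (ha' : (a' : reesAlgebra K) = algebraMap S (reesAlgebra K) (a : S))
    (h : ∀ Q ∈ associatedPrimes (reesAlgebra 𝔏) (AssociatedGradedRing 𝔏),
      reesDegreeOne 𝔏 a' ∈ Q → ∀ c, reesDegreeOne 𝔏 c ∈ Q) :
    ∃ s₀, ∀ r, ∀ s ≥ s₀, ∀ z, (a : S) * z ∈ K ^ r * L ^ (s + 1) → z ∈ K ^ r * L ^ s := by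
  obtain ⟨N, hN⟩ := exists_forall_mem_pow_succ_of_mul_mem _ h
  rw [ha'] at hN
  obtain ⟨k₁, hk₁⟩ := exists_forall_mem_pow_of_mul_mem_pow_add K ha
  obtain ⟨k₂, hk₂⟩ := exists_forall_mem_pow_of_mul_mem_pow_add 𝔏
    (isSMulRegular_algebraMap_reesAlgebra (I := K) ha)
  refine ⟨l * k₁ + (N + k₂), fun r s hs z hz => ?_⟩
  have hzr : z ∈ K ^ r := by
    apply hk₁
    have h1 : L ^ (s + 1) ≤ K ^ k₁ := by
      calc L ^ (s + 1) ≤ L ^ (l * k₁) := Ideal.pow_le_pow_right (by omega)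
        _ = (L ^ l) ^ k₁ := pow_mul _ _ _
        _ ≤ K ^ k₁ := Ideal.pow_right_mono hl _
    rw [pow_add]
    exact Ideal.mul_mono_right h1 hz
  -- `z tʳ` moves up in the `𝔏`-adic filtration, starting from the Artin–Rees bound
  let Z : reesAlgebra K := reesMonomial r z hzr
  have haZ : algebraMap S (reesAlgebra K) (a : S) * Z ∈ 𝔏 ^ (s + 1) := by
    rw [h𝔏, ← Ideal.map_pow, mem_map_reesAlgebra_iff, algebraMap_mul_reesMonomial]
    intro n
    rw [coe_reesMonomial, coeff_monomial]
    split_ifs with hn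
    · rw [← hn, mul_comm]
      exact hz
    · exact zero_mem _
  have hZN : Z ∈ 𝔏 ^ N :=
    hk₂ N Z (Ideal.pow_le_pow_right (by omega) haZ)
  have hZ : ∀ m, N ≤ m → m ≤ s → Z ∈ 𝔏 ^ m := by
    intro m hm
    induction m, hm using Nat.le_induction with
    | base => exact fun _ => hZN
    | succ m hm ih =>
      intro hms
      exact hN m hm Z (ih (by omega)) (Ideal.pow_le_pow_right (by omega) haZ)
  have h2 := hZ s (by omega) le_rfl
  rw [h𝔏, ← Ideal.map_pow, mem_map_reesAlgebra_iff] at h2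
  have h3 := h2 r
  rw [coe_reesMonomial, coeff_monomial_same, mul_comm] at h3
  exact h3

/-- The elements `a` of `I` such that `a t` avoids the associated primes of the associated graded
ring of `I T` that do not contain its positive part are the elements outside finitely many proper
submodules. -/
theorem exists_finite_forall_associatedPrimes {R T : Type u} [CommRing R] [CommRing T]
    [IsNoetherianRing T] (ψ : R →+* T) (I : Ideal R) :
    ∃ 𝒲 : Set (Submodule R I), 𝒲.Finite ∧ (∀ W ∈ 𝒲, W ≠ ⊤) ∧ ∀ a : I, (∀ W ∈ 𝒲, a ∉ W) →
      ∀ Q ∈ associatedPrimes (reesAlgebra (I.map ψ)) (AssociatedGradedRing (I.map ψ)),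
        reesDegreeOne (I.map ψ) (idealMap ψ I a) ∈ Q → ∀ c, reesDegreeOne (I.map ψ) c ∈ Q := by
  set L := I.map ψ with hL
  let τ : I → reesAlgebra L := fun c => reesDegreeOne L (idealMap ψ I c)
  have hτ_add : ∀ c c', τ (c + c') = τ c + τ c' := by
    intro c c'
    have : idealMap ψ I (c + c') = idealMap ψ I c + idealMap ψ I c' :=
      Subtype.ext (map_add ψ _ _)
    change reesDegreeOne L _ = _
    rw [this, map_add]
  have hτ_smul : ∀ (r : R) c, τ (r • c) = algebraMap T (reesAlgebra L) (ψ r) * τ c := by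
    intro r c
    have : idealMap ψ I (r • c) = ψ r • idealMap ψ I c := Subtype.ext (map_mul ψ _ _)
    change reesDegreeOne L _ = _
    rw [this, map_smul, Algebra.smul_def]
  let W : Ideal (reesAlgebra L) → Submodule R I := fun Q =>
    { carrier := {c | τ c ∈ Q}
      add_mem' := fun {c c'} hc hc' => by
        change τ (c + c') ∈ Q
        rw [hτ_add]
        exact add_mem hc hc'
      zero_mem' := by
        change τ 0 ∈ Q
        have : τ 0 = 0 := by simpa using hτ_smul 0 0
        rw [this]
        exact zero_mem _
      smul_mem' := fun r c hc => by
        change τ (r • c) ∈ Q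
        rw [hτ_smul]
        exact Ideal.mul_mem_left _ _ hc }
  let 𝒬 : Set (Ideal (reesAlgebra L)) :=
    {Q ∈ associatedPrimes (reesAlgebra L) (AssociatedGradedRing L) | ¬ ∀ c, reesDegreeOne L c ∈ Q}
  have hfin : (associatedPrimes (reesAlgebra L) (AssociatedGradedRing L)).Finite :=
    associatedPrimes.finite _ _
  refine ⟨W '' 𝒬, (hfin.subset fun Q hQ => hQ.1).image _, ?_, ?_⟩
  · rintro _ ⟨Q, hQ, rfl⟩ htop
    refine hQ.2 ?_
    have key : ∀ y ∈ L, ∀ hy : y ∈ L, reesDegreeOne L ⟨y, hy⟩ ∈ Q := by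
      intro y hy
      have hle : ∀ y ∈ Ideal.span (ψ '' I), y ∈ L := fun y hy => hy
      refine Submodule.span_induction (p := fun y _ => ∀ hy : y ∈ L, reesDegreeOne L ⟨y, hy⟩ ∈ Q)
        ?_ ?_ ?_ ?_ (hy : y ∈ Ideal.span (ψ '' I))
      · rintro _ ⟨c, hc, rfl⟩ _
        have h1 : (⟨c, hc⟩ : I) ∈ W Q := by rw [htop]; trivial
        exact h1
      · intro h0
        have : (⟨0, h0⟩ : L) = 0 := rfl
        rw [this, map_zero]
        exact zero_mem _
      · intro x y hx hy ihx ihy hxy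
        have : (⟨x + y, hxy⟩ : L) = ⟨x, hle x hx⟩ + ⟨y, hle y hy⟩ := rfl
        rw [this, map_add]
        exact add_mem (ihx _) (ihy _)
      · intro r x hx ihx hrx
        have : (⟨r • x, hrx⟩ : L) = r • ⟨x, hle x hx⟩ := rfl
        rw [this, map_smul, Algebra.smul_def]
        exact Ideal.mul_mem_left _ _ (ihx _)
    exact fun c => key c.1 c.2 c.2
  · intro a ha Q hQ haQ
    by_contra hcon
    exact ha _ ⟨Q, ⟨hQ, hcon⟩, rfl⟩ haQ

/-- Superficiality holds for all regular elements of `I` outside finitely many proper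
submodules. -/
theorem exists_finite_forall_superficial {R S : Type u} [CommRing R] [CommRing S]
    [IsNoetherianRing S] (φ : R →+* S) (I : Ideal R) (K : Ideal S) {l : ℕ}
    (hl : (I.map φ) ^ l ≤ K) :
    ∃ 𝒲 : Set (Submodule R I), 𝒲.Finite ∧ (∀ W ∈ 𝒲, W ≠ ⊤) ∧ ∀ a : I, (∀ W ∈ 𝒲, a ∉ W) →
      IsSMulRegular S (φ a) → ∃ s₀, ∀ r, ∀ s ≥ s₀, ∀ z,
        φ a * z ∈ K ^ r * (I.map φ) ^ (s + 1) → z ∈ K ^ r * (I.map φ) ^ s := by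
  obtain ⟨𝒲, hfin, htop, h⟩ := exists_finite_forall_associatedPrimes
    ((algebraMap S (reesAlgebra K)).comp φ) I
  refine ⟨𝒲, hfin, htop, fun a ha hreg => ?_⟩
  exact exists_forall_mem_pow_mul_pow_of_mul_mem K (I.map φ) hl (idealMap φ I a) hreg
    (Ideal.map_map _ _).symm _ rfl (h a ha)

/-- A finitely generated module over a local ring with infinite residue field is not a finite union
of proper submodules. -/
theorem exists_forall_notMem_of_finite {R : Type u} [CommRing R] [IsLocalRing R]
    [Infinite (ResidueField R)] {M : Type v} [AddCommGroup M] [Module R M] [Module.Finite R M]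
    {𝒲 : Set (Submodule R M)} (hfin : 𝒲.Finite) (h𝒲 : ∀ W ∈ 𝒲, W ≠ ⊤) :
    ∃ a : M, ∀ W ∈ 𝒲, a ∉ W := by
  classical
  by_contra hcon
  push Not at hcon
  let s : Finset (Submodule R M) := hfin.toFinset.image fun W => W ⊔ maximalIdeal R • ⊤
  have hs : ⋃ p ∈ s, (p : Set M) = Set.univ := by
    refine Set.eq_univ_of_forall fun a => ?_
    obtain ⟨W, hW, haW⟩ := hcon a
    refine Set.mem_iUnion₂.mpr ⟨W ⊔ maximalIdeal R • ⊤, ?_, Submodule.mem_sup_left haW⟩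
    exact Finset.mem_image_of_mem _ (hfin.mem_toFinset.mpr hW)
  obtain ⟨p, hp, hpfin⟩ := Submodule.exists_finiteIndex_of_cover hs
  obtain ⟨W, hW, rfl⟩ := Finset.mem_image.mp hp
  have hne : W ⊔ maximalIdeal R • ⊤ ≠ ⊤ := by
    intro htop
    refine h𝒲 W (hfin.mem_toFinset.mp hW) (top_le_iff.mp ?_)
    exact Submodule.le_of_le_smul_of_le_jacobson_bot Module.Finite.fg_top
      (maximalIdeal_le_jacobson _) htop.ge
  obtain ⟨x, -, hx⟩ := SetLike.exists_of_lt (lt_top_iff_ne_top.mpr hne)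
  have hfin' : Finite (M ⧸ (W ⊔ maximalIdeal R • ⊤)) :=
    AddSubgroup.finite_quotient_of_finiteIndex
      (H := (W ⊔ maximalIdeal R • (⊤ : Submodule R M)).toAddSubgroup)
  -- the residue field embeds into the finite module `M / (W + 𝔪 M)`
  let f : R →ₗ[R] M ⧸ (W ⊔ maximalIdeal R • (⊤ : Submodule R M)) :=
    LinearMap.toSpanSingleton R _ (Submodule.Quotient.mk x)
  have hker : LinearMap.ker f = maximalIdeal R := by
    symm
    apply (maximalIdeal.isMaximal R).eq_of_le
    · intro h1
      have : (1 : R) ∈ LinearMap.ker f := h1 ▸ trivial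
      rw [LinearMap.mem_ker, LinearMap.toSpanSingleton_apply, one_smul,
        Submodule.Quotient.mk_eq_zero] at this
      exact hx this
    · intro r hr
      rw [LinearMap.mem_ker, LinearMap.toSpanSingleton_apply, ← Submodule.Quotient.mk_smul,
        Submodule.Quotient.mk_eq_zero]
      exact Submodule.mem_sup_right (Submodule.smul_mem_smul hr trivial)
  have : Finite (R ⧸ LinearMap.ker f) :=
    Finite.of_injective _ f.quotKerEquivRange.injective
  rw [hker] at this
  have hres : Finite (ResidueField R) := this
  exact _root_.not_finite (ResidueField R)

end SuperficialPairs

/-! ### General elements -/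

section GeneralElements

open Polynomial

/-- An associated prime of `A / J` is of the form `(J : u)`. -/
theorem exists_forall_mul_mem_iff {A : Type u} [CommRing A] [IsNoetherianRing A] {J Q : Ideal A}
    (hQ : Q ∈ associatedPrimes A (A ⧸ J)) : ∃ u, ∀ s, s * u ∈ J ↔ s ∈ Q := by
  obtain ⟨-, u, hu⟩ := isAssociatedPrime_iff.mp hQ
  obtain ⟨u, rfl⟩ := Submodule.Quotient.mk_surjective _ u
  refine ⟨u, fun s => ?_⟩
  rw [hu, Submodule.mem_colon_singleton, Submodule.mem_bot, ← Submodule.Quotient.mk_smul,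
    Submodule.Quotient.mk_eq_zero, smul_eq_mul]

/-- Let `τ : M → A` be semilinear. If no associated prime of `A / J` contains the image of `τ`, then
`τ a` is regular modulo `J` for all `a` outside finitely many proper submodules of `M`. -/
theorem exists_finite_forall_regular {R A : Type u} [CommRing R] [CommRing A] [IsNoetherianRing A]
    (ψ : R →+* A) {M : Type v} [AddCommGroup M] [Module R M] (τ : M →+ A)
    (hτ : ∀ (r : R) c, τ (r • c) = ψ r * τ c) (J : Ideal A)
    (hJ : ∀ Q ∈ associatedPrimes A (A ⧸ J), ¬ ∀ c, τ c ∈ Q) :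
    ∃ 𝒲 : Set (Submodule R M), 𝒲.Finite ∧ (∀ W ∈ 𝒲, W ≠ ⊤) ∧ ∀ a : M, (∀ W ∈ 𝒲, a ∉ W) →
      ∀ z, τ a * z ∈ J → z ∈ J := by
  let W : Ideal A → Submodule R M := fun Q =>
    { carrier := {c | τ c ∈ Q}
      add_mem' := fun {c c'} hc hc' => by
        change τ (c + c') ∈ Q
        rw [map_add]
        exact add_mem hc hc'
      zero_mem' := by
        change τ 0 ∈ Q
        rw [map_zero]
        exact zero_mem _
      smul_mem' := fun r c hc => by
        change τ (r • c) ∈ Q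
        rw [hτ]
        exact Ideal.mul_mem_left _ _ hc }
  refine ⟨W '' associatedPrimes A (A ⧸ J), (associatedPrimes.finite _ _).image _, ?_, ?_⟩
  · rintro _ ⟨Q, hQ, rfl⟩ htop
    refine hJ Q hQ fun c => ?_
    have h1 : c ∈ W Q := by rw [htop]; trivial
    exact h1
  · intro a ha
    have h1 : IsSMulRegular (A ⧸ J) (τ a) := by
      by_contra hcon
      have h2 : τ a ∈ ({x | IsSMulRegular (A ⧸ J) x}ᶜ : Set A) := hcon
      rw [← biUnion_associatedPrimes_eq_compl_regular] at h2
      obtain ⟨Q, hQ, haQ⟩ := Set.mem_iUnion₂.mp h2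
      exact ha _ ⟨Q, hQ, rfl⟩ haQ
    intro z hz
    exact (isSMulRegular_quotient_iff_mem_of_smul_mem _ _).mp h1 z hz

variable {R : Type u} [CommRing R] {I : Ideal R}

/-- The homogeneous components of the ideal generated by `a₁ t, …, aₙ t`. -/
theorem coeff_mem_of_mem_ofList {l : List I} {f : reesAlgebra I}
    (hf : f ∈ Ideal.ofList (l.map (reesDegreeOne I))) :
    (f : R[X]).coeff 0 = 0 ∧
      ∀ n, (f : R[X]).coeff (n + 1) ∈ Ideal.ofList (l.map ((↑) : I → R)) * I ^ n := by
  refine Submodule.span_induction (p := fun (f : reesAlgebra I) _ => (f : R[X]).coeff 0 = 0 ∧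
      ∀ n, (f : R[X]).coeff (n + 1) ∈ Ideal.ofList (l.map ((↑) : I → R)) * I ^ n) ?_ ?_ ?_ ?_ hf
  · intro f hf
    obtain ⟨c, hc, rfl⟩ := List.mem_map.mp hf
    change (monomial 1 (c : R)).coeff 0 = 0 ∧ ∀ n, (monomial 1 (c : R)).coeff (n + 1) ∈ _
    refine ⟨by simp [coeff_monomial], fun n => ?_⟩
    rw [coeff_monomial]
    split_ifs with h
    · obtain rfl : n = 0 := by omega
      rw [pow_zero, Ideal.one_eq_top, Ideal.mul_top]
      exact Ideal.subset_span (List.mem_map_of_mem hc)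
    · exact zero_mem _
  · simp
  · intro x y _ _ hx hy
    refine ⟨by rw [AddMemClass.coe_add, coeff_add, hx.1, hy.1, add_zero], fun n => ?_⟩
    rw [AddMemClass.coe_add, coeff_add]
    exact add_mem (hx.2 n) (hy.2 n)
  · intro x y _ hy
    rw [smul_eq_mul, MulMemClass.coe_mul]
    refine ⟨by rw [mul_coeff_zero, hy.1, mul_zero], fun n => ?_⟩
    rw [coeff_mul]
    refine sum_mem fun p hp => ?_
    have hp' : p.1 + p.2 = n + 1 := Finset.HasAntidiagonal.mem_antidiagonal.mp hp
    obtain ⟨i, j⟩ := p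
    cases j with
    | zero => simp only [hy.1, mul_zero]; exact zero_mem _
    | succ j =>
      obtain rfl : n = i + j := by simp only at hp'; omega
      rw [pow_add, mul_left_comm]
      exact Ideal.mul_mem_mul (x.2 i) (hy.2 j)

/-- The homogeneous components of the ideal generated by `a₁ t, …, aₙ t` and `𝔪`. -/
theorem coeff_mem_of_mem_ofList_sup_map {l : List I} {𝔪 : Ideal R} {f : reesAlgebra I}
    (hf : f ∈ Ideal.ofList (l.map (reesDegreeOne I)) ⊔ 𝔪.map (algebraMap R (reesAlgebra I)))
    (n : ℕ) :
    (f : R[X]).coeff (n + 1) ∈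
      Ideal.ofList (l.map ((↑) : I → R)) * I ^ n ⊔ 𝔪 * I ^ (n + 1) := by
  obtain ⟨g, hg, h, hh, rfl⟩ := Submodule.mem_sup.mp hf
  rw [AddMemClass.coe_add, coeff_add]
  exact Submodule.add_mem_sup ((coeff_mem_of_mem_ofList hg).2 n)
    ((mem_map_reesAlgebra_iff _ _ _).mp hh (n + 1))

/-- If `Iⁿ⁺¹` is contained in `(l) Iⁿ + 𝔪 Iⁿ⁺¹` then `I` lies in the radical of `(l)`. So `l` has at
least `dim R` elements. -/
theorem ringKrullDim_le_length_of_pow_succ_le [IsLocalRing R] [IsNoetherianRing R]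
    (hrad : I.radical = maximalIdeal R) {l : List I} {n : ℕ}
    (h : I ^ (n + 1) ≤ Ideal.ofList (l.map ((↑) : I → R)) * I ^ n ⊔ maximalIdeal R * I ^ (n + 1)) :
    ringKrullDim R ≤ l.length := by
  have h1 : I ^ (n + 1) ≤ Ideal.ofList (l.map ((↑) : I → R)) * I ^ n :=
    Submodule.le_of_le_smul_of_le_jacobson_bot (IsNoetherian.noetherian _)
      (maximalIdeal_le_jacobson _) h
  have h2 : I ≤ (Ideal.ofList (l.map ((↑) : I → R))).radical := fun x hx =>
    ⟨n + 1, mem_left_of_mem_mul (h1 (Ideal.pow_mem_pow hx _))⟩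
  have h3 : maximalIdeal R ∈ (Ideal.ofList (l.map ((↑) : I → R))).minimalPrimes := by
    refine ⟨⟨inferInstance, Ideal.span_le.mpr fun r hr => ?_⟩, ?_⟩
    · obtain ⟨c, -, rfl⟩ := List.mem_map.mp hr
      exact hrad ▸ Ideal.le_radical c.2
    · rintro Q ⟨hQ, hQle⟩ -
      rw [← hrad]
      exact (Ideal.IsPrime.radical_le_iff hQ).mpr
        (h2.trans ((Ideal.IsPrime.radical_le_iff hQ).mpr hQle))
  have h4 := height_le_length_of_mem_minimalPrimes h3
  rw [List.length_map] at h4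
  rw [← IsLocalRing.maximalIdeal_height_eq_ringKrullDim]
  exact_mod_cast h4

/-- The constant coefficient of an element of the Rees algebra. -/
noncomputable def reesConstantCoeff (I : Ideal R) : reesAlgebra I →+* R :=
  constantCoeff.comp (reesAlgebra I).val.toRingHom

/-- Let `B` be the fiber cone of `I`, assumed Cohen–Macaulay. A regular sequence
`a₁ t, …, aᵢ t` on `B` with `i < dim R` never has the graded maximal ideal among its associated
primes: otherwise `a₁, …, aᵢ` would generate a reduction of `I`. -/
theorem exists_reesDegreeOne_notMem_of_mem_associatedPrimes [IsLocalRing R] [IsNoetherianRing R]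
    (hrad : I.radical = maximalIdeal R) {B : Type u} [CommRing B] [IsNoetherianRing B]
    (hB : IsCohenMacaulayRing B)
    (π : reesAlgebra I →+* B) (hπ : Function.Surjective π)
    (hker : RingHom.ker π = (maximalIdeal R).map (algebraMap R (reesAlgebra I))) {l : List I}
    (hl : (l.length : WithBot ℕ∞) < ringKrullDim R)
    (hw : IsWeaklyRegular B (l.map fun c => π (reesDegreeOne I c))) (Q : Ideal B)
    (hQ : Q ∈ associatedPrimes B (B ⧸ Ideal.ofList (l.map fun c => π (reesDegreeOne I c)))) :
    ¬ ∀ c, π (reesDegreeOne I c) ∈ Q := by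
  intro hcon
  have hQp : Q.IsPrime := hQ.1
  let ε : reesAlgebra I →+* ResidueField R := (residue R).comp (reesConstantCoeff I)
  have hε : Function.Surjective ε := by
    intro x
    obtain ⟨r, rfl⟩ := residue_surjective x
    refine ⟨algebraMap R _ r, ?_⟩
    change residue R ((C r).coeff 0) = _
    rw [coeff_C_zero]
  have hmem : ∀ f, f ∈ RingHom.ker ε ↔ (f : R[X]).coeff 0 ∈ maximalIdeal R := fun f => by
    rw [RingHom.mem_ker]
    exact residue_eq_zero_iff _
  have hεmax : (RingHom.ker ε).IsMaximal := RingHom.ker_isMaximal_of_surjective ε hε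
  have hmQ : (maximalIdeal R).map (algebraMap R (reesAlgebra I)) ≤ Q.comap π := by
    rw [← hker]
    intro f hf
    rw [Ideal.mem_comap, RingHom.mem_ker.mp hf]
    exact zero_mem _
  -- `Q` contains the graded maximal ideal, so it is the graded maximal ideal
  have hle : RingHom.ker ε ≤ Q.comap π := by
    intro f hf
    rw [eq_sum_reesMonomial f]
    refine sum_mem fun n _ => ?_
    cases n with
    | zero =>
      have h1 : reesMonomial 0 ((f : R[X]).coeff 0) (f.2 0) =
          algebraMap R (reesAlgebra I) ((f : R[X]).coeff 0) := Subtype.ext rfl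
      rw [h1]
      exact hmQ (Ideal.mem_map_of_mem _ ((hmem f).mp hf))
    | succ n =>
      have h1 : Ideal.span (Set.range (reesDegreeOne I)) ≤ Q.comap π := by
        refine Ideal.span_le.mpr ?_
        rintro _ ⟨c, rfl⟩
        exact hcon c
      exact h1 (Ideal.pow_le_self (by omega) (reesMonomial_mem_pow (n + 1) _ (f.2 (n + 1))))
  have hQε : Q.comap π = RingHom.ker ε :=
    (hεmax.eq_of_le (Ideal.IsPrime.ne_top inferInstance) hle).symm
  have hQmax : Q.IsMaximal := by
    have h1 : (Q.comap π).IsMaximal := hQε ▸ hεmax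
    rw [← Ideal.map_comap_of_surjective π hπ Q]
    refine (Ideal.map_eq_top_or_isMaximal_of_surjective π hπ h1).resolve_left ?_
    rw [Ideal.map_comap_of_surjective π hπ Q]
    exact hQp.ne_top
  -- as `B_Q` is Cohen–Macaulay, a power of `Q` lies in the ideal of the sequence, up to an element
  -- `s = π f` outside `Q`; the constant coefficient of `f` is a unit
  obtain ⟨u, hu⟩ := exists_forall_mul_mem_iff hQ
  obtain ⟨N, hN⟩ := exists_forall_mem_pow_exists_mul_mem Q (hB.2 Q) (by
    intro r hr
    obtain ⟨c, -, rfl⟩ := List.mem_map.mp hr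
    exact hcon c) hw hu
  refine absurd (ringKrullDim_le_length_of_pow_succ_le hrad (l := l) (n := N) fun c hc => ?_)
    (not_le.mpr hl)
  have hcQ : π (reesMonomial (N + 1) c hc) ∈ Q ^ N := by
    have h1 : Ideal.span (Set.range (reesDegreeOne I)) ≤ Q.comap π := by
      refine Ideal.span_le.mpr ?_
      rintro _ ⟨c, rfl⟩
      exact hcon c
    have h2 := Ideal.pow_le_pow_right (Nat.le_succ N) (reesMonomial_mem_pow (N + 1) c hc)
    exact Ideal.le_comap_pow π N (Ideal.pow_right_mono h1 N h2)
  obtain ⟨s, hs, hsc⟩ := hN _ hcQ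
  obtain ⟨f, rfl⟩ := hπ s
  have hf : IsUnit ((f : R[X]).coeff 0) := by
    by_contra hcon'
    refine hs ?_
    rw [← Ideal.mem_comap, hQε, hmem]
    exact (mem_maximalIdeal _).mpr hcon'
  have h3 : f * reesMonomial (N + 1) c hc ∈ Ideal.ofList (l.map (reesDegreeOne I)) ⊔
      (maximalIdeal R).map (algebraMap R (reesAlgebra I)) := by
    rw [← hker, RingHom.ker_eq_comap_bot, ← Ideal.comap_map_of_surjective π hπ, Ideal.mem_comap,
      map_mul, Ideal.map_ofList, List.map_map]
    exact hsc
  have h4 := coeff_mem_of_mem_ofList_sup_map h3 N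
  have h5 : ((f * reesMonomial (N + 1) c hc : reesAlgebra I) : R[X]).coeff (N + 1) =
      (f : R[X]).coeff 0 * c := by
    rw [MulMemClass.coe_mul, coe_reesMonomial]
    have := coeff_mul_monomial (f : R[X]) (N + 1) 0 c
    rwa [zero_add] at this
  rw [h5] at h4
  exact (Ideal.unit_mul_mem_iff_mem _ hf).mp h4

/-- Let `J` be generated by a regular sequence that is shorter than `dim R`. A general element of an
`𝔪`-primary ideal `L` is regular modulo `J` and superficial for the images of `K` and `L` in
`R / J`. -/
theorem exists_finite_forall_regular_superficial [IsLocalRing R] {d : ℕ}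
    (hR : IsCohenMacaulayOfDim R d) {K L : Ideal R} (hrad : L.radical = maximalIdeal R) {k : ℕ}
    (hk : L ^ k ≤ K) {rs : List R} (hrs : ∀ r ∈ rs, r ∈ maximalIdeal R)
    (hw : IsWeaklyRegular R rs) (hl : rs.length < d) :
    ∃ 𝒲 : Set (Submodule R L), 𝒲.Finite ∧ (∀ W ∈ 𝒲, W ≠ ⊤) ∧ ∀ a : L, (∀ W ∈ 𝒲, a ∉ W) →
      IsWeaklyRegular R (rs ++ [(a : R)]) ∧ ∃ s₀, ∀ r, ∀ s ≥ s₀, ∀ z,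
        (a : R) * z ∈ Ideal.ofList rs ⊔ K ^ r * L ^ (s + 1) →
          z ∈ Ideal.ofList rs ⊔ K ^ r * L ^ s := by
  have := hR.isNoetherianRing
  set J := Ideal.ofList rs with hJ
  obtain ⟨𝒲₁, hf₁, ht₁, h₁⟩ := exists_finite_forall_regular (RingHom.id R) L.subtype.toAddMonoidHom
    (fun r c => rfl) J (by
      intro Q hQ hcon
      obtain ⟨u, hu⟩ := exists_forall_mul_mem_iff hQ
      have hQp : Q.IsPrime := hQ.1
      have hmQ : maximalIdeal R ≤ Q := by
        rw [← hrad]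
        exact (Ideal.IsPrime.radical_le_iff hQp).mpr fun c hc => hcon ⟨c, hc⟩
      have h1 : u ∈ J :=
        hR.mem_ofList_of_forall_mul_mem hrs hw hl fun x hx => (hu x).mpr (hmQ hx)
      exact hQp.ne_top ((Ideal.eq_top_iff_one _).mpr ((hu 1).mp (by rwa [one_mul]))))
  obtain ⟨𝒲₃, hf₃, ht₃, h₃⟩ := exists_finite_forall_superficial (Ideal.Quotient.mk J) L
    (K.map (Ideal.Quotient.mk J)) (l := k) (by
      rw [← Ideal.map_pow]
      exact Ideal.map_mono hk)
  refine ⟨𝒲₁ ∪ 𝒲₃, hf₁.union hf₃, ?_, fun a ha => ?_⟩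
  · rintro W (hW | hW)
    exacts [ht₁ W hW, ht₃ W hW]
  have ha₁ := h₁ a fun W hW => ha W (Or.inl hW)
  have hreg : IsSMulRegular (R ⧸ J) (Ideal.Quotient.mk J (a : R)) := by
    have h4 : IsSMulRegular (R ⧸ J) (a : R) :=
      (isSMulRegular_quotient_iff_mem_of_smul_mem _ _).mpr ha₁
    exact fun x y hxy => h4 hxy
  obtain ⟨s₀, hs₀⟩ := h₃ a (fun W hW => ha W (Or.inr hW)) hreg
  refine ⟨?_, s₀, ?_⟩
  · rw [isWeaklyRegular_append_singleton_iff]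
    exact ⟨hw, ha₁⟩
  · intro r s hs z hz
    have h5 := hs₀ r s hs (Ideal.Quotient.mk J z)
    rw [← map_mul, ← Ideal.map_pow, ← Ideal.map_pow, ← Ideal.map_pow, ← Ideal.map_mul,
      ← Ideal.map_mul, Ideal.mem_quotient_iff_mem_sup, Ideal.mem_quotient_iff_mem_sup,
      sup_comm, sup_comm _ J] at h5
    exact h5 hz

/-- One step in the choice of the general elements. Given `l = a₁, …, aᵢ ∈ I` with `i < d`, regular
on `R` and with initial forms regular on the fiber cone, a general element `a` of `I` prolongs both
sequences and is superficial for the images of `𝔪` and `I` in `R / (l)`. -/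
theorem exists_isWeaklyRegular_append_of_infinite [IsLocalRing R]
    [Infinite (ResidueField R)] {d : ℕ} (hR : IsCohenMacaulayOfDim R d)
    (hrad : I.radical = maximalIdeal R) {B : Type u} [CommRing B] [IsNoetherianRing B]
    (hB : IsCohenMacaulayRing B)
    (π : reesAlgebra I →+* B) (hπ : Function.Surjective π)
    (hker : RingHom.ker π = (maximalIdeal R).map (algebraMap R (reesAlgebra I))) {l : List I}
    (hl : l.length < d) (hw : IsWeaklyRegular R (l.map ((↑) : I → R)))
    (hwB : IsWeaklyRegular B (l.map fun c => π (reesDegreeOne I c))) :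
    ∃ a : I, IsWeaklyRegular R ((l ++ [a]).map ((↑) : I → R)) ∧
      IsWeaklyRegular B ((l ++ [a]).map fun c => π (reesDegreeOne I c)) ∧
      ∃ s₀, ∀ r, ∀ s ≥ s₀, ∀ z,
        (a : R) * z ∈ Ideal.ofList (l.map ((↑) : I → R)) ⊔ maximalIdeal R ^ r * I ^ (s + 1) →
        z ∈ Ideal.ofList (l.map ((↑) : I → R)) ⊔ maximalIdeal R ^ r * I ^ s := by
  have := hR.isNoetherianRing
  have hIm : I ≤ maximalIdeal R := hrad ▸ Ideal.le_radical
  obtain ⟨𝒲₁, hf₁, ht₁, h₁⟩ := exists_finite_forall_regular_superficial hR hrad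
    (K := maximalIdeal R) (k := 1) (by rwa [pow_one]) (by
      intro r hr
      obtain ⟨c, -, rfl⟩ := List.mem_map.mp hr
      exact hIm c.2) hw (by simpa using hl)
  obtain ⟨𝒲₂, hf₂, ht₂, h₂⟩ := exists_finite_forall_regular
    (π.comp (algebraMap R (reesAlgebra I)))
    (π.toAddMonoidHom.comp (reesDegreeOne I).toAddMonoidHom)
    (fun r c => by
      change π (reesDegreeOne I (r • c)) = π (algebraMap R _ r) * π (reesDegreeOne I c)
      rw [map_smul, Algebra.smul_def, map_mul])
    (Ideal.ofList (l.map fun c => π (reesDegreeOne I c)))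
    (exists_reesDegreeOne_notMem_of_mem_associatedPrimes hrad hB π hπ hker
      (by rw [hR.ringKrullDim_eq]; exact_mod_cast hl) hwB)
  obtain ⟨a, ha⟩ := exists_forall_notMem_of_finite (R := R) (M := I) (hf₁.union hf₂) (by
    rintro W (hW | hW)
    exacts [ht₁ W hW, ht₂ W hW])
  obtain ⟨ha₁, s₀, hs₀⟩ := h₁ a fun W hW => ha W (Or.inl hW)
  have ha₂ := h₂ a fun W hW => ha W (Or.inr hW)
  refine ⟨a, ?_, ?_, s₀, hs₀⟩
  · rwa [List.map_append, List.map_singleton]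
  · rw [List.map_append, List.map_singleton, isWeaklyRegular_append_singleton_iff]
    exact ⟨hwB, ha₂⟩

end GeneralElements

/-! ### Colengths and relative lengths -/

section Colength

variable {R : Type u} [CommRing R]

/-- The colength `ℓ(R / A)` of an ideal `A`, possibly infinite. -/
noncomputable def colength (A : Ideal R) : ℕ∞ := Module.length R (R ⧸ A)

theorem colength_ne_top [IsLocalRing R] [IsNoetherianRing R] {A : Ideal R} {n : ℕ}
    (hn : maximalIdeal R ^ n ≤ A) : colength A ≠ ⊤ := by
  by_cases hA : A = ⊤
  · subst hA
    rw [colength, Module.length_eq_zero]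
    exact ENat.zero_ne_top
  have : Nontrivial (R ⧸ A) := Ideal.Quotient.nontrivial_iff.mpr hA
  have : IsLocalRing (R ⧸ A) :=
    IsLocalRing.of_surjective' (Ideal.Quotient.mk A) Ideal.Quotient.mk_surjective
  have hm : (maximalIdeal R).map (Ideal.Quotient.mk A) = maximalIdeal (R ⧸ A) :=
    IsLocalRing.map_maximalIdeal_of_surjective _ Ideal.Quotient.mk_surjective
  have : IsArtinianRing (R ⧸ A) := by
    rw [isArtinianRing_iff_isNilpotent_maximalIdeal]
    refine ⟨n, ?_⟩
    rw [← hm, ← Ideal.map_pow, Ideal.zero_eq_bot, Ideal.map_eq_bot_iff_le_ker, Ideal.mk_ker]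
    exact hn
  rw [colength, Module.length_eq_of_surjective (S := R) (R := R ⧸ A) Ideal.Quotient.mk_surjective]
  exact Module.length_ne_top

theorem colength_anti {A B : Ideal R} (h : A ≤ B) : colength B ≤ colength A :=
  Module.length_le_of_surjective (Submodule.factor h) (Submodule.factor_surjective h)

theorem colength_add_one_le {A B : Ideal R} (h : A < B) : colength B + 1 ≤ colength A := by
  rw [colength, colength, Module.length_quotient, Module.length_quotient]
  exact Order.coheight_add_one_le h

/-- Multiplication by `a` identifies `R / (A : a)` with the kernel of `R / A → R / (A + a R)`. -/
theorem colength_eq_add {A A' : Ideal R} {a : R} (h : ∀ z, z ∈ A' ↔ a * z ∈ A) :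
    colength A = colength A' + colength (A ⊔ Ideal.span {a}) := by
  let f : (R ⧸ A') →ₗ[R] R ⧸ A :=
    Submodule.mapQ A' A (LinearMap.lsmul R R a) fun z hz => (h z).mp hz
  let g : (R ⧸ A) →ₗ[R] R ⧸ (A ⊔ Ideal.span {a}) := Submodule.factor le_sup_left
  have hf : ∀ z, f (Submodule.Quotient.mk z) = Submodule.Quotient.mk (a * z) := fun z => rfl
  refine Module.length_eq_add_of_exact f g ?_ (Submodule.factor_surjective _) ?_
  · rw [injective_iff_map_eq_zero]
    intro z hz
    obtain ⟨z, rfl⟩ := Submodule.Quotient.mk_surjective _ z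
    rw [hf, Submodule.Quotient.mk_eq_zero] at hz
    rw [Submodule.Quotient.mk_eq_zero]
    exact (h z).mpr hz
  · intro z
    obtain ⟨z, rfl⟩ := Submodule.Quotient.mk_surjective _ z
    change Submodule.Quotient.mk z = 0 ↔ _
    rw [Submodule.Quotient.mk_eq_zero]
    constructor
    · intro hz
      obtain ⟨p, hp, q, hq, rfl⟩ := Submodule.mem_sup.mp hz
      obtain ⟨w, rfl⟩ := Ideal.mem_span_singleton'.mp hq
      refine ⟨Submodule.Quotient.mk w, ?_⟩
      rw [hf, Submodule.Quotient.eq]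
      have h1 : a * w - (p + w * a) = -p := by ring
      change a * w - (p + w * a) ∈ A
      rw [h1]
      exact neg_mem hp
    · rintro ⟨w, hw⟩
      obtain ⟨w, rfl⟩ := Submodule.Quotient.mk_surjective _ w
      rw [hf, Submodule.Quotient.eq] at hw
      have h1 : z = a * w - (a * w - z) := by ring
      rw [h1]
      exact sub_mem (Submodule.mem_sup_right (Ideal.mul_mem_right _ _
        (Ideal.mem_span_singleton_self a))) (Submodule.mem_sup_left hw)

/-- The length of `X / (X ∩ Y)`; it is used for `Y ⊆ X`. -/
noncomputable def relLength (X Y : Ideal R) : ℕ∞ :=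
  Module.length R (X ⧸ Submodule.comap X.subtype Y)

theorem colength_eq_add_relLength {X Y : Ideal R} (h : Y ≤ X) :
    colength Y = relLength X Y + colength X := by
  let f : (X ⧸ Submodule.comap X.subtype Y) →ₗ[R] R ⧸ Y := Submodule.mapQ _ Y X.subtype le_rfl
  have hf : ∀ z : X, f (Submodule.Quotient.mk z) = Submodule.Quotient.mk (z : R) := fun z => rfl
  refine Module.length_eq_add_of_exact f (Submodule.factor h) ?_ (Submodule.factor_surjective _) ?_
  · rw [injective_iff_map_eq_zero]
    intro z hz
    obtain ⟨z, rfl⟩ := Submodule.Quotient.mk_surjective _ z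
    rw [hf, Submodule.Quotient.mk_eq_zero] at hz
    rw [Submodule.Quotient.mk_eq_zero]
    exact hz
  · intro z
    obtain ⟨z, rfl⟩ := Submodule.Quotient.mk_surjective _ z
    change Submodule.Quotient.mk z = 0 ↔ _
    rw [Submodule.Quotient.mk_eq_zero]
    constructor
    · intro hz
      exact ⟨Submodule.Quotient.mk ⟨z, hz⟩, rfl⟩
    · rintro ⟨w, hw⟩
      obtain ⟨w, rfl⟩ := Submodule.Quotient.mk_surjective _ w
      rw [hf, Submodule.Quotient.eq] at hw
      have h1 : z = w - (w - z) := by ring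
      rw [h1]
      exact sub_mem w.2 (h hw)

/-- Multiplication by `a` induces an injection `X / Y → X' / Y'`. If the lengths agree, it is
surjective. -/
theorem relLength_le_relLength {X Y X' Y' : Ideal R} {a : R} (hX : ∀ z ∈ X, a * z ∈ X')
    (hY : ∀ z ∈ X, a * z ∈ Y' ↔ z ∈ Y) : relLength X Y ≤ relLength X' Y' ∧
      (relLength X' Y' ≤ relLength X Y → relLength X Y ≠ ⊤ → X' ≤ Ideal.span {a} * X ⊔ Y') := by
  let m : X →ₗ[R] X' := (LinearMap.lsmul R R a).restrict hX
  let f : (X ⧸ Submodule.comap X.subtype Y) →ₗ[R] X' ⧸ Submodule.comap X'.subtype Y' :=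
    Submodule.mapQ _ _ m fun z hz => (hY z z.2).mpr hz
  have hfm : ∀ z : X, f (Submodule.Quotient.mk z) = Submodule.Quotient.mk (m z) := fun z => rfl
  have hf : Function.Injective f := by
    rw [injective_iff_map_eq_zero]
    intro z hz
    obtain ⟨z, rfl⟩ := Submodule.Quotient.mk_surjective _ z
    rw [hfm, Submodule.Quotient.mk_eq_zero] at hz
    rw [Submodule.Quotient.mk_eq_zero]
    exact (hY z z.2).mp hz
  refine ⟨Module.length_le_of_injective f hf, fun hle hfin => ?_⟩
  have h1 := Module.length_eq_add_of_exact f (LinearMap.range f).mkQ hf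
    (Submodule.mkQ_surjective _) (LinearMap.exact_map_mkQ_range f)
  have h2 : Module.length R (_ ⧸ LinearMap.range f) = 0 := by
    have h3 : relLength X Y + Module.length R (_ ⧸ LinearMap.range f) ≤ relLength X Y + 0 := by
      rw [add_zero]
      exact h1.symm.trans_le hle
    exact nonpos_iff_eq_zero.mp ((ENat.add_le_add_iff_left hfin).mp h3)
  have h4 : LinearMap.range f = ⊤ :=
    Submodule.Quotient.subsingleton_iff.mp (Module.length_eq_zero_iff.mp h2)
  intro z hz
  obtain ⟨w, hw⟩ := LinearMap.range_eq_top.mp h4 (Submodule.Quotient.mk ⟨z, hz⟩)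
  obtain ⟨w, rfl⟩ := Submodule.Quotient.mk_surjective _ w
  rw [hfm, Submodule.Quotient.eq] at hw
  have h5 : a * (w : R) - z ∈ Y' := hw
  have h6 : z = a * (w : R) - (a * (w : R) - z) := by ring
  rw [h6]
  exact sub_mem (Submodule.mem_sup_left (Ideal.mul_mem_mul (Ideal.mem_span_singleton_self a) w.2))
    (Submodule.mem_sup_right h5)

/-- The ideal `X` is generated by at most `ℓ(X / Y)` elements modulo `Y`, since each new generator
lowers the colength. -/
theorem exists_finset_span_sup_eq [IsNoetherianRing R] (X Y : Ideal R) (h : Y ≤ X) :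
    ∃ T : Finset R, Ideal.span (T : Set R) ⊔ Y = X ∧ T.card + colength X ≤ colength Y := by
  classical
  induction Y using WellFoundedGT.induction with
  | ind Y ih =>
    by_cases hXY : X ≤ Y
    · obtain rfl := le_antisymm h hXY
      exact ⟨∅, by simp, by simp⟩
    · obtain ⟨t, htX, htY⟩ := SetLike.not_le_iff_exists.mp hXY
      have hlt : Y < Y ⊔ Ideal.span {t} := left_lt_sup.mpr fun hle =>
        htY (hle (Ideal.mem_span_singleton_self t))
      obtain ⟨T, hT, hc⟩ := ih _ hlt (sup_le h ((Ideal.span_singleton_le_iff_mem _).mpr htX))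
      refine ⟨insert t T, ?_, ?_⟩
      · rw [Finset.coe_insert, Ideal.span_insert, ← hT]
        simp only [sup_comm, sup_left_comm]
      · calc ((insert t T).card : ℕ∞) + colength X ≤ (T.card + 1 : ℕ) + colength X := by
              gcongr
              exact Finset.card_insert_le _ _
          _ = (T.card + colength X) + 1 := by push_cast; ring
          _ ≤ colength (Y ⊔ Ideal.span {t}) + 1 := by gcongr
          _ ≤ colength Y := colength_add_one_le hlt

/-- If `V ⊆ (l) + 𝔪 I`, then `I` is generated by `l` and at most `ℓ(I / V)` further elements. The
two colengths stand for `ℓ(I / V)`. -/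
theorem spanFinrank_le_of_le_sup [IsLocalRing R] [IsNoetherianRing R] {I V : Ideal R} {l : List I}
    (hVI : V ≤ I) (hV : V ≤ Ideal.ofList (l.map ((↑) : I → R)) ⊔ maximalIdeal R * I) :
    Submodule.spanFinrank I + colength I ≤ l.length + colength V := by
  classical
  obtain ⟨T, hT, hc⟩ := exists_finset_span_sup_eq I V hVI
  let U : Finset R := T ∪ (l.map ((↑) : I → R)).toFinset
  have hspan : Ideal.span (U : Set R) =
      Ideal.span (T : Set R) ⊔ Ideal.ofList (l.map ((↑) : I → R)) := by
    rw [Finset.coe_union, Ideal.span_union]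
    congr 2
    ext x
    simp
  have hI : Ideal.span (U : Set R) = I := by
    apply le_antisymm
    · rw [hspan]
      refine sup_le (hT ▸ le_sup_left) (Ideal.span_le.mpr fun r hr => ?_)
      obtain ⟨c, -, rfl⟩ := List.mem_map.mp hr
      exact c.2
    · refine Submodule.le_of_le_smul_of_le_jacobson_bot (IsNoetherian.noetherian I)
        (maximalIdeal_le_jacobson _) ?_
      calc I = Ideal.span (T : Set R) ⊔ V := hT.symm
        _ ≤ Ideal.span (T : Set R) ⊔ (Ideal.ofList (l.map ((↑) : I → R)) ⊔ maximalIdeal R * I) :=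
          sup_le_sup_left hV _
        _ = _ := by rw [hspan, sup_assoc]; rfl
  have h1 : Submodule.spanFinrank I ≤ U.card := by
    have := Submodule.spanFinrank_span_le_ncard_of_finite (R := R) U.finite_toSet
    rw [Set.ncard_coe_finset] at this
    have h2 : Submodule.span R (U : Set R) = I := hI
    rwa [h2] at this
  have h3 : U.card ≤ T.card + l.length :=
    (Finset.card_union_le _ _).trans (Nat.add_le_add_left
      ((List.toFinset_card_le _).trans_eq (List.length_map _)) _)
  calc (Submodule.spanFinrank I : ℕ∞) + colength I ≤ (T.card + l.length : ℕ) + colength I := by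
        gcongr
        exact h1.trans h3
    _ = l.length + (T.card + colength I) := by push_cast; ring
    _ ≤ l.length + colength V := by gcongr

end Colength

/-! ### Differences of the Bhattacharya function -/

section Differences

/-- The function `f` agrees for large arguments with the polynomial
`∑_{a + b ≤ m} c a b * (r + a choose a) * (s + b choose b)`. -/
def IsEventuallyBinomialSum (m : ℕ) (c : ℕ → ℕ → ℤ) (f : ℕ → ℕ → ℤ) : Prop :=
  ∃ N : ℕ, ∀ r s : ℕ, N ≤ r → N ≤ s → f r s =
    ∑ a ∈ Finset.range (m + 1), ∑ b ∈ Finset.range (m + 1 - a),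
      c a b * ((r + a).choose a : ℤ) * ((s + b).choose b : ℤ)

/-- Taking differences in the second variable shifts the coefficients. -/
theorem IsEventuallyBinomialSum.sub {m : ℕ} {c f g : ℕ → ℕ → ℤ}
    (hf : IsEventuallyBinomialSum (m + 1) c f) {s₀ : ℕ}
    (hg : ∀ r, ∀ s ≥ s₀, f r (s + 1) = f r s + g r (s + 1)) :
    IsEventuallyBinomialSum m (fun a b => c a (b + 1)) g := by
  obtain ⟨N, hN⟩ := hf
  refine ⟨max N s₀ + 1, fun r s hr hs => ?_⟩
  obtain ⟨s, rfl⟩ : ∃ t, s = t + 1 := ⟨s - 1, by omega⟩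
  have h1 := hg r s (by omega)
  rw [hN r (s + 1) (by omega) (by omega), hN r s (by omega) (by omega)] at h1
  have h2 := eq_sub_of_add_eq' h1.symm
  rw [h2, ← Finset.sum_sub_distrib, Finset.sum_range_succ]
  have h3 : m + 1 + 1 - (m + 1) = 1 := by omega
  rw [h3, Finset.sum_range_one, Finset.sum_range_one]
  simp only [add_zero, Nat.choose_zero_right, sub_self]
  refine Finset.sum_congr rfl fun a ha => ?_
  have h4 : m + 1 + 1 - a = (m + 1 - a) + 1 := by
    have := Finset.mem_range.mp ha
    omega
  rw [h4, Finset.sum_range_succ', Finset.sum_range_succ']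
  simp only [add_zero, Nat.choose_zero_right, add_sub_add_right_eq_sub]
  rw [← Finset.sum_sub_distrib]
  refine Finset.sum_congr rfl fun b _ => ?_
  have h5 : ((s + 1 + (b + 1)).choose (b + 1) : ℤ) =
      ((s + 1 + b).choose b : ℤ) + ((s + (b + 1)).choose (b + 1) : ℤ) := by
    have := Nat.choose_succ_succ (s + 1 + b) b
    rw [show s + (b + 1) = s + 1 + b by ring]
    exact_mod_cast this
  rw [h5]
  ring

/-- A polynomial of total degree one has a constant difference in the first variable. -/
theorem IsEventuallyBinomialSum.exists_sub_eq {c f : ℕ → ℕ → ℤ}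
    (hf : IsEventuallyBinomialSum 1 c f) :
    ∃ N, ∀ r s, N ≤ r → N ≤ s → f (r + 1) s - f r s = c 1 0 := by
  obtain ⟨N, hN⟩ := hf
  refine ⟨N, fun r s hr hs => ?_⟩
  rw [hN (r + 1) s (by omega) hs, hN r s hr hs]
  simp [Finset.sum_range_succ]
  ring

variable {R : Type u} [CommRing R]

/-- If `(J + A : a) = J + A'`, then `ℓ(R / (J + A))` is the sum of `ℓ(R / (J + A'))` and
`ℓ(R / (J + a R + A))`. So the colength function of a superficial element is a difference. -/
theorem toNat_colength_sup_eq_add [IsLocalRing R] [IsNoetherianRing R] {J A A' : Ideal R} {a : R}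
    (ha : ∀ z ∈ A', a * z ∈ A) (h : ∀ z, a * z ∈ J ⊔ A → z ∈ J ⊔ A') {n : ℕ}
    (hn : maximalIdeal R ^ n ≤ A) : ((colength (J ⊔ A)).toNat : ℤ) =
      (colength (J ⊔ A')).toNat + (colength (J ⊔ Ideal.span {a} ⊔ A)).toNat := by
  have h1 : ∀ z, z ∈ J ⊔ A' ↔ a * z ∈ J ⊔ A := fun z => by
    refine ⟨fun hz => ?_, h z⟩
    obtain ⟨p, hp, q, hq, rfl⟩ := Submodule.mem_sup.mp hz
    rw [mul_add]
    exact Submodule.add_mem_sup (Ideal.mul_mem_left _ _ hp) (ha q hq)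
  have h2 := colength_eq_add h1
  have h3 : J ⊔ A ⊔ Ideal.span {a} = J ⊔ Ideal.span {a} ⊔ A := sup_right_comm _ _ _
  rw [h3] at h2
  have h4 : colength (J ⊔ A') ≠ ⊤ := colength_ne_top (n := n)
    (hn.trans fun z hz => h z (Ideal.mul_mem_left _ _ (Submodule.mem_sup_right hz)))
  have h5 : colength (J ⊔ Ideal.span {a} ⊔ A) ≠ ⊤ := colength_ne_top (hn.trans le_sup_right)
  rw [h2, ENat.toNat_add h4 h5]
  push_cast
  rfl

theorem exists_pow_le_pow_mul_pow [IsLocalRing R] [IsNoetherianRing R] {I : Ideal R}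
    (hrad : I.radical = maximalIdeal R) (r s : ℕ) :
    ∃ n, maximalIdeal R ^ n ≤ maximalIdeal R ^ r * I ^ s := by
  obtain ⟨k, hk⟩ := Ideal.exists_pow_le_of_le_radical_of_fg hrad.ge (IsNoetherian.noetherian _)
  refine ⟨r + k * s, ?_⟩
  rw [pow_add, pow_mul]
  exact Ideal.mul_mono_right (Ideal.pow_right_mono hk s)

/-- A superficial sequence of length `i` in `I` whose initial forms are regular on the fiber cone.
The function `ℓ(R / (J + 𝔪ʳ Iˢ))` is the `i`-th difference in `s` of the Bhattacharya function. -/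
theorem exists_list_superficial [IsLocalRing R] {I : Ideal R}
    [Infinite (ResidueField R)] {d : ℕ} (hR : IsCohenMacaulayOfDim R d)
    (hrad : I.radical = maximalIdeal R) {B : Type u} [CommRing B] [IsNoetherianRing B]
    (hB : IsCohenMacaulayRing B)
    (π : reesAlgebra I →+* B) (hπ : Function.Surjective π)
    (hker : RingHom.ker π = (maximalIdeal R).map (algebraMap R (reesAlgebra I)))
    {e : ℕ → ℕ → ℤ} (he : IsBhattacharyaCoeff d I e) (i : ℕ) (hi : i < d) :
    ∃ l : List I, l.length = i ∧ IsWeaklyRegular R (l.map ((↑) : I → R)) ∧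
      IsWeaklyRegular B (l.map fun c => π (reesDegreeOne I c)) ∧
      (∃ N, ∀ n ≥ N, Ideal.ofList (l.map ((↑) : I → R)) ⊓ I ^ (n + 1) ≤
        Ideal.ofList (l.map ((↑) : I → R)) * I ^ n) ∧
      IsEventuallyBinomialSum (d - i) (fun a b => e a (b + i)) (fun r s =>
        ((colength (Ideal.ofList (l.map ((↑) : I → R)) ⊔
          maximalIdeal R ^ r * I ^ s)).toNat : ℤ)) := by
  have := hR.isNoetherianRing
  induction i with
  | zero =>
    refine ⟨[], rfl, .nil R R, .nil B B, ⟨0, ?_⟩, ?_⟩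
    · simp
    · simp only [List.map_nil, Ideal.ofList_nil, bot_sup_eq]
      exact he
  | succ i ih =>
    obtain ⟨l, hl, hw, hwB, ⟨N, hN⟩, hsum⟩ := ih (by omega)
    obtain ⟨a, ha, haB, s₀, hs₀⟩ := exists_isWeaklyRegular_append_of_infinite hR hrad hB π hπ hker
      (l := l) (by omega) hw hwB
    have hof : Ideal.ofList ((l ++ [a]).map ((↑) : I → R)) =
        Ideal.ofList (l.map ((↑) : I → R)) ⊔ Ideal.span {(a : R)} := by
      rw [List.map_append, List.map_singleton, ofList_append_singleton]
    refine ⟨l ++ [a], by simp [hl], ha, haB, ⟨max N s₀, ?_⟩, ?_⟩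
    · rw [hof]
      set J := Ideal.ofList (l.map ((↑) : I → R)) with hJ
      rintro n hn z ⟨hz, hzI⟩
      obtain ⟨j, hj, q, hq, rfl⟩ := Submodule.mem_sup.mp hz
      obtain ⟨w, rfl⟩ := Ideal.mem_span_singleton.mp hq
      have h1 := hs₀ 0 n (by omega) w
      rw [pow_zero, one_mul, one_mul] at h1
      have h2 : (a : R) * w ∈ J ⊔ I ^ (n + 1) := by
        have h3 : (a : R) * w = -j + (j + a * w) := by ring
        rw [h3]
        exact Submodule.add_mem_sup (neg_mem hj) hzI
      obtain ⟨j', hj', w', hw', rfl⟩ := Submodule.mem_sup.mp (h1 h2)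
      have h4 : (a : R) * w' ∈ I ^ (n + 1) := by
        rw [pow_succ']
        exact Ideal.mul_mem_mul a.2 hw'
      have h5 : j + (a : R) * j' ∈ J ⊓ I ^ (n + 1) := by
        refine ⟨add_mem hj (Ideal.mul_mem_left _ _ hj'), ?_⟩
        have h6 : j + (a : R) * j' = (j + a * (j' + w')) - a * w' := by ring
        rw [h6]
        exact sub_mem hzI h4
      have h7 : j + (a : R) * (j' + w') = (j + a * j') + a * w' := by ring
      rw [h7]
      exact add_mem (Ideal.mul_mono_left le_sup_left (hN n (by omega) h5))
        (Ideal.mul_mem_mul (Submodule.mem_sup_right (Ideal.mem_span_singleton_self _)) hw')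
    · rw [hof]
      have h8 : d - i = (d - (i + 1)) + 1 := by omega
      rw [h8] at hsum
      have h9 := hsum.sub (s₀ := s₀) (g := fun r s => ((colength
        (Ideal.ofList (l.map ((↑) : I → R)) ⊔ Ideal.span {(a : R)} ⊔
          maximalIdeal R ^ r * I ^ s)).toNat : ℤ)) (by
        intro r s hs
        obtain ⟨n, hn⟩ := exists_pow_le_pow_mul_pow hrad r (s + 1)
        refine toNat_colength_sup_eq_add (a := (a : R)) ?_ (hs₀ r s hs) hn
        intro z hz
        rw [pow_succ', mul_left_comm]
        exact Ideal.mul_mem_mul a.2 hz)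
      convert h9 using 4
      ring

end Differences

/-! ### The reduction number -/

section ReductionNumber

open Polynomial

variable {R : Type u} [CommRing R] {I : Ideal R}

/-- The converse of `coeff_mem_of_mem_ofList_sup_map` for homogeneous elements. -/
theorem reesMonomial_mem_ofList_sup_map {l : List I} {𝔪 : Ideal R} {n : ℕ} {c : R}
    (hc : c ∈ I ^ (n + 1))
    (h : c ∈ Ideal.ofList (l.map ((↑) : I → R)) * I ^ n ⊔ 𝔪 * I ^ (n + 1)) :
    reesMonomial (n + 1) c hc ∈
      Ideal.ofList (l.map (reesDegreeOne I)) ⊔ 𝔪.map (algebraMap R (reesAlgebra I)) := by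
  have h1 : ∀ j ∈ Ideal.ofList (l.map ((↑) : I → R)),
      ∃ g ∈ Ideal.ofList (l.map (reesDegreeOne I)), (g : R[X]) = monomial 1 j := by
    intro j hj
    refine Submodule.span_induction (p := fun j _ =>
      ∃ g ∈ Ideal.ofList (l.map (reesDegreeOne I)), (g : R[X]) = monomial 1 j) ?_ ?_ ?_ ?_ hj
    · intro j hj
      obtain ⟨c, hc, rfl⟩ := List.mem_map.mp hj
      exact ⟨reesDegreeOne I c, Ideal.subset_span (List.mem_map_of_mem hc), rfl⟩
    · exact ⟨0, zero_mem _, by simp⟩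
    · rintro x y _ _ ⟨g, hg, hgx⟩ ⟨g', hg', hgy⟩
      exact ⟨g + g', add_mem hg hg', by rw [AddMemClass.coe_add, hgx, hgy, map_add]⟩
    · rintro r x _ ⟨g, hg, hgx⟩
      refine ⟨algebraMap R _ r * g, Ideal.mul_mem_left _ _ hg, ?_⟩
      rw [MulMemClass.coe_mul, hgx, coe_algebraMap_reesAlgebra, C_mul_monomial, smul_eq_mul]
  have h2 : ∀ p ∈ Ideal.ofList (l.map ((↑) : I → R)) * I ^ n,
      ∃ g ∈ Ideal.ofList (l.map (reesDegreeOne I)), (g : R[X]) = monomial (n + 1) p := by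
    intro p hp
    refine Submodule.mul_induction_on hp ?_ ?_
    · intro j hj y hy
      obtain ⟨g, hg, hgj⟩ := h1 j hj
      refine ⟨reesMonomial n y hy * g, Ideal.mul_mem_left _ _ hg, ?_⟩
      rw [MulMemClass.coe_mul, hgj, coe_reesMonomial, monomial_mul_monomial, mul_comm y]
    · rintro x y ⟨g, hg, hgx⟩ ⟨g', hg', hgy⟩
      exact ⟨g + g', add_mem hg hg', by rw [AddMemClass.coe_add, hgx, hgy, map_add]⟩
  obtain ⟨p, hp, q, hq, rfl⟩ := Submodule.mem_sup.mp h
  obtain ⟨g, hg, hgp⟩ := h2 p hp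
  have hqI : q ∈ I ^ (n + 1) := Ideal.mul_le_right hq
  have h3 : reesMonomial (n + 1) (p + q) hc = g + reesMonomial (n + 1) q hqI := by
    apply Subtype.ext
    rw [AddMemClass.coe_add, hgp, coe_reesMonomial, coe_reesMonomial, map_add]
  rw [h3]
  refine Submodule.add_mem_sup hg ((mem_map_reesAlgebra_iff _ _ _).mpr fun k => ?_)
  rw [coe_reesMonomial, coeff_monomial]
  split_ifs with hk
  · rw [← hk]
    exact hq
  · exact zero_mem _

/-- The regularity of `a t` on `F(I) / (l t)` in each positive degree. -/
theorem mem_of_mul_mem_of_isWeaklyRegular [IsLocalRing R] {B : Type u} [CommRing B]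
    (π : reesAlgebra I →+* B) (hπ : Function.Surjective π)
    (hker : RingHom.ker π = (maximalIdeal R).map (algebraMap R (reesAlgebra I)))
    {l : List I} {a : I} (hw : IsWeaklyRegular B ((l ++ [a]).map fun c => π (reesDegreeOne I c)))
    {n : ℕ} {z : R} (hz : z ∈ I ^ (n + 1))
    (haz : (a : R) * z ∈ Ideal.ofList (l.map ((↑) : I → R)) * I ^ (n + 1) ⊔
      maximalIdeal R * I ^ (n + 2)) :
    z ∈ Ideal.ofList (l.map ((↑) : I → R)) * I ^ n ⊔ maximalIdeal R * I ^ (n + 1) := by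
  rw [List.map_append, List.map_singleton, isWeaklyRegular_append_singleton_iff] at hw
  have hmem : ∀ f, π f ∈ Ideal.ofList (l.map fun c => π (reesDegreeOne I c)) ↔
      f ∈ Ideal.ofList (l.map (reesDegreeOne I)) ⊔
        (maximalIdeal R).map (algebraMap R (reesAlgebra I)) := by
    intro f
    rw [← hker, RingHom.ker_eq_comap_bot, ← Ideal.comap_map_of_surjective π hπ, Ideal.mem_comap,
      Ideal.map_ofList, List.map_map]
    rfl
  have hazI : (a : R) * z ∈ I ^ (n + 1 + 1) := by
    rw [pow_succ']
    exact Ideal.mul_mem_mul a.2 hz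
  have h1 : reesDegreeOne I a * reesMonomial (n + 1) z hz =
      reesMonomial (n + 1 + 1) ((a : R) * z) hazI := by
    apply Subtype.ext
    change monomial 1 (a : R) * monomial (n + 1) z = monomial (n + 1 + 1) _
    rw [monomial_mul_monomial, add_comm 1]
  have h2 := (hmem _).mpr (reesMonomial_mem_ofList_sup_map hazI haz)
  rw [← h1, map_mul] at h2
  have h3 := coeff_mem_of_mem_ofList_sup_map ((hmem _).mp (hw.2 _ h2)) n
  rwa [coe_reesMonomial, coeff_monomial_same] at h3

/-- The mixed multiplicity `e_{d-1}` is the colength of a regular sequence consisting of `d - 1`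
elements of `I`, superficial for `𝔪` and `I`, and one general element `x` of `𝔪`. The hypothesis
says that the colength function modulo the first `d - 1` elements has degree one; the step by `x` is
a difference in the exponent of `𝔪`. -/
theorem exists_eq_colength_sup_span_singleton [IsLocalRing R] [Infinite (ResidueField R)] {d : ℕ}
    (hR : IsCohenMacaulayOfDim R d) (hrad : I.radical = maximalIdeal R) {rs : List R}
    (hrs : ∀ r ∈ rs, r ∈ maximalIdeal R) (hw : IsWeaklyRegular R rs) (hl : rs.length + 1 = d)
    {c : ℕ → ℕ → ℤ} (hc : IsEventuallyBinomialSum 1 c (fun r s =>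
      ((colength (Ideal.ofList rs ⊔ maximalIdeal R ^ r * I ^ s)).toNat : ℤ))) :
    ∃ x ∈ maximalIdeal R, (∀ z, x * z ∈ Ideal.ofList rs → z ∈ Ideal.ofList rs) ∧
      colength (Ideal.ofList rs ⊔ Ideal.span {x}) ≠ ⊤ ∧
      ((colength (Ideal.ofList rs ⊔ Ideal.span {x})).toNat : ℤ) = c 1 0 := by
  have := hR.isNoetherianRing
  have hmrad : (maximalIdeal R).radical = maximalIdeal R :=
    Ideal.IsPrime.radical inferInstance
  obtain ⟨k, hk⟩ := Ideal.exists_pow_le_of_le_radical_of_fg hrad.ge (IsNoetherian.noetherian _)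
  obtain ⟨𝒲, hfin, htop, h𝒲⟩ := exists_finite_forall_regular_superficial hR hmrad hk hrs hw
    (by omega)
  obtain ⟨x, hx⟩ := exists_forall_notMem_of_finite (R := R) (M := maximalIdeal R) hfin htop
  obtain ⟨hwx, s₀, hs₀⟩ := h𝒲 x hx
  obtain ⟨n, hn⟩ := hR.exists_pow_le_ofList_of_le_length hwx (by simp [hl])
  rw [ofList_append_singleton] at hn
  refine ⟨x, x.2, ((isWeaklyRegular_append_singleton_iff _ _).mp hwx).2, colength_ne_top hn, ?_⟩
  obtain ⟨N, hN⟩ := hc.exists_sub_eq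
  let r := max N (max s₀ n)
  have hr : n ≤ r := (le_max_right _ _).trans (le_max_right _ _)
  have hr' : s₀ ≤ r := (le_max_left _ _).trans (le_max_right _ _)
  have h1 := hN r N (le_max_left _ _) le_rfl
  obtain ⟨n', hn'⟩ := exists_pow_le_pow_mul_pow hrad (r + 1) N
  have h2 := toNat_colength_sup_eq_add (J := Ideal.ofList rs) (a := (x : R))
    (A := maximalIdeal R ^ (r + 1) * I ^ N) (A' := maximalIdeal R ^ r * I ^ N) (by
      intro z hz
      rw [pow_succ', mul_assoc]
      exact Ideal.mul_mem_mul x.2 hz) (by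
      intro z hz
      have h3 := hs₀ N r hr' z
      rw [mul_comm (I ^ N), mul_comm (I ^ N)] at h3
      exact h3 hz) hn'
  -- `R / (J + x R)` has finite length, so a high power of `𝔪` no longer contributes
  have h4 : Ideal.ofList rs ⊔ Ideal.span {(x : R)} ⊔ maximalIdeal R ^ (r + 1) * I ^ N =
      Ideal.ofList rs ⊔ Ideal.span {(x : R)} :=
    sup_eq_left.mpr (Ideal.mul_le_left.trans ((Ideal.pow_le_pow_right (by omega)).trans hn))
  rw [h4] at h2
  linarith

/-- For all large `n` the length of `Iⁿ⁺¹ / (J Iⁿ + 𝔪 Iⁿ⁺¹)` is at most `ℓ(R / (J + x R))`, by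
comparison with `Iⁿ⁺¹ / x Iⁿ⁺¹` modulo `J`. -/
theorem relLength_le_colength [IsLocalRing R] [IsNoetherianRing R]
    (hrad : I.radical = maximalIdeal R) {J : Ideal R}
    {x : R} (hx : x ∈ maximalIdeal R) (hxJ : ∀ z, x * z ∈ J → z ∈ J) {n : ℕ}
    (hn : J ⊓ I ^ (n + 1) ≤ J * I ^ n) :
    relLength (I ^ (n + 1)) (J * I ^ n ⊔ maximalIdeal R * I ^ (n + 1)) ≤
      colength (J ⊔ Ideal.span {x}) := by
  have hle : maximalIdeal R * I ^ (n + 1) ⊔ J ≤ I ^ (n + 1) ⊔ J :=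
    sup_le_sup_right Ideal.mul_le_right _
  have h1 := (relLength_le_relLength (X := I ^ (n + 1))
    (Y := J * I ^ n ⊔ maximalIdeal R * I ^ (n + 1)) (X' := I ^ (n + 1) ⊔ J)
    (Y' := maximalIdeal R * I ^ (n + 1) ⊔ J) (a := 1) (by
      intro z hz
      rw [one_mul]
      exact Submodule.mem_sup_left hz) (by
      intro z hz
      rw [one_mul]
      constructor
      · intro h
        obtain ⟨p, hp, j, hj, rfl⟩ := Submodule.mem_sup.mp h
        rw [add_comm p j] at hz ⊢
        refine Submodule.add_mem_sup (hn ⟨hj, ?_⟩) hp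
        have : j = (j + p) - p := by ring
        rw [this]
        exact sub_mem hz (Ideal.mul_le_right hp)
      · intro h
        have hJn : J * I ^ n ⊔ maximalIdeal R * I ^ (n + 1) ≤ maximalIdeal R * I ^ (n + 1) ⊔ J :=
          sup_le (Ideal.mul_le_left.trans le_sup_right) le_sup_left
        exact hJn h)).1
  refine h1.trans ?_
  have h2 := colength_eq_add_relLength hle
  have h3 : colength (maximalIdeal R * I ^ (n + 1) ⊔ J) ≤
      colength (Ideal.span {x} * I ^ (n + 1) ⊔ J) :=
    colength_anti (sup_le_sup_right
      (Ideal.mul_mono_left ((Ideal.span_singleton_le_iff_mem _).mpr hx)) _)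
  have h4 : colength (Ideal.span {x} * I ^ (n + 1) ⊔ J) = colength (I ^ (n + 1) ⊔ J) +
      colength (Ideal.span {x} * I ^ (n + 1) ⊔ J ⊔ Ideal.span {x}) := by
    refine colength_eq_add fun z => ⟨fun hz => ?_, fun hz => ?_⟩
    · obtain ⟨p, hp, j, hj, rfl⟩ := Submodule.mem_sup.mp hz
      rw [mul_add]
      exact Submodule.add_mem_sup (Ideal.mul_mem_mul (Ideal.mem_span_singleton_self x) hp)
        (Ideal.mul_mem_left _ _ hj)
    · obtain ⟨p, hp, j, hj, hz⟩ := Submodule.mem_sup.mp hz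
      obtain ⟨w, hw, rfl⟩ := Ideal.mem_span_singleton_mul.mp hp
      have h5 : z - w ∈ J := by
        apply hxJ
        have h6 : x * (z - w) = j := by linear_combination -hz
        rwa [h6]
      have h7 : z = w + (z - w) := by ring
      rw [h7]
      exact Submodule.add_mem_sup hw h5
  have h8 : colength (Ideal.span {x} * I ^ (n + 1) ⊔ J ⊔ Ideal.span {x}) ≤
      colength (J ⊔ Ideal.span {x}) := colength_anti (sup_le_sup_right le_sup_right _)
  obtain ⟨k, hk⟩ := exists_pow_le_pow_mul_pow hrad 0 (n + 1)
  rw [pow_zero, one_mul] at hk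
  have h9 : colength (I ^ (n + 1) ⊔ J) ≠ ⊤ := colength_ne_top (hk.trans le_sup_left)
  rw [h2, h4, add_comm] at h3
  exact ((ENat.add_le_add_iff_left h9).mp h3).trans h8

/-- An ideal of minimal mixed multiplicity with Cohen–Macaulay fiber cone has reduction number at
most one. The lengths of `Iⁿ / (J Iⁿ⁻¹ + 𝔪 Iⁿ)` are at least `e` for `n = 1`, at most `e` for large
`n`, and nondecreasing, since multiplication by the last general element is injective on them; so it
is bijective. -/
theorem exists_isWeaklyRegular_sq_le_mul [IsLocalRing R] [Infinite (ResidueField R)] {d : ℕ}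
    (hd : 1 ≤ d) (hR : IsCohenMacaulayOfDim R d)
    (hrad : I.radical = maximalIdeal R) {B : Type u} [CommRing B] [IsNoetherianRing B]
    (hB : IsCohenMacaulayRing B)
    (π : reesAlgebra I →+* B) (hπ : Function.Surjective π)
    (hker : RingHom.ker π = (maximalIdeal R).map (algebraMap R (reesAlgebra I)))
    {e : ℕ → ℕ → ℤ} (he : IsBhattacharyaCoeff d I e)
    (hmin : (Submodule.spanFinrank I : ℤ) = e 1 (d - 1) + (d : ℤ) - 1) :
    ∃ l : List I, l.length = d ∧ IsWeaklyRegular R (l.map ((↑) : I → R)) ∧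
      I ^ 2 ≤ Ideal.ofList (l.map ((↑) : I → R)) * I := by
  have := hR.isNoetherianRing
  have hIm : I ≤ maximalIdeal R := hrad ▸ Ideal.le_radical
  obtain ⟨l, hl, hw, hwB, ⟨N, hN⟩, hsum⟩ :=
    exists_list_superficial hR hrad hB π hπ hker he (d - 1) (by omega)
  obtain ⟨a, ha, haB, -⟩ := exists_isWeaklyRegular_append_of_infinite hR hrad hB π hπ hker
    (l := l) (by omega) hw hwB
  rw [show d - (d - 1) = 1 by omega] at hsum
  obtain ⟨x, hxm, hxJ, hxfin, hx⟩ := exists_eq_colength_sup_span_singleton hR hrad (by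
    intro r hr
    obtain ⟨c, -, rfl⟩ := List.mem_map.mp hr
    exact hIm c.2) hw (by simp only [List.length_map]; omega) hsum
  simp only [zero_add] at hx
  have hof : Ideal.ofList ((l ++ [a]).map ((↑) : I → R)) =
      Ideal.ofList (l.map ((↑) : I → R)) ⊔ Ideal.span {(a : R)} := by
    rw [List.map_append, List.map_singleton, ofList_append_singleton]
  refine ⟨l ++ [a], by simp only [List.length_append, List.length_singleton]; omega, ha, ?_⟩
  rw [hof]
  have hJI : Ideal.ofList (l.map ((↑) : I → R)) ≤ I := Ideal.span_le.mpr fun r hr => by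
    obtain ⟨c, -, rfl⟩ := List.mem_map.mp hr
    exact c.2
  set J := Ideal.ofList (l.map ((↑) : I → R)) with hJ
  -- indices are shifted by one: `H n` is the length of `Iⁿ⁺¹ / (J Iⁿ + 𝔪 Iⁿ⁺¹)`
  let H : ℕ → ℕ∞ := fun n => relLength (I ^ (n + 1)) (J * I ^ n ⊔ maximalIdeal R * I ^ (n + 1))
  have hstep : ∀ n, H n ≤ H (n + 1) ∧ (H (n + 1) ≤ H n → H n ≠ ⊤ → I ^ (n + 1 + 1) ≤
      Ideal.span {(a : R)} * I ^ (n + 1) ⊔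
        (J * I ^ (n + 1) ⊔ maximalIdeal R * I ^ (n + 1 + 1))) := by
    intro n
    refine relLength_le_relLength (fun z hz => ?_) (fun z hz => ⟨fun h => ?_, fun h => ?_⟩)
    · rw [pow_succ']
      exact Ideal.mul_mem_mul a.2 hz
    · exact mem_of_mul_mem_of_isWeaklyRegular π hπ hker haB hz h
    · obtain ⟨p, hp, q, hq, rfl⟩ := Submodule.mem_sup.mp h
      rw [mul_add]
      refine Submodule.add_mem_sup ?_ ?_
      · rw [pow_succ', mul_left_comm]
        exact Ideal.mul_mem_mul a.2 hp
      · rw [pow_succ' I (n + 1), mul_left_comm]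
        exact Ideal.mul_mem_mul a.2 hq
  have hmono : Monotone H := monotone_nat_of_le_succ fun n => (hstep n).1
  have hbound : ∀ n, H n ≤ colength (J ⊔ Ideal.span {x}) := fun n =>
    (hmono (le_max_left n N)).trans (relLength_le_colength hrad hxm hxJ (hN _ (le_max_right n N)))
  have hlow : colength (J ⊔ Ideal.span {x}) ≤ H 0 := by
    have hVI : J * I ^ 0 ⊔ maximalIdeal R * I ^ (0 + 1) ≤ I ^ (0 + 1) := by
      rw [pow_zero, mul_one, zero_add, pow_one]
      exact sup_le hJI Ideal.mul_le_right
    have h1 := colength_eq_add_relLength hVI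
    have h2 := spanFinrank_le_of_le_sup (I := I) (V := J * I ^ 0 ⊔ maximalIdeal R * I ^ (0 + 1))
      (l := l) (by simpa using hVI) (by rw [pow_zero, mul_one, zero_add, pow_one])
    rw [h1, zero_add, pow_one, ← add_assoc] at h2
    obtain ⟨k, hk⟩ := exists_pow_le_pow_mul_pow hrad 0 1
    rw [pow_zero, one_mul, pow_one] at hk
    have h3 := (ENat.add_le_add_iff_right (colength_ne_top hk)).mp h2
    have h4 : (Submodule.spanFinrank I : ℕ∞) ≤ l.length + H 0 := by
      refine h3.trans_eq ?_
      simp only [H, zero_add, pow_one]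
    have h5 : Submodule.spanFinrank I = l.length + (colength (J ⊔ Ideal.span {x})).toNat := by
      omega
    rw [h5, Nat.cast_add, ENat.natCast_toNat hxfin] at h4
    exact (ENat.add_le_add_iff_left (ENat.natCast_ne_top _)).mp h4
  -- equality at the first step makes multiplication by `a` surjective there
  have h6 := (hstep 0).2 ((hbound 1).trans hlow) (ne_top_of_le_ne_top hxfin (hbound 0))
  refine Submodule.le_of_le_smul_of_le_jacobson_bot (IsNoetherian.noetherian _)
    (maximalIdeal_le_jacobson _) ?_
  refine h6.trans ?_
  rw [← sup_assoc, ← Ideal.sup_mul, zero_add, pow_one, sup_comm (Ideal.span {(a : R)})]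
  exact le_rfl

end ReductionNumber

/-! ### Ideals of minimal mixed multiplicity -/

section MinimalMixedMultiplicity

variable {R : Type u} [CommRing R] [IsLocalRing R]

/-- `exists_isWeaklyRegular_sq_le_mul` for the fiber cone and the mixed multiplicity. -/
theorem exists_isWeaklyRegular_sq_le_mul_of_hasMinimalMixedMultiplicity
    [Infinite (ResidueField R)] (hR : IsCohenMacaulayLocalRing R) {d : ℕ}
    (hdim : ringKrullDim R = d) (hd : 1 ≤ d) {I : Ideal R} (hI : I.radical = maximalIdeal R)
    (hmin : HasMinimalMixedMultiplicity d I) (hF : IsCohenMacaulayRing (FiberCone I)) :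
    ∃ l : List I, l.length = d ∧ IsWeaklyRegular R (l.map ((↑) : I → R)) ∧
      I ^ 2 ≤ Ideal.ofList (l.map ((↑) : I → R)) * I := by
  have := hR.1
  obtain ⟨n, hn⟩ := isCohenMacaulayLocalRing_iff.mp hR
  obtain rfl : n = d := by
    have := hn.ringKrullDim_eq.symm.trans hdim
    exact_mod_cast this
  by_cases h : ∃ e, IsBhattacharyaCoeff n I e
  · obtain ⟨e, he⟩ := h
    rw [HasMinimalMixedMultiplicity, he.mixedMultiplicity_eq (by omega),
      show n - (n - 1) = 1 by omega] at hmin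
    have hB : IsNoetherianRing (FiberCone I) := hF.1
    exact exists_isWeaklyRegular_sq_le_mul hd hn hI hF (Ideal.Quotient.mk _)
      Ideal.Quotient.mk_surjective Ideal.mk_ker he hmin
  · -- without Bhattacharya coefficients, the mixed multiplicity is the default value zero, and
    -- an ideal of height `n` would have `n - 1` generators
    exfalso
    rw [HasMinimalMixedMultiplicity, mixedMultiplicity, dif_neg h] at hmin
    have h1 : maximalIdeal R ∈ I.minimalPrimes := by
      refine ⟨⟨inferInstance, hI ▸ Ideal.le_radical⟩, ?_⟩
      rintro Q ⟨hQ, hQle⟩ -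
      rw [← hI]
      exact (Ideal.IsPrime.radical_le_iff hQ).mpr hQle
    have h2 : (maximalIdeal R).height ≤ (Submodule.spanFinrank I : ℕ∞) := by
      have h6 := Ideal.height_le_spanRank_toENat_of_mem_minimalPrimes I _ h1
      rwa [Submodule.fg_iff_spanRank_eq_spanFinrank.mpr (IsNoetherian.noetherian I),
        map_natCast] at h6
    have h3 := IsLocalRing.maximalIdeal_height_eq_ringKrullDim (R := R)
    rw [hdim] at h3
    have h4 : (maximalIdeal R).height = n := by exact_mod_cast h3
    rw [h4] at h2
    have h5 : n ≤ Submodule.spanFinrank I := by exact_mod_cast h2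
    omega

end MinimalMixedMultiplicity

end BlowupAlgebras

theorem mainTheorem4 {R : Type*} [CommRing R] [IsLocalRing R]
    [Infinite (IsLocalRing.ResidueField R)]
    (hR : BlowupAlgebras.IsCohenMacaulayLocalRing R)
    (d : ℕ) (hdim : ringKrullDim R = d) (hd : 2 ≤ d)
    (I : Ideal R) (hI : I.radical = IsLocalRing.maximalIdeal R)
    (hmin : BlowupAlgebras.HasMinimalMixedMultiplicity d I)
    (hF : BlowupAlgebras.IsCohenMacaulayRing (BlowupAlgebras.FiberCone I)) :
    BlowupAlgebras.IsCohenMacaulayRing (BlowupAlgebras.AssociatedGradedRing I) ∧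
      BlowupAlgebras.IsCohenMacaulayRing (reesAlgebra I) := by
  obtain ⟨l, hl, hw, hsq⟩ :=
    BlowupAlgebras.exists_isWeaklyRegular_sq_le_mul_of_hasMinimalMixedMultiplicity hR hdim
      (by omega) hI hmin hF
  have := hR.1
  subst hl
  have hof : List.ofFn (fun i => (l.get i : R)) = l.map ((↑) : I → R) := by
    rw [List.ofFn_comp', List.ofFn_get]
  have hspan : Ideal.span (Set.range fun i => (l.get i : R)) =
      Ideal.ofList (l.map ((↑) : I → R)) := by
    rw [← hof]
    exact congrArg Ideal.span (Set.ext fun x => List.mem_ofFn.symm)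
  rw [← hspan] at hsq
  rw [← hof] at hw
  refine ⟨BlowupAlgebras.isCohenMacaulayRing_associatedGradedRing hI (fun i => (l.get i).2)
    ?_ hsq, BlowupAlgebras.isCohenMacaulayRing_reesAlgebra hR hI hd (fun i => (l.get i).2) hw hsq⟩
  refine IsLocalRing.isWeaklyRegular_of_perm_of_subset_maximalIdeal hw (List.reverse_perm _).symm ?_
  intro r hr
  obtain ⟨i, rfl⟩ := List.mem_ofFn.mp hr
  exact hI ▸ Ideal.le_radical (l.get i).2
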